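/- Fix $r\in(0,\infty)$ and put $v=(1+r^{-1})^{-1}$. For $\theta\in\mathbb R^n$ let $X\sim N_n(\theta,I)$ and $Y\sim N_n(\theta,rI)$ be independent. A predictive density estimate $\hat p(y\mid x)$ is a jointly measurable function such that $\hat p(\cdot\mid x)$ is a probability density on $\mathbb R^n$ for every $x$; its Kullback–Leibler risk is $$\rho(\theta,\hat p)=\int p(x\mid\theta,1)\int p(y\mid\theta,r)\log\frac{p(y\mid\theta,r)}{\hat p(y\mid x)}\,dy\,dx\in[0,\infty],$$ where $p(\cdot\mid\theta,w)$ is the $N_n(\theta,wI)$ density. Let $\Theta_n[s]=\{\theta\in\mathbb R^n:\#\{i:\theta_i\neq0\}\le s\}$ and $R_N(\Theta)=\inf_{\hat p}\sup_{\theta\in\Theta}\rho(\theta,\hat p)$, the infimum being over all predictive density estimates. For $\eta\in(0,1)$ let $\lambda=\sqrt{2\log\eta^{-v}}$ and let $$\nu^+=(1-\eta^v)\sum_{j\ge1}\eta^{(j-1)v}\delta_{\lambda j},\qquad \pi_G[\eta]=(1-\eta)\delta_0+\tfrac12\eta(\nu^++\nu^-),$$ where $\nu^-$ is the reflection of $\nu^+$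 about $0$. For a sequence $s_n$ with $s_n\ge1$ for all large $n$, let $\eta_n=s_n/n$ and let $\hat p_G(y\mid x)=\int p(y\mid\theta,r)\,\pi(d\theta\mid x)$ be the Bayes predictive density on $\mathbb R^n$ for the product prior $\pi=\pi_G[\eta_n]^{\otimes n}$ (defined when $0<\eta_n<1$). Put $$h_r=\frac{(1+2r)(1-2r-4r^2)}{4(1+r)^2},\qquad h_r^+=\max(h_r,0),\qquad r_0=\frac{\sqrt5-1}{4}.$$ **Theorem.** If $\eta_n\to0$ as $n\to\infty$, then $0<R_N(\Theta_n[s_n])<\infty$ for all large $n$ and $$\sup_{\theta\in\Theta_n[s_n]}\rho(\theta,\hat p_G)=R_N(\Theta_n[s_n])\,\bigl(1+h_r^++o(1)\bigr).$$ Consequently the ratio $\sup_{\Theta_n[s_n]}\rho(\theta,\hat p_G)/R_N(\Theta_n[s_n])$ tends to $1$ if and only if $r\ge r_0$. If $r<r_0$, it tends to $1+h_r$, where $1<1+h_r\le 5/4$. For every $r$, the maximum risk of $\hat p_G$ is at most $1.25$ times $R_N(\Theta_n[s_n])$ for all large $n$. -/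

import Mathlib

open MeasureTheory ProbabilityTheory Filter Topology
open scoped ENNReal NNReal

noncomputable section

namespace SparsePrediction

/-- The Gaussian law `N_n(θ, w I)` on `ℝⁿ`. -/
def gaussLaw {n : ℕ} (θ : Fin n → ℝ) (w : ℝ≥0) : Measure (Fin n → ℝ) :=
  Measure.pi fun i => gaussianReal (θ i) w

/-- The Lebesgue density `p(y | θ, w)` of `N_n(θ, w I)` (for `w > 0`). -/
def gaussDensity {n : ℕ} (θ : Fin n → ℝ) (w : ℝ≥0) (y : Fin n → ℝ) : ℝ≥0∞ :=
  ∏ i, gaussianPDF (θ i) w (y i)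

/-- `p x y` is a predictive density estimate `p̂(y | x)`: it is jointly measurable and
`p x` is a probability density with respect to Lebesgue measure for every `x`. -/
structure IsPDE {n : ℕ} (p : (Fin n → ℝ) → (Fin n → ℝ) → ℝ≥0∞) : Prop where
  measurable : Measurable (Function.uncurry p)
  lintegral_eq_one : ∀ x, ∫⁻ y, p x y = 1

/-- The Kullback-Leibler loss `∫ p(y | θ, r) log (p(y | θ, r) / q(y)) dy ∈ [0, ∞]` of a
density `q`, where the future observation has law `N_n(θ, r I)`. -/
def loss {n : ℕ} (r : ℝ≥0) (θ : Fin n → ℝ) (q : (Fin n → ℝ) → ℝ≥0∞) : ℝ≥0∞ :=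
  InformationTheory.klDiv (gaussLaw θ r) (volume.withDensity q)

/-- The risk `ρ(θ, p̂)`: the loss averaged over the past observation `X ∼ N_n(θ, I)`. -/
def risk {n : ℕ} (r : ℝ≥0) (θ : Fin n → ℝ)
    (p : (Fin n → ℝ) → (Fin n → ℝ) → ℝ≥0∞) : ℝ≥0∞ :=
  ∫⁻ x, loss r θ (p x) ∂(gaussLaw θ 1)

/-- The maximum risk of `p̂` over `Θ`. -/
def maxRisk {n : ℕ} (r : ℝ≥0) (Θ : Set (Fin n → ℝ))
    (p : (Fin n → ℝ) → (Fin n → ℝ) → ℝ≥0∞) : ℝ≥0∞ :=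
  ⨆ θ ∈ Θ, risk r θ p

/-- The minimax risk `R_N(Θ)`, the infimum being over all predictive density estimates. -/
def klMinimaxRisk {n : ℕ} (r : ℝ≥0) (Θ : Set (Fin n → ℝ)) : ℝ≥0∞ :=
  ⨅ (p : (Fin n → ℝ) → (Fin n → ℝ) → ℝ≥0∞) (_ : IsPDE p), maxRisk r Θ p

/-- `Θ_n[s]`: the vectors in `ℝⁿ` with at most `s` nonzero coordinates. -/
def sparseSet (n : ℕ) (s : ℝ) : Set (Fin n → ℝ) :=
  {θ | (hammingNorm θ : ℝ) ≤ s}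

/-- The posterior `π(dθ | x)` for a prior `π` and an observation `x` of `N_n(θ, I)`. -/
def posteriorLaw {n : ℕ} (π : Measure (Fin n → ℝ)) (x : Fin n → ℝ) : Measure (Fin n → ℝ) :=
  (∫⁻ θ, gaussDensity θ 1 x ∂π)⁻¹ • π.withDensity fun θ => gaussDensity θ 1 x

/-- The Bayes predictive density `p̂_π(y | x) = ∫ p(y | θ, r) π(dθ | x)`. -/
def bayesPDE {n : ℕ} (r : ℝ≥0) (π : Measure (Fin n → ℝ)) (x y : Fin n → ℝ) : ℝ≥0∞ :=
  ∫⁻ θ, gaussDensity θ r y ∂(posteriorLaw π x)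

/-- The oracle variance `v = (1 + r⁻¹)⁻¹`. -/
def oracleVar (r : ℝ≥0) : ℝ := (1 + (r : ℝ)⁻¹)⁻¹

/-- The spacing `λ(η) = √(2 log η^{-v})`. -/
def gridSpacing (r : ℝ≥0) (η : ℝ) : ℝ :=
  √(2 * Real.log (η ^ (-oracleVar r)))

/-- `ν⁺ = (1 - η^v) ∑_{j ≥ 1} η^{(j-1)v} δ_{λ j}`; the index `k` below is `j - 1`. -/
def gridPos (r : ℝ≥0) (η : ℝ) : Measure ℝ :=
  Measure.sum fun k : ℕ =>
    ENNReal.ofReal ((1 - η ^ oracleVar r) * η ^ ((k : ℝ) * oracleVar r)) •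
      Measure.dirac (gridSpacing r η * ((k : ℝ) + 1))

/-- The univariate sparse grid prior `(1 - η) δ₀ + (η / 2) (ν⁺ + ν⁻)`, where `ν⁻` is the
reflection of `ν⁺`. -/
def gridPrior (r : ℝ≥0) (η : ℝ) : Measure ℝ :=
  ENNReal.ofReal (1 - η) • Measure.dirac 0 +
    ENNReal.ofReal (η / 2) • (gridPos r η + (gridPos r η).map fun t => -t)

/-- The Bayes predictive density for `n` independent draws from the sparse grid prior. -/
def gridPDE (r : ℝ≥0) (n : ℕ) (η : ℝ) : (Fin n → ℝ) → (Fin n → ℝ) → ℝ≥0∞ :=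
  bayesPDE r (Measure.pi fun _ : Fin n => gridPrior r η)

/-- The maximum risk over `Θ_n[s]` of the grid-prior Bayes predictive density, `η = s / n`. -/
def gridMaxRisk (r : ℝ≥0) (n : ℕ) (s : ℝ) : ℝ≥0∞ :=
  maxRisk r (sparseSet n s) (gridPDE r n (s / n))

/-- `h_r = (1 + 2r) (1 + r)^{-2} (1 - 2r - 4r²) / 4`. -/
def hConst (r : ℝ≥0) : ℝ :=
  (1 + 2 * (r : ℝ)) * ((1 + (r : ℝ)) ^ 2)⁻¹ * (1 - 2 * (r : ℝ) - 4 * (r : ℝ) ^ 2) / 4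

/-- The critical variance ratio `r₀ = (√5 - 1) / 4`. -/
def rCrit : ℝ := (√5 - 1) / 4

end SparsePrediction

end

open SparsePrediction

namespace SparsePrediction

/-! ### Products of one-dimensional measures -/

/-! Write c = 1 + 1/r, so that cv = 1 and log(1/η) = cλ²/2. For a product prior the posterior
factorizes and the loss is additive over coordinates, so the risk is a sum of univariate risks
(`risk_bayesPDE_pi`). By `uniRisk_eq` the univariate risk at θ is θ²/(2r) - E log T_c(X + Y/r) + E
log T_1(X), where T_c is `tiltMass` at c.

For a grid prior, T is a sum of exponentials with quadratically decaying exponents, so log T equals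
its largest exponent up to terms that are O(λ) in mean. At θ = λt the risk is then bounded by λ²/2
times a deterministic profile in t. Put the positive atoms at λ(1 + bk), with weights of ratio
η^(b²v), and write t = 1 + b(K + u) with 0 ≤ u ≤ 1. The geometric weights are tuned so that atom K,
just below t, is the best positive atom in T_1. In T_c atom K is overtaken by K + 1 once u exceeds
u₀ = (1 + v)/2 when b = 1. The critical point of the profile is therefore K = 0, u = u₀, where the
risk is at least (λ²/2)(1 + h_r)/r up to O(λ) (`le_uniRisk_gridPrior`), and no θ exceeds (λ²/2)(1 +
h_r⁺)/r by more than O(λ) (`uniRisk_gridPrior_le`). The zero coordinates cost only O(s) in total.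

The minimax risk is asymptotic to ⌊s⌋λ²/(2r). From above, shrinking the spacing to bλ while keeping
the first atom at λ bounds the profile by (1 + b²)/r (`uniRisk_scaledGridPrior_le_one_add_sq`), and
b is arbitrarily small. From below, split the coordinates into ⌊s⌋ blocks and place in each block
one spike of height λ at a uniformly random position. The height λ is critical: the expected joint
log-likelihood ratio of the spike equals log(n/s), about the log of the block size, so even the pair
(x, y) barely locates it. A Gibbs variational inequality (`ofReal_integral_add_one_le_klDiv_add`),
averaged over the mixture (`ofReal_le_maxRisk`), turns this into a bound of λ²/(2r) - O(λ) per
block. -/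

theorem lintegral_pi_prod {n : ℕ} (μ : Fin n → Measure ℝ) [∀ i, SigmaFinite (μ i)]
    (f : Fin n → ℝ → ℝ≥0∞) (hf : ∀ i, Measurable (f i)) :
    ∫⁻ x, ∏ i, f i (x i) ∂Measure.pi μ = ∏ i, ∫⁻ t, f i t ∂μ i := by
  induction n with
  | zero => simp
  | succ n ih =>
    have hmp := (measurePreserving_piFinSuccAbove μ 0).symm
    rw [← hmp.lintegral_comp_emb (MeasurableEquiv.measurableEmbedding _)]
    simp only [MeasurableEquiv.piFinSuccAbove_symm_apply, Fin.insertNthEquiv,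
      Fin.prod_univ_succ, Fin.insertNth_zero, Equiv.coe_fn_mk, Fin.cons_succ, Fin.cons_zero,
      Fin.zero_succAbove, cast_eq]
    rw [lintegral_prod_mul (f := fun a => f 0 a)
      (g := fun b : (j : Fin n) → ℝ => ∏ i, f i.succ (b i)) (hf 0).aemeasurable
      (Finset.measurable_prod _ fun i _ => (hf i.succ).comp (measurable_pi_apply i)).aemeasurable,
      ih (fun j => μ j.succ) (fun j => f j.succ) (fun j => hf j.succ)]

theorem measurable_gaussDensity {n : ℕ} (θ : Fin n → ℝ) (w : ℝ≥0) :
    Measurable (gaussDensity θ w) :=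
  Finset.measurable_prod _ fun i _ => (measurable_gaussianPDF _ _).comp (measurable_pi_apply i)

theorem withDensity_pi_prod {n : ℕ} (f : Fin n → ℝ → ℝ≥0∞) (hf : ∀ i, Measurable (f i))
    [∀ i, SigmaFinite ((volume : Measure ℝ).withDensity (f i))] :
    (volume : Measure (Fin n → ℝ)).withDensity (fun x => ∏ i, f i (x i)) =
      Measure.pi fun i => (volume : Measure ℝ).withDensity (f i) := by
  refine (Measure.pi_eq fun s hs => ?_).symm
  rw [withDensity_apply _ (MeasurableSet.univ_pi hs), ← lintegral_indicator (.univ_pi hs)]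
  have : ∀ x : Fin n → ℝ, (Set.univ.pi s).indicator (fun x => ∏ i, f i (x i)) x
      = ∏ i, (s i).indicator (f i) (x i) := by
    intro x
    by_cases hx : x ∈ Set.univ.pi s
    · rw [Set.indicator_of_mem hx]
      exact Finset.prod_congr rfl fun i _ =>
        (Set.indicator_of_mem (hx i (Set.mem_univ i)) _).symm
    · rw [Set.indicator_of_notMem hx]
      simp only [Set.mem_univ_pi, not_forall] at hx
      obtain ⟨i, hi⟩ := hx
      exact (Finset.prod_eq_zero (Finset.mem_univ i) (Set.indicator_of_notMem hi _)).symm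
  simp_rw [this]
  rw [volume_pi, lintegral_pi_prod _ _ fun i => (hf i).indicator (hs i)]
  exact Finset.prod_congr rfl fun i _ => by
    rw [withDensity_apply _ (hs i), lintegral_indicator (hs i)]

theorem gaussLaw_eq_withDensity {n : ℕ} (θ : Fin n → ℝ) {w : ℝ≥0} (hw : w ≠ 0) :
    gaussLaw θ w = volume.withDensity (gaussDensity θ w) := by
  have h : ∀ i, (volume : Measure ℝ).withDensity (gaussianPDF (θ i) w) = gaussianReal (θ i) w :=
    fun i => (gaussianReal_of_var_ne_zero _ hw).symm
  have : ∀ i, SigmaFinite ((volume : Measure ℝ).withDensity (gaussianPDF (θ i) w)) := by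
    intro i; rw [h i]; infer_instance
  have := withDensity_pi_prod (fun i => gaussianPDF (θ i) w) fun i => measurable_gaussianPDF _ _
  unfold gaussLaw gaussDensity
  rw [this]
  simp_rw [h]

instance {n : ℕ} (θ : Fin n → ℝ) (w : ℝ≥0) : IsProbabilityMeasure (gaussLaw θ w) := by
  unfold gaussLaw; infer_instance

/-! ### Kullback-Leibler divergences -/

/-- Since g is positive and finite everywhere, f/g is a version of the Radon-Nikodym derivative, and
equal total masses cancel the correction term of `klDiv`. Nonnegativity is recorded because
`ENNReal.ofReal` would otherwise hide the sign when the loss is integrated. -/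
theorem klDiv_withDensity_of_pos {α : Type*} [MeasurableSpace α] {m : Measure α} [SigmaFinite m]
    {f g : α → ℝ≥0∞} (hf : Measurable f) (hg : Measurable g)
    (hf1 : ∫⁻ x, f x ∂m = 1) (hg1 : ∫⁻ x, g x ∂m = 1)
    (hg0 : ∀ x, g x ≠ 0) (hgt : ∀ x, g x ≠ ∞)
    (hint : Integrable (fun x => Real.log (f x / g x).toReal) (m.withDensity f)) :
    0 ≤ ∫ x, Real.log (f x / g x).toReal ∂(m.withDensity f) ∧
    InformationTheory.klDiv (m.withDensity f) (m.withDensity g) =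
      ENNReal.ofReal (∫ x, Real.log (f x / g x).toReal ∂(m.withDensity f)) := by
  have hfp : IsProbabilityMeasure (m.withDensity f) :=
    ⟨by rw [withDensity_apply _ .univ, Measure.restrict_univ, hf1]⟩
  have hgp : IsProbabilityMeasure (m.withDensity g) :=
    ⟨by rw [withDensity_apply _ .univ, Measure.restrict_univ, hg1]⟩
  have hfg : m.withDensity f = (m.withDensity g).withDensity (f / g) := by
    rw [← withDensity_mul _ hg (hf.div hg)]
    congr 1
    ext x
    simp only [Pi.mul_apply, Pi.div_apply]
    exact (ENNReal.mul_div_cancel (hg0 x) (hgt x)).symm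
  have hac : m.withDensity f ≪ m.withDensity g := by
    rw [hfg]; exact withDensity_absolutelyContinuous _ _
  have hrn : (m.withDensity f).rnDeriv (m.withDensity g) =ᵐ[m.withDensity f] f / g := by
    apply hac.ae_le
    nth_rewrite 1 [hfg]
    exact Measure.rnDeriv_withDensity _ (hf.div hg)
  have hllr : llr (m.withDensity f) (m.withDensity g)
      =ᵐ[m.withDensity f] fun x => Real.log (f x / g x).toReal := by
    filter_upwards [hrn] with x hx
    rw [llr, hx]; rfl
  have hI : Integrable (llr (m.withDensity f) (m.withDensity g)) (m.withDensity f) :=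
    (integrable_congr hllr).2 hint
  have h0 := InformationTheory.integral_llr_add_sub_measure_univ_nonneg hac hI
  have h1 := InformationTheory.klDiv_of_ac_of_integrable hac hI
  rw [integral_congr_ae hllr] at h0 h1
  simp only [probReal_univ, add_sub_cancel_right] at h0 h1
  exact ⟨h0, h1⟩

/-- Gibbs variational bound: apply 1 + a ≤ exp a to a = g - log(dμ/dν) and integrate against μ.
Keeping the exponential integral, instead of its logarithm as in Donsker-Varadhan, makes the bound
linear in ν, so it can later be averaged over observations and spikes without Jensen. -/
theorem ofReal_integral_add_one_le_klDiv_add {α : Type*} [MeasurableSpace α] (μ ν : Measure α)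
    [IsProbabilityMeasure μ] [IsProbabilityMeasure ν] {g : α → ℝ} (hgm : Measurable g)
    (hg : Integrable g μ) :
    ENNReal.ofReal (∫ x, g x ∂μ + 1) ≤
      InformationTheory.klDiv μ ν + ∫⁻ x, ENNReal.ofReal (Real.exp (g x)) ∂ν := by
  by_cases hk : InformationTheory.klDiv μ ν = ∞
  · simp [hk]
  obtain ⟨hac, hI⟩ := InformationTheory.klDiv_ne_top_iff.1 hk
  rw [InformationTheory.klDiv_of_ac_of_integrable hac hI]
  simp only [probReal_univ, add_sub_cancel_right]
  have hpt : ∀ᵐ x ∂μ, g x + 1 - llr μ ν x ≤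
      Real.exp (g x) * (μ.rnDeriv ν x).toReal⁻¹ := by
    filter_upwards [Measure.rnDeriv_pos hac, hac.ae_le (Measure.rnDeriv_lt_top μ ν)] with x h0 ht
    have hp : 0 < (μ.rnDeriv ν x).toReal := ENNReal.toReal_pos h0.ne' ht.ne
    have := Real.add_one_le_exp (g x - llr μ ν x)
    rw [Real.exp_sub] at this
    have he : Real.exp (llr μ ν x) = (μ.rnDeriv ν x).toReal := Real.exp_log hp
    rw [he] at this
    rw [← div_eq_mul_inv]; linarith
  -- Only an inequality: the left side ignores the part of ν where dμ/dν vanishes.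
  have hle : ∫⁻ x, ENNReal.ofReal (Real.exp (g x) * (μ.rnDeriv ν x).toReal⁻¹) ∂μ ≤
      ∫⁻ x, ENNReal.ofReal (Real.exp (g x)) ∂ν := by
    have hm : Measurable fun x => ENNReal.ofReal (Real.exp (g x) * (μ.rnDeriv ν x).toReal⁻¹) :=
      ((Real.measurable_exp.comp hgm).mul
        (Measure.measurable_rnDeriv μ ν).ennreal_toReal.inv).ennreal_ofReal
    nth_rewrite 1 [← Measure.withDensity_rnDeriv_eq μ ν hac]
    rw [lintegral_withDensity_eq_lintegral_mul _ (Measure.measurable_rnDeriv μ ν) hm]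
    refine lintegral_mono_ae ?_
    filter_upwards [Measure.rnDeriv_lt_top μ ν] with x ht
    simp only [Pi.mul_apply]
    rcases eq_or_ne (μ.rnDeriv ν x) 0 with h0 | h0
    · simp [h0]
    · have hp : 0 < (μ.rnDeriv ν x).toReal := ENNReal.toReal_pos h0 ht.ne
      conv_lhs => enter [1]; rw [← ENNReal.ofReal_toReal ht.ne]
      rw [← ENNReal.ofReal_mul hp.le]
      apply ENNReal.ofReal_le_ofReal
      field_simp
      exact le_rfl
  have hint : Integrable (fun x => g x + 1 - llr μ ν x) μ :=
    (hg.add (integrable_const 1)).sub hI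
  have hsub : ENNReal.ofReal (∫ x, (g x + 1 - llr μ ν x) ∂μ) ≤
      ∫⁻ x, ENNReal.ofReal (Real.exp (g x)) ∂ν := by
    refine le_trans ?_ hle
    calc ENNReal.ofReal (∫ x, (g x + 1 - llr μ ν x) ∂μ)
        ≤ ENNReal.ofReal (∫ x, max (g x + 1 - llr μ ν x) 0 ∂μ) :=
          ENNReal.ofReal_le_ofReal (integral_mono hint hint.pos_part fun x => le_max_left _ _)
      _ = ∫⁻ x, ENNReal.ofReal (max (g x + 1 - llr μ ν x) 0) ∂μ :=
          ofReal_integral_eq_lintegral_ofReal hint.pos_part (ae_of_all _ fun x => le_max_right _ _)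
      _ ≤ _ := by
          refine lintegral_mono_ae ?_
          filter_upwards [hpt] with x hx
          exact ENNReal.ofReal_le_ofReal (max_le hx (by positivity))
  have heq : ∫ x, g x ∂μ + 1 = ∫ x, llr μ ν x ∂μ + ∫ x, (g x + 1 - llr μ ν x) ∂μ := by
    have h1 : ∫ x, (g x + 1) ∂μ = ∫ x, g x ∂μ + 1 := by
      rw [integral_add hg (integrable_const 1)]; simp
    have h2 : Integrable (fun x => g x + 1) μ := hg.add (integrable_const 1)
    rw [integral_sub h2 hI, h1]
    ring
  rw [heq]
  exact ENNReal.ofReal_add_le.trans (by gcongr)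

/-! ### Exponentially tilted mass of a prior -/

/-- `∫ exp (t s - c t² / 2) π(dt)`: up to a factor free of the prior, the marginal density at
`s / c` of a Gaussian observation with variance `1 / c`. -/
noncomputable def tiltMass (π : Measure ℝ) (c s : ℝ) : ℝ≥0∞ :=
  ∫⁻ t, ENNReal.ofReal (Real.exp (t * s - c * t ^ 2 / 2)) ∂π

/-- The logarithm of `tiltMass`. -/
noncomputable def logTilt (π : Measure ℝ) (c s : ℝ) : ℝ := Real.log (tiltMass π c s).toReal

section Tilt

variable {π : Measure ℝ} {c p : ℝ}

theorem measurable_tiltMass [SFinite π] (c : ℝ) : Measurable (tiltMass π c) := by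
  unfold tiltMass
  refine Measurable.lintegral_prod_right'
    (f := fun z : ℝ × ℝ => ENNReal.ofReal (Real.exp (z.2 * z.1 - c * z.2 ^ 2 / 2))) ?_
  fun_prop

theorem measurable_logTilt [SFinite π] (c : ℝ) : Measurable (logTilt π c) :=
  (measurable_tiltMass c).ennreal_toReal.log

/-- Completing the square bounds the integrand uniformly in t. With an atom at 0 for the lower
bound, the log-mass grows at most quadratically, which gives every integrability statement below. -/
theorem tiltMass_le [IsProbabilityMeasure π] (hc : 0 < c) (s : ℝ) :
    tiltMass π c s ≤ ENNReal.ofReal (Real.exp (s ^ 2 / (2 * c))) := by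
  calc tiltMass π c s ≤ ∫⁻ _, ENNReal.ofReal (Real.exp (s ^ 2 / (2 * c))) ∂π := by
        refine lintegral_mono fun t => ENNReal.ofReal_le_ofReal (Real.exp_le_exp.2 ?_)
        have : s ^ 2 / (2 * c) - (t * s - c * t ^ 2 / 2) = (s - c * t) ^ 2 / (2 * c) := by
          field_simp; ring
        have h2 : 0 ≤ (s - c * t) ^ 2 / (2 * c) := by positivity
        linarith
    _ = _ := by simp

theorem tiltMass_ne_top [IsProbabilityMeasure π] (hc : 0 < c) (s : ℝ) : tiltMass π c s ≠ ∞ :=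
  ((tiltMass_le hc s).trans_lt ENNReal.ofReal_lt_top).ne

theorem le_tiltMass_of_le_singleton {q t : ℝ} (hq0 : 0 ≤ q) (hq : ENNReal.ofReal q ≤ π {t})
    (c s : ℝ) :
    ENNReal.ofReal (q * Real.exp (t * s - c * t ^ 2 / 2)) ≤ tiltMass π c s := by
  calc ENNReal.ofReal (q * Real.exp (t * s - c * t ^ 2 / 2))
      ≤ π {t} * ENNReal.ofReal (Real.exp (t * s - c * t ^ 2 / 2)) := by
        rw [ENNReal.ofReal_mul hq0]; gcongr
    _ = ∫⁻ t' in {t}, ENNReal.ofReal (Real.exp (t' * s - c * t' ^ 2 / 2)) ∂π := by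
        rw [lintegral_singleton, mul_comm]
    _ ≤ _ := setLIntegral_le_lintegral _ _

/-- One atom already bounds the log-mass below by an affine function of s, whose Gaussian mean is
explicit. -/
theorem log_add_le_logTilt [IsProbabilityMeasure π] (hc : 0 < c) {q t : ℝ} (hq0 : 0 < q)
    (hq : ENNReal.ofReal q ≤ π {t}) (s : ℝ) :
    Real.log q + (t * s - c * t ^ 2 / 2) ≤ logTilt π c s := by
  have h := le_tiltMass_of_le_singleton hq0.le hq c s
  have hpos : 0 < q * Real.exp (t * s - c * t ^ 2 / 2) := by positivity
  rw [ENNReal.ofReal_le_iff_le_toReal (tiltMass_ne_top hc s)] at h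
  have := Real.log_le_log hpos h
  rwa [Real.log_mul hq0.ne' (Real.exp_pos _).ne', Real.log_exp] at this

theorem log_le_logTilt [IsProbabilityMeasure π] (hc : 0 < c) (hp0 : 0 < p)
    (hp : ENNReal.ofReal p ≤ π {0}) (s : ℝ) : Real.log p ≤ logTilt π c s := by
  simpa using log_add_le_logTilt hc hp0 hp s

theorem tiltMass_ne_zero (hp0 : 0 < p) (hp : ENNReal.ofReal p ≤ π {0}) (c s : ℝ) :
    tiltMass π c s ≠ 0 := by
  have := le_tiltMass_of_le_singleton hp0.le hp c s
  have h2 : 0 < ENNReal.ofReal (p * Real.exp (0 * s - c * 0 ^ 2 / 2)) :=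
    ENNReal.ofReal_pos.2 (by positivity)
  exact (h2.trans_le this).ne'

theorem logTilt_le [IsProbabilityMeasure π] (hc : 0 < c) (hp0 : 0 < p)
    (hp : ENNReal.ofReal p ≤ π {0}) (s : ℝ) : logTilt π c s ≤ s ^ 2 / (2 * c) := by
  have h := tiltMass_le (π := π) hc s
  have hpos := ENNReal.toReal_pos (tiltMass_ne_zero hp0 hp c s) (tiltMass_ne_top hc s)
  have := Real.log_le_log hpos (ENNReal.toReal_le_of_le_ofReal (by positivity) h)
  rwa [Real.log_exp] at this

theorem abs_logTilt_le [IsProbabilityMeasure π] (hc : 0 < c) (hp0 : 0 < p)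
    (hp : ENNReal.ofReal p ≤ π {0}) (s : ℝ) :
    |logTilt π c s| ≤ |Real.log p| + s ^ 2 / (2 * c) := by
  have h1 := log_le_logTilt hc hp0 hp s
  have h2 := logTilt_le hc hp0 hp s
  have h3 : 0 ≤ s ^ 2 / (2 * c) := by positivity
  rw [abs_le]
  constructor
  · linarith [neg_abs_le (Real.log p)]
  · linarith [abs_nonneg (Real.log p)]

/-! ### Gaussian moments -/

theorem gaussianPDF_eq_tilt (t : ℝ) {w : ℝ≥0} (hw : w ≠ 0) (x : ℝ) :
    gaussianPDF t w x =
      gaussianPDF 0 w x * ENNReal.ofReal (Real.exp (t * x / w - t ^ 2 / (2 * w))) := by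
  have hw' : (w : ℝ) ≠ 0 := by exact_mod_cast hw
  rw [gaussianPDF, gaussianPDF, ← ENNReal.ofReal_mul (gaussianPDFReal_nonneg _ _ _),
    gaussianPDFReal, gaussianPDFReal, mul_assoc (√(2 * Real.pi * w))⁻¹, ← Real.exp_add]
  congr 3
  field_simp
  ring

theorem integrable_id_gaussianReal (θ : ℝ) (w : ℝ≥0) :
    Integrable (fun x : ℝ => x) (gaussianReal θ w) :=
  memLp_one_iff_integrable.1 (memLp_id_gaussianReal 1)

theorem integrable_sub_sq_gaussianReal (θ a : ℝ) (w : ℝ≥0) :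
    Integrable (fun x : ℝ => (x - a) ^ 2) (gaussianReal θ w) :=
  ((memLp_id_gaussianReal (μ := θ) (v := w) 2).sub (memLp_const a)).integrable_sq

theorem integral_sub_gaussianReal (θ : ℝ) (w : ℝ≥0) : ∫ x, (x - θ) ∂gaussianReal θ w = 0 := by
  rw [integral_sub (integrable_id_gaussianReal θ w) (integrable_const _)]
  simp [integral_id_gaussianReal]

theorem integral_sub_sq_gaussianReal (θ : ℝ) (w : ℝ≥0) :
    ∫ x, (x - θ) ^ 2 ∂gaussianReal θ w = w := by
  have h := variance_fun_id_gaussianReal (μ := θ) (v := w)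
  rw [variance_eq_integral (by fun_prop)] at h
  simpa [integral_id_gaussianReal] using h

/-! ### The univariate Bayes predictive density -/

/-- The Bayes predictive density on `ℝ` for the prior `π`. -/
noncomputable def postPred (r : ℝ≥0) (π : Measure ℝ) (x y : ℝ) : ℝ≥0∞ :=
  gaussianPDF 0 r y * (tiltMass π (1 + (r : ℝ)⁻¹) (x + y / r) / tiltMass π 1 x)

theorem postPred_eq_mul_inv (r : ℝ≥0) (π : Measure ℝ) (x y : ℝ) :
    postPred r π x y = gaussianPDF 0 r y *
      (tiltMass π (1 + (r : ℝ)⁻¹) (x + y / r) * (tiltMass π 1 x)⁻¹) := by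
  rw [postPred, div_eq_mul_inv (tiltMass _ _ _)]

theorem lintegral_gaussianPDF_prior (π : Measure ℝ) (x : ℝ) :
    ∫⁻ t, gaussianPDF t 1 x ∂π = gaussianPDF 0 1 x * tiltMass π 1 x := by
  rw [tiltMass, ← lintegral_const_mul _ (by fun_prop)]
  refine lintegral_congr fun t => ?_
  rw [gaussianPDF_eq_tilt t one_ne_zero]
  simp

theorem gaussianPDF_mul_gaussianPDF {r : ℝ≥0} (hr : r ≠ 0) (t x y : ℝ) :
    gaussianPDF t 1 x * gaussianPDF t r y = gaussianPDF 0 1 x * gaussianPDF 0 r y *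
      ENNReal.ofReal (Real.exp (t * (x + y / r) - (1 + (r : ℝ)⁻¹) * t ^ 2 / 2)) := by
  rw [gaussianPDF_eq_tilt t one_ne_zero x, gaussianPDF_eq_tilt t hr y,
    mul_mul_mul_comm, ← ENNReal.ofReal_mul (Real.exp_pos _).le, ← Real.exp_add]
  have hr' : (r : ℝ) ≠ 0 := by exact_mod_cast hr
  congr 3
  push_cast
  field_simp
  ring

theorem lintegral_gaussianPDF_mul_prior {r : ℝ≥0} (hr : r ≠ 0) (π : Measure ℝ) (x y : ℝ) :
    ∫⁻ t, gaussianPDF t 1 x * gaussianPDF t r y ∂π =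
      gaussianPDF 0 1 x * gaussianPDF 0 r y * tiltMass π (1 + (r : ℝ)⁻¹) (x + y / r) := by
  rw [tiltMass, ← lintegral_const_mul _ (by fun_prop)]
  exact lintegral_congr fun t => gaussianPDF_mul_gaussianPDF hr t x y

theorem measurable_gaussianPDF_left (w : ℝ≥0) (x : ℝ) :
    Measurable fun t => gaussianPDF t w x :=
  measurable_uncurry_gaussianPDF.comp (measurable_id.prodMk (measurable_const.prodMk
    measurable_const))

theorem lintegral_postPred [IsProbabilityMeasure π] {r : ℝ≥0} (hr : r ≠ 0) (hp0 : 0 < p)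
    (hp : ENNReal.ofReal p ≤ π {0}) (x : ℝ) : ∫⁻ y, postPred r π x y = 1 := by
  have hT0 := tiltMass_ne_zero hp0 hp 1 x
  have hTt := tiltMass_ne_top (π := π) one_pos x
  have hm2 : Measurable (Function.uncurry fun y t : ℝ =>
      gaussianPDF t 1 x * gaussianPDF t r y) := by
    have h1 : Measurable fun z : ℝ × ℝ => gaussianPDF z.2 1 x :=
      (measurable_gaussianPDF_left 1 x).comp measurable_snd
    have h2 : Measurable fun z : ℝ × ℝ => gaussianPDF z.2 r z.1 :=
      measurable_uncurry_gaussianPDF.comp (measurable_snd.prodMk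
        (measurable_const.prodMk measurable_fst))
    exact h1.mul h2
  have h : ∀ y, postPred r π x y =
      (∫⁻ t, gaussianPDF t 1 x * gaussianPDF t r y ∂π) *
        (gaussianPDF 0 1 x * tiltMass π 1 x)⁻¹ := by
    intro y
    have hg0 : gaussianPDF 0 1 x ≠ 0 := (gaussianPDF_pos 0 one_ne_zero x).ne'
    have hgt : gaussianPDF 0 1 x ≠ ∞ := gaussianPDF_ne_top
    rw [lintegral_gaussianPDF_mul_prior hr, ENNReal.mul_inv (Or.inl hg0) (Or.inl hgt), 
      postPred_eq_mul_inv]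
    calc _ = (gaussianPDF 0 1 x * (gaussianPDF 0 1 x)⁻¹) * (gaussianPDF 0 r y *
          (tiltMass π (1 + (r : ℝ)⁻¹) (x + y / r) * (tiltMass π 1 x)⁻¹)) := by
          rw [ENNReal.mul_inv_cancel hg0 hgt, one_mul]
      _ = _ := by ring
  simp_rw [h]
  rw [lintegral_mul_const _ hm2.lintegral_prod_right, lintegral_lintegral_swap hm2.aemeasurable]
  have h2 : ∀ t, ∫⁻ y, gaussianPDF t 1 x * gaussianPDF t r y = gaussianPDF t 1 x := by
    intro t
    rw [lintegral_const_mul _ (measurable_gaussianPDF _ _), lintegral_gaussianPDF_eq_one _ hr,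
      mul_one]
  simp_rw [h2]
  rw [lintegral_gaussianPDF_prior]
  refine ENNReal.mul_inv_cancel (mul_ne_zero (gaussianPDF_pos 0 one_ne_zero x).ne' hT0)
    (ENNReal.mul_ne_top gaussianPDF_ne_top hTt)

theorem measurable_postPred [SFinite π] (r : ℝ≥0) :
    Measurable fun z : ℝ × ℝ => postPred r π z.1 z.2 := by
  unfold postPred
  have h1 : Measurable fun z : ℝ × ℝ => gaussianPDF 0 r z.2 :=
    (measurable_gaussianPDF 0 r).comp measurable_snd
  have h2 : Measurable fun z : ℝ × ℝ => tiltMass π 1 z.1 :=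
    (measurable_tiltMass 1).comp measurable_fst
  have h3 : Measurable fun z : ℝ × ℝ => z.1 + z.2 / r := by fun_prop
  exact h1.mul (((measurable_tiltMass _).comp h3).div h2)

/-! ### Product priors -/

theorem measurable_gaussDensity_left {n : ℕ} (w : ℝ≥0) (x : Fin n → ℝ) :
    Measurable fun θ : Fin n → ℝ => gaussDensity θ w x :=
  Finset.measurable_prod _ fun i _ =>
    (measurable_gaussianPDF_left w (x i)).comp (measurable_pi_apply i)

/-- Numerator and denominator of Bayes' formula both factor over coordinates, and the factors
`gaussianPDF 0 1 (x i)` cancel. -/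
theorem bayesPDE_pi [IsProbabilityMeasure π] {r : ℝ≥0} (hr : r ≠ 0) (hp0 : 0 < p)
    (hp : ENNReal.ofReal p ≤ π {0}) {n : ℕ} (x y : Fin n → ℝ) :
    bayesPDE r (Measure.pi fun _ : Fin n => π) x y = ∏ i, postPred r π (x i) (y i) := by
  have hden : ∫⁻ θ, gaussDensity θ 1 x ∂(Measure.pi fun _ : Fin n => π) =
      ∏ i, (gaussianPDF 0 1 (x i) * tiltMass π 1 (x i)) := by
    simp_rw [← lintegral_gaussianPDF_prior]
    exact lintegral_pi_prod _ (fun i t => gaussianPDF t 1 (x i))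
      fun i => measurable_gaussianPDF_left 1 (x i)
  have hnum : ∫⁻ θ, gaussDensity θ 1 x * gaussDensity θ r y ∂(Measure.pi fun _ : Fin n => π) =
      ∏ i, (gaussianPDF 0 1 (x i) * gaussianPDF 0 r (y i) *
        tiltMass π (1 + (r : ℝ)⁻¹) (x i + y i / r)) := by
    simp_rw [← lintegral_gaussianPDF_mul_prior hr, gaussDensity, ← Finset.prod_mul_distrib]
    exact lintegral_pi_prod _ (fun i t => gaussianPDF t 1 (x i) * gaussianPDF t r (y i))
      fun i => (measurable_gaussianPDF_left 1 (x i)).mul (measurable_gaussianPDF_left r (y i))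
  rw [bayesPDE, posteriorLaw, lintegral_smul_measure,
    lintegral_withDensity_eq_lintegral_mul _ (measurable_gaussDensity_left 1 x)
      (measurable_gaussDensity_left r y)]
  simp only [Pi.mul_apply, smul_eq_mul]
  rw [hden, hnum, ENNReal.prod_inv_distrib, ← Finset.prod_mul_distrib]
  · refine Finset.prod_congr rfl fun i _ => ?_
    have hg0 : gaussianPDF 0 1 (x i) ≠ 0 := (gaussianPDF_pos 0 one_ne_zero _).ne'
    have hgt : gaussianPDF 0 1 (x i) ≠ ∞ := gaussianPDF_ne_top
    rw [ENNReal.mul_inv (Or.inl hg0) (Or.inl hgt), postPred_eq_mul_inv]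
    calc _ = (gaussianPDF 0 1 (x i) * (gaussianPDF 0 1 (x i))⁻¹) * (gaussianPDF 0 r (y i) *
          (tiltMass π (1 + (r : ℝ)⁻¹) (x i + y i / r) * (tiltMass π 1 (x i))⁻¹)) := by ring
      _ = _ := by rw [ENNReal.mul_inv_cancel hg0 hgt, one_mul]
  · intro i _ j _ _
    exact Or.inl (mul_ne_zero (gaussianPDF_pos 0 one_ne_zero _).ne' (tiltMass_ne_zero hp0 hp _ _))

theorem isPDE_bayesPDE_pi [IsProbabilityMeasure π] {r : ℝ≥0} (hr : r ≠ 0) (hp0 : 0 < p)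
    (hp : ENNReal.ofReal p ≤ π {0}) (n : ℕ) :
    IsPDE (bayesPDE r (Measure.pi fun _ : Fin n => π)) := by
  refine ⟨?_, fun x => ?_⟩
  · have : Function.uncurry (bayesPDE r (Measure.pi fun _ : Fin n => π)) =
        fun z => ∏ i, postPred r π (z.1 i) (z.2 i) := by
      ext z; exact bayesPDE_pi hr hp0 hp z.1 z.2
    rw [this]
    refine Finset.measurable_prod _ fun i _ => ?_
    have h : Measurable fun z : (Fin n → ℝ) × (Fin n → ℝ) => (z.1 i, z.2 i) := by fun_prop
    have h2 := (measurable_postPred (π := π) r).comp h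
    simpa only [Function.comp_def] using h2
  · have h : ∀ i, Measurable fun t => postPred r π (x i) t := by
      intro i
      have h1 : Measurable fun t : ℝ => (x i, t) := by fun_prop
      have h2 := (measurable_postPred (π := π) r).comp h1
      simpa only [Function.comp_def] using h2
    simp_rw [bayesPDE_pi hr hp0 hp]
    rw [volume_pi, lintegral_pi_prod _ (fun i t => postPred r π (x i) t) h]
    simp [lintegral_postPred hr hp0 hp]

end Tilt

section Risk

variable {π : Measure ℝ} {p : ℝ}

/-! ### Integrals of functions of quadratic growth -/

theorem integrable_gaussianReal_of_abs_le {F : ℝ → ℝ} (hF : Measurable F) (θ a A B : ℝ)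
    (w : ℝ≥0) (h : ∀ x, |F x| ≤ A + B * (x - a) ^ 2) : Integrable F (gaussianReal θ w) :=
  ((integrable_const A).add ((integrable_sub_sq_gaussianReal θ a w).const_mul B)).mono'
    hF.aestronglyMeasurable (ae_of_all _ h)

theorem integrable_quadratic_gaussianReal (θ A B C : ℝ) (w : ℝ≥0) :
    Integrable (fun x => A + B * (x - θ) + C * (x - θ) ^ 2) (gaussianReal θ w) :=
  ((integrable_const A).add
    (((integrable_id_gaussianReal θ w).sub (integrable_const θ)).const_mul B)).add
    ((integrable_sub_sq_gaussianReal θ θ w).const_mul C)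

theorem integral_quadratic_gaussianReal (θ A B C : ℝ) (w : ℝ≥0) :
    ∫ x, (A + B * (x - θ) + C * (x - θ) ^ 2) ∂gaussianReal θ w = A + C * w := by
  have h1 : Integrable (fun x => B * (x - θ)) (gaussianReal θ w) :=
    ((integrable_id_gaussianReal θ w).sub (integrable_const θ)).const_mul B
  have h2 : Integrable (fun x => A + B * (x - θ)) (gaussianReal θ w) :=
    (integrable_const A).add h1
  rw [integral_add h2 ((integrable_sub_sq_gaussianReal θ θ w).const_mul C),
    integral_add (integrable_const A) h1, integral_const_mul, integral_const_mul,
    integral_sub_gaussianReal, integral_sub_sq_gaussianReal]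
  simp

/-- The error bounds are quadratics centred at the mean, so the linear coefficient B, however large,
costs nothing. -/
theorem integral_le_of_le_quadratic {F : ℝ → ℝ} {θ : ℝ} {w : ℝ≥0}
    (hF : Integrable F (gaussianReal θ w)) (A B C : ℝ)
    (h : ∀ x, F x ≤ A + B * (x - θ) + C * (x - θ) ^ 2) :
    ∫ x, F x ∂gaussianReal θ w ≤ A + C * w := by
  rw [← integral_quadratic_gaussianReal θ A B C w]
  exact integral_mono hF (integrable_quadratic_gaussianReal θ A B C w) h

theorem integrable_prod_quadratic (θ₁ θ₂ A B C D E : ℝ) (w₁ w₂ : ℝ≥0) :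
    Integrable (fun z : ℝ × ℝ => A + B * (z.1 - θ₁) + D * (z.1 - θ₁) ^ 2 +
      (C * (z.2 - θ₂) + E * (z.2 - θ₂) ^ 2))
      ((gaussianReal θ₁ w₁).prod (gaussianReal θ₂ w₂)) := by
  have h1 := (integrable_quadratic_gaussianReal θ₁ A B D w₁).comp_fst (gaussianReal θ₂ w₂)
  have h2 := (integrable_quadratic_gaussianReal θ₂ 0 C E w₂).comp_snd (gaussianReal θ₁ w₁)
  simp only [zero_add] at h2
  exact h1.add h2

theorem integral_prod_quadratic (θ₁ θ₂ A B C D E : ℝ) (w₁ w₂ : ℝ≥0) :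
    ∫ z : ℝ × ℝ, (A + B * (z.1 - θ₁) + D * (z.1 - θ₁) ^ 2 +
      (C * (z.2 - θ₂) + E * (z.2 - θ₂) ^ 2))
      ∂((gaussianReal θ₁ w₁).prod (gaussianReal θ₂ w₂)) = A + D * w₁ + E * w₂ := by
  have h1 := (integrable_quadratic_gaussianReal θ₁ A B D w₁).comp_fst (gaussianReal θ₂ w₂)
  have h2 := (integrable_quadratic_gaussianReal θ₂ 0 C E w₂).comp_snd (gaussianReal θ₁ w₁)
  have h3 := integral_quadratic_gaussianReal θ₂ 0 C E w₂
  simp only [zero_add] at h2 h3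
  rw [integral_add h1 h2, integral_fun_fst (μ := gaussianReal θ₁ w₁) (ν := gaussianReal θ₂ w₂)
      (fun x => A + B * (x - θ₁) + D * (x - θ₁) ^ 2),
    integral_fun_snd (μ := gaussianReal θ₁ w₁) (ν := gaussianReal θ₂ w₂)
      (fun x => C * (x - θ₂) + E * (x - θ₂) ^ 2), h3, integral_quadratic_gaussianReal]
  simp

theorem integral_prod_le_of_le_quadratic {F : ℝ × ℝ → ℝ} {θ₁ θ₂ : ℝ} {w₁ w₂ : ℝ≥0}
    (hF : Integrable F ((gaussianReal θ₁ w₁).prod (gaussianReal θ₂ w₂))) (A B C D E : ℝ)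
    (h : ∀ z, F z ≤ A + B * (z.1 - θ₁) + D * (z.1 - θ₁) ^ 2 +
      (C * (z.2 - θ₂) + E * (z.2 - θ₂) ^ 2)) :
    ∫ z, F z ∂((gaussianReal θ₁ w₁).prod (gaussianReal θ₂ w₂)) ≤ A + D * w₁ + E * w₂ := by
  rw [← integral_prod_quadratic θ₁ θ₂ A B C D E w₁ w₂]
  exact integral_mono hF (integrable_prod_quadratic _ _ _ _ _ _ _ _ _) h

/-! ### The risk of a product prior -/

theorem one_le_one_add_inv (r : ℝ≥0) : 1 ≤ 1 + (r : ℝ)⁻¹ := by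
  have : 0 ≤ (r : ℝ)⁻¹ := by positivity
  linarith

theorem one_add_inv_pos (r : ℝ≥0) : 0 < 1 + (r : ℝ)⁻¹ := zero_lt_one.trans_le (one_le_one_add_inv r)

theorem integrable_logTilt_one [IsProbabilityMeasure π] (hp0 : 0 < p)
    (hp : ENNReal.ofReal p ≤ π {0}) (θ : ℝ) (w : ℝ≥0) :
    Integrable (logTilt π 1) (gaussianReal θ w) :=
  integrable_gaussianReal_of_abs_le (measurable_logTilt 1) θ 0 |Real.log p| (1 / 2) w fun x => by
    have := abs_logTilt_le one_pos hp0 hp x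
    simp only [sub_zero]
    linarith

theorem integrable_logTilt_prod [IsProbabilityMeasure π] {r : ℝ≥0} (hp0 : 0 < p)
    (hp : ENNReal.ofReal p ≤ π {0}) (θ₁ θ₂ : ℝ) (w₁ w₂ : ℝ≥0) :
    Integrable (fun z : ℝ × ℝ => logTilt π (1 + (r : ℝ)⁻¹) (z.1 + z.2 / r))
      ((gaussianReal θ₁ w₁).prod (gaussianReal θ₂ w₂)) := by
  have h1 : Integrable (fun z : ℝ × ℝ => |Real.log p| + (z.1 - 0) ^ 2 +
      (((z.2 - 0) ^ 2) * ((r : ℝ)⁻¹ ^ 2))) ((gaussianReal θ₁ w₁).prod (gaussianReal θ₂ w₂)) := by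
    refine ((integrable_const _).add ((integrable_sub_sq_gaussianReal θ₁ 0 w₁).comp_fst _)).add ?_
    exact ((integrable_sub_sq_gaussianReal θ₂ 0 w₂).mul_const _).comp_snd _
  have hm : Measurable fun z : ℝ × ℝ => logTilt π (1 + (r : ℝ)⁻¹) (z.1 + z.2 / r) :=
    (measurable_logTilt (π := π) _).comp (by fun_prop)
  refine h1.mono' hm.aestronglyMeasurable (ae_of_all _ fun z => ?_)
  have hc := one_le_one_add_inv r
  have := abs_logTilt_le (one_add_inv_pos r) hp0 hp (z.1 + z.2 / r)
  have h2 : (z.1 + z.2 / r) ^ 2 / (2 * (1 + (r : ℝ)⁻¹)) ≤ (z.1 + z.2 / r) ^ 2 / 2 := by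
    apply div_le_div_of_nonneg_left (by positivity) (by norm_num) (by linarith)
  rw [Real.norm_eq_abs]
  have h3 : (z.1 + z.2 / r) ^ 2 / 2 ≤ z.1 ^ 2 + z.2 ^ 2 * ((r : ℝ)⁻¹ ^ 2) := by
    rw [div_eq_mul_inv z.2]
    nlinarith [sq_nonneg (z.1 - z.2 * (r : ℝ)⁻¹)]
  simp only [sub_zero]
  linarith

theorem integrable_logTilt_add [IsProbabilityMeasure π] {r : ℝ≥0} (hp0 : 0 < p)
    (hp : ENNReal.ofReal p ≤ π {0}) (θ x : ℝ) (w : ℝ≥0) :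
    Integrable (fun y => logTilt π (1 + (r : ℝ)⁻¹) (x + y / r)) (gaussianReal θ w) := by
  refine integrable_gaussianReal_of_abs_le ((measurable_logTilt (π := π) _).comp (by fun_prop))
    θ 0 (|Real.log p| + x ^ 2) ((r : ℝ)⁻¹ ^ 2) w fun y => ?_
  have hc := one_le_one_add_inv r
  have := abs_logTilt_le (one_add_inv_pos r) hp0 hp (x + y / r)
  have h2 : (x + y / r) ^ 2 / (2 * (1 + (r : ℝ)⁻¹)) ≤ (x + y / r) ^ 2 / 2 := by
    apply div_le_div_of_nonneg_left (by positivity) (by norm_num) (by linarith)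
  have h3 : (x + y / r) ^ 2 / 2 ≤ x ^ 2 + ((r : ℝ)⁻¹ ^ 2) * y ^ 2 := by
    rw [div_eq_mul_inv y]
    nlinarith [sq_nonneg (x - y * (r : ℝ)⁻¹)]
  simp only [sub_zero, Function.comp_apply]
  linarith

/-- The univariate Kullback-Leibler loss at `x` of the Bayes predictive density for `π`. -/
noncomputable def uniLoss (r : ℝ≥0) (π : Measure ℝ) (θ x : ℝ) : ℝ :=
  θ ^ 2 / (2 * r) - ∫ y, logTilt π (1 + (r : ℝ)⁻¹) (x + y / r) ∂gaussianReal θ r + logTilt π 1 x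

/-- The univariate risk of the Bayes predictive density for `π`. -/
noncomputable def uniRisk (r : ℝ≥0) (π : Measure ℝ) (θ : ℝ) : ℝ :=
  ∫ x, uniLoss r π θ x ∂gaussianReal θ 1

theorem log_toReal_gaussianPDF (t : ℝ) {w : ℝ≥0} (hw : w ≠ 0) (x : ℝ) :
    Real.log (gaussianPDF t w x).toReal =
      Real.log (gaussianPDF 0 w x).toReal + (t * x / w - t ^ 2 / (2 * w)) := by
  have h0 : (gaussianPDF 0 w x).toReal ≠ 0 := by
    rw [toReal_gaussianPDF]; exact (gaussianPDFReal_pos 0 w x hw).ne'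
  rw [gaussianPDF_eq_tilt t hw, ENNReal.toReal_mul, ENNReal.toReal_ofReal (Real.exp_pos _).le,
    Real.log_mul h0 (Real.exp_pos _).ne', Real.log_exp]

theorem postPred_ne_zero [IsProbabilityMeasure π] {r : ℝ≥0} (hr : r ≠ 0) (hp0 : 0 < p)
    (hp : ENNReal.ofReal p ≤ π {0}) (x y : ℝ) : postPred r π x y ≠ 0 :=
  mul_ne_zero (gaussianPDF_pos 0 hr y).ne' (ENNReal.div_ne_zero.2
    ⟨tiltMass_ne_zero hp0 hp _ _, tiltMass_ne_top one_pos x⟩)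

theorem postPred_ne_top [IsProbabilityMeasure π] {r : ℝ≥0} (hp0 : 0 < p)
    (hp : ENNReal.ofReal p ≤ π {0}) (x y : ℝ) : postPred r π x y ≠ ∞ :=
  ENNReal.mul_ne_top gaussianPDF_ne_top (ENNReal.div_ne_top
    (tiltMass_ne_top (one_add_inv_pos r) _) (tiltMass_ne_zero hp0 hp _ _))

theorem log_toReal_postPred [IsProbabilityMeasure π] {r : ℝ≥0} (hr : r ≠ 0) (hp0 : 0 < p)
    (hp : ENNReal.ofReal p ≤ π {0}) (x y : ℝ) :
    Real.log (postPred r π x y).toReal = Real.log (gaussianPDF 0 r y).toReal +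
      (logTilt π (1 + (r : ℝ)⁻¹) (x + y / r) - logTilt π 1 x) := by
  have h0 : (gaussianPDF 0 r y).toReal ≠ 0 := by
    rw [toReal_gaussianPDF]; exact (gaussianPDFReal_pos 0 r y hr).ne'
  have h1 := (ENNReal.toReal_pos (tiltMass_ne_zero hp0 hp (1 + (r : ℝ)⁻¹) (x + y / r))
    (tiltMass_ne_top (one_add_inv_pos r) _)).ne'
  have h2 := (ENNReal.toReal_pos (tiltMass_ne_zero hp0 hp 1 x) (tiltMass_ne_top one_pos x)).ne'
  rw [postPred, ENNReal.toReal_mul, ENNReal.toReal_div, Real.log_mul h0 (div_ne_zero h1 h2),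
    Real.log_div h1 h2]
  rfl

/-- Both densities are products, so the log-ratio is a sum over coordinates and each term is
integrated against its own marginal. -/
theorem loss_bayesPDE_pi [IsProbabilityMeasure π] {r : ℝ≥0} (hr : r ≠ 0) (hp0 : 0 < p)
    (hp : ENNReal.ofReal p ≤ π {0}) {n : ℕ} (θ x : Fin n → ℝ) :
    0 ≤ ∑ i, uniLoss r π (θ i) (x i) ∧
    loss r θ (bayesPDE r (Measure.pi fun _ : Fin n => π) x) =
      ENNReal.ofReal (∑ i, uniLoss r π (θ i) (x i)) := by
  have hPDE := isPDE_bayesPDE_pi hr hp0 hp n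
  set g := bayesPDE r (Measure.pi fun _ : Fin n => π) x with hg
  have hgy : ∀ y, g y = ∏ i, postPred r π (x i) (y i) := fun y => bayesPDE_pi hr hp0 hp x y
  have hgm : Measurable g := hPDE.measurable.of_uncurry_left
  have hgd0 : ∀ y, gaussDensity θ r y ≠ 0 := fun y =>
    Finset.prod_ne_zero_iff.2 fun i _ => (gaussianPDF_pos _ hr _).ne'
  have hgdt : ∀ y, gaussDensity θ r y ≠ ∞ := fun y =>
    ENNReal.prod_ne_top fun i _ => gaussianPDF_ne_top
  have hg0 : ∀ y, g y ≠ 0 := fun y => by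
    rw [hgy]; exact Finset.prod_ne_zero_iff.2 fun i _ => postPred_ne_zero hr hp0 hp _ _
  have hgt : ∀ y, g y ≠ ∞ := fun y => by
    rw [hgy]; exact ENNReal.prod_ne_top fun i _ => postPred_ne_top hp0 hp _ _
  have hlog : ∀ y, Real.log (gaussDensity θ r y / g y).toReal =
      ∑ i, (θ i * y i / r - θ i ^ 2 / (2 * r) -
        logTilt π (1 + (r : ℝ)⁻¹) (x i + y i / r) + logTilt π 1 (x i)) := by
    intro y
    rw [ENNReal.toReal_div, Real.log_div (ENNReal.toReal_pos (hgd0 y) (hgdt y)).ne'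
      (ENNReal.toReal_pos (hg0 y) (hgt y)).ne', hgy, gaussDensity, ENNReal.toReal_prod,
      ENNReal.toReal_prod, Real.log_prod, Real.log_prod, ← Finset.sum_sub_distrib]
    · refine Finset.sum_congr rfl fun i _ => ?_
      rw [log_toReal_gaussianPDF _ hr, log_toReal_postPred hr hp0 hp]
      ring
    · exact fun i _ => (ENNReal.toReal_pos (postPred_ne_zero hr hp0 hp _ _)
        (postPred_ne_top hp0 hp _ _)).ne'
    · exact fun i _ => (ENNReal.toReal_pos (gaussianPDF_pos _ hr _).ne' gaussianPDF_ne_top).ne'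
  have hI1 : ∀ i, Integrable (fun t : ℝ => θ i * t / r - θ i ^ 2 / (2 * r) -
      logTilt π (1 + (r : ℝ)⁻¹) (x i + t / r) + logTilt π 1 (x i)) (gaussianReal (θ i) r) := by
    intro i
    refine ((Integrable.sub ?_ (integrable_const _)).sub
      (integrable_logTilt_add hp0 hp _ _ _)).add (integrable_const _)
    exact ((integrable_id_gaussianReal _ _).const_mul _).div_const _
  have hI2 : ∀ i, ∫ t, (θ i * t / r - θ i ^ 2 / (2 * r) -
      logTilt π (1 + (r : ℝ)⁻¹) (x i + t / r) + logTilt π 1 (x i)) ∂gaussianReal (θ i) r =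
      uniLoss r π (θ i) (x i) := by
    intro i
    have h1 : Integrable (fun t : ℝ => θ i * t / r) (gaussianReal (θ i) r) :=
      ((integrable_id_gaussianReal _ _).const_mul _).div_const _
    have h2 := integrable_logTilt_add (r := r) hp0 hp (θ i) (x i) r
    have h3 : Integrable (fun t : ℝ => θ i * t / r - θ i ^ 2 / (2 * r)) (gaussianReal (θ i) r) :=
      h1.sub (integrable_const _)
    have h4 : Integrable (fun t : ℝ => θ i * t / r - θ i ^ 2 / (2 * r) -
      logTilt π (1 + (r : ℝ)⁻¹) (x i + t / r)) (gaussianReal (θ i) r) := h3.sub h2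
    rw [integral_add h4 (integrable_const _), integral_sub h3 h2,
      integral_sub h1 (integrable_const _), integral_div, integral_const_mul,
      integral_id_gaussianReal, uniLoss]
    simp only [integral_const, probReal_univ, one_smul]
    ring
  have hI3 : ∀ i, Integrable (fun y : Fin n → ℝ => θ i * y i / r - θ i ^ 2 / (2 * r) -
      logTilt π (1 + (r : ℝ)⁻¹) (x i + y i / r) + logTilt π 1 (x i)) (gaussLaw θ r) :=
    fun i => integrable_comp_eval (μ := fun i => gaussianReal (θ i) r) (hI1 i)
  have hsum : ∫ y, Real.log (gaussDensity θ r y / g y).toReal ∂gaussLaw θ r =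
      ∑ i, uniLoss r π (θ i) (x i) := by
    simp_rw [hlog]
    rw [integral_finsetSum _ fun i _ => hI3 i]
    refine Finset.sum_congr rfl fun i _ => ?_
    rw [← hI2 i]
    exact integral_comp_eval (μ := fun i => gaussianReal (θ i) r) (hI1 i).aestronglyMeasurable
  have hf1 : ∫⁻ y, gaussDensity θ r y = 1 := by
    have := measure_univ (μ := gaussLaw θ r)
    rwa [gaussLaw_eq_withDensity θ hr, withDensity_apply _ .univ, Measure.restrict_univ] at this
  have hint : Integrable (fun y => Real.log (gaussDensity θ r y / g y).toReal)
      (volume.withDensity (gaussDensity θ r)) := by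
    rw [← gaussLaw_eq_withDensity θ hr]
    simp_rw [hlog]
    exact integrable_finsetSum _ fun i _ => hI3 i
  have key := klDiv_withDensity_of_pos (measurable_gaussDensity θ r) hgm hf1
    (hPDE.lintegral_eq_one x) hg0 hgt hint
  rw [← gaussLaw_eq_withDensity θ hr, hsum] at key
  exact key

theorem integrable_uniLoss [IsProbabilityMeasure π] {r : ℝ≥0} (hp0 : 0 < p)
    (hp : ENNReal.ofReal p ≤ π {0}) (θ : ℝ) :
    Integrable (uniLoss r π θ) (gaussianReal θ 1) :=
  ((integrable_const _).sub (integrable_logTilt_prod (r := r) hp0 hp θ θ 1 r).integral_prod_left).add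
    (integrable_logTilt_one hp0 hp θ 1)

theorem risk_bayesPDE_pi [IsProbabilityMeasure π] {r : ℝ≥0} (hr : r ≠ 0) (hp0 : 0 < p)
    (hp : ENNReal.ofReal p ≤ π {0}) {n : ℕ} (θ : Fin n → ℝ) :
    risk r θ (bayesPDE r (Measure.pi fun _ : Fin n => π)) =
      ENNReal.ofReal (∑ i, uniRisk r π (θ i)) := by
  have hI : ∀ i, Integrable (fun x : Fin n → ℝ => uniLoss r π (θ i) (x i)) (gaussLaw θ 1) :=
    fun i => integrable_comp_eval (μ := fun i => gaussianReal (θ i) 1)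
      (integrable_uniLoss hp0 hp (θ i))
  rw [risk]
  simp_rw [fun x => (loss_bayesPDE_pi hr hp0 hp θ x).2]
  rw [← ofReal_integral_eq_lintegral_ofReal (integrable_finsetSum _ fun i _ => hI i)
    (ae_of_all _ fun x => (loss_bayesPDE_pi hr hp0 hp θ x).1),
    integral_finsetSum _ fun i _ => hI i]
  congr 1
  refine Finset.sum_congr rfl fun i _ => ?_
  exact integral_comp_eval (μ := fun i => gaussianReal (θ i) 1)
    (integrable_uniLoss hp0 hp (θ i)).aestronglyMeasurable

theorem uniRisk_nonneg [IsProbabilityMeasure π] {r : ℝ≥0} (hr : r ≠ 0) (hp0 : 0 < p)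
    (hp : ENNReal.ofReal p ≤ π {0}) (θ : ℝ) : 0 ≤ uniRisk r π θ := by
  refine integral_nonneg fun x => ?_
  have := (loss_bayesPDE_pi hr hp0 hp (fun _ : Fin 1 => θ) (fun _ => x)).1
  simpa using this

theorem uniRisk_eq [IsProbabilityMeasure π] {r : ℝ≥0} (hp0 : 0 < p)
    (hp : ENNReal.ofReal p ≤ π {0}) (θ : ℝ) :
    uniRisk r π θ = θ ^ 2 / (2 * r) -
      ∫ z : ℝ × ℝ, logTilt π (1 + (r : ℝ)⁻¹) (z.1 + z.2 / r)
        ∂((gaussianReal θ 1).prod (gaussianReal θ r)) +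
      ∫ x, logTilt π 1 x ∂gaussianReal θ 1 := by
  have h1 := integrable_logTilt_prod (r := r) hp0 hp θ θ 1 r
  have h2 := h1.integral_prod_left
  have h3 : Integrable (fun x => θ ^ 2 / (2 * r) -
      ∫ y, logTilt π (1 + (r : ℝ)⁻¹) (x + y / r) ∂gaussianReal θ r) (gaussianReal θ 1) :=
    (integrable_const _).sub h2
  rw [integral_prod _ h1, uniRisk]
  unfold uniLoss
  rw [integral_add h3 (integrable_logTilt_one hp0 hp θ 1), integral_sub (integrable_const _) h2]
  simp

/-! ### The risk at the origin -/

theorem lintegral_tiltMass_one [IsProbabilityMeasure π] :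
    ∫⁻ x, tiltMass π 1 x ∂gaussianReal 0 1 = 1 := by
  rw [gaussianReal_of_var_ne_zero 0 one_ne_zero, lintegral_withDensity_eq_lintegral_mul _
    (measurable_gaussianPDF 0 1) (measurable_tiltMass 1)]
  simp only [Pi.mul_apply, ← lintegral_gaussianPDF_prior]
  have hm : Measurable (Function.uncurry fun x t : ℝ => gaussianPDF t 1 x) :=
    measurable_uncurry_gaussianPDF.comp (measurable_snd.prodMk
      (measurable_const.prodMk measurable_fst))
  rw [lintegral_lintegral_swap hm.aemeasurable]
  simp [lintegral_gaussianPDF_eq_one]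

/-- `tiltMass π 1 x` is the likelihood ratio of the marginal of x to N(0, 1), hence has mean 1 under
N(0, 1); then log a ≤ a - 1. -/
theorem integral_logTilt_one_nonpos [IsProbabilityMeasure π] (hp0 : 0 < p)
    (hp : ENNReal.ofReal p ≤ π {0}) : ∫ x, logTilt π 1 x ∂gaussianReal 0 1 ≤ 0 := by
  have hI : Integrable (fun x => (tiltMass π 1 x).toReal) (gaussianReal 0 1) := by
    refine integrable_toReal_of_lintegral_ne_top (measurable_tiltMass 1).aemeasurable ?_
    rw [lintegral_tiltMass_one]; exact ENNReal.one_ne_top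
  have h1 : ∫ x, (tiltMass π 1 x).toReal ∂gaussianReal 0 1 = 1 := by
    rw [integral_toReal (measurable_tiltMass 1).aemeasurable
      (ae_of_all _ fun x => (tiltMass_ne_top one_pos x).lt_top), lintegral_tiltMass_one]
    simp
  calc ∫ x, logTilt π 1 x ∂gaussianReal 0 1
      ≤ ∫ x, ((tiltMass π 1 x).toReal - 1) ∂gaussianReal 0 1 := by
        refine integral_mono (integrable_logTilt_one hp0 hp 0 1) (hI.sub (integrable_const 1))
          fun x => ?_
        exact Real.log_le_sub_one_of_pos
          (ENNReal.toReal_pos (tiltMass_ne_zero hp0 hp 1 x) (tiltMass_ne_top one_pos x))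
    _ = 0 := by rw [integral_sub hI (integrable_const 1), h1]; simp

/-- The atom at 0 alone bounds the joint log-mass below by log p, and the past log-mass has
nonpositive mean. With p = 1 - η this makes the risk at zero O(η). -/
theorem uniRisk_zero_le [IsProbabilityMeasure π] {r : ℝ≥0} (hp0 : 0 < p)
    (hp : ENNReal.ofReal p ≤ π {0}) : uniRisk r π 0 ≤ -Real.log p := by
  rw [uniRisk_eq hp0 hp]
  have h1 := integral_logTilt_one_nonpos hp0 hp
  have h2 : ∫ _ : ℝ × ℝ, Real.log p ∂((gaussianReal 0 1).prod (gaussianReal 0 r)) ≤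
      ∫ z : ℝ × ℝ, logTilt π (1 + (r : ℝ)⁻¹) (z.1 + z.2 / r)
        ∂((gaussianReal 0 1).prod (gaussianReal 0 r)) :=
    integral_mono (integrable_const _) (integrable_logTilt_prod hp0 hp 0 0 1 r)
      fun z => log_le_logTilt (one_add_inv_pos r) hp0 hp _
  simp only [integral_const, probReal_univ, one_smul] at h2
  simp only [ne_eq, OfNat.ofNat_ne_zero, not_false_eq_true, zero_pow, zero_div]
  linarith

end Risk

/-! ### Sparse grid priors with scaled spacing -/

/-- The positive part of a sparse grid prior whose atoms are `λ (1 + b k)`, with geometric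
weights of ratio `η ^ (b² v)`. -/
noncomputable def scaledGridPos (r : ℝ≥0) (b η : ℝ) : Measure ℝ :=
  Measure.sum fun k : ℕ =>
    ENNReal.ofReal ((1 - η ^ (b ^ 2 * oracleVar r)) * η ^ ((k : ℝ) * (b ^ 2 * oracleVar r))) •
      Measure.dirac (gridSpacing r η * (1 + b * (k : ℝ)))

/-- The symmetric sparse grid prior built from `scaledGridPos`. -/
noncomputable def scaledGridPrior (r : ℝ≥0) (b η : ℝ) : Measure ℝ :=
  ENNReal.ofReal (1 - η) • Measure.dirac 0 +
    ENNReal.ofReal (η / 2) • (scaledGridPos r b η + (scaledGridPos r b η).map fun t => -t)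

theorem scaledGridPrior_one (r : ℝ≥0) (η : ℝ) : scaledGridPrior r 1 η = gridPrior r η := by
  have : scaledGridPos r 1 η = gridPos r η := by
    unfold scaledGridPos gridPos
    simp only [one_pow, one_mul, add_comm]
  rw [scaledGridPrior, gridPrior, this]

theorem oracleVar_pos {r : ℝ≥0} : 0 < oracleVar r := inv_pos.2 (one_add_inv_pos r)

theorem oracleVar_le_one {r : ℝ≥0} : oracleVar r ≤ 1 := inv_le_one_of_one_le₀ (one_le_one_add_inv r)

theorem oracleVar_mul {r : ℝ≥0} : (1 + (r : ℝ)⁻¹) * oracleVar r = 1 :=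
  mul_inv_cancel₀ (one_add_inv_pos r).ne'

theorem gridSpacing_nonneg (r : ℝ≥0) (η : ℝ) : 0 ≤ gridSpacing r η := Real.sqrt_nonneg _

theorem gridSpacing_sq {r : ℝ≥0} {η : ℝ} (h0 : 0 < η) (h1 : η < 1) :
    gridSpacing r η ^ 2 = 2 * (oracleVar r * -Real.log η) := by
  have hl := Real.log_neg h0 h1
  have hv := oracleVar_pos (r := r)
  rw [gridSpacing, Real.log_rpow h0, Real.sq_sqrt]
  · ring
  · nlinarith

/-- This identity puts the prior penalty log(1/η) on the scale λ²/2 of all the Gaussian exponents.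
-/
theorem neg_log_eq_gridSpacing {r : ℝ≥0} {η : ℝ} (h0 : 0 < η) (h1 : η < 1) :
    -Real.log η = (1 + (r : ℝ)⁻¹) * gridSpacing r η ^ 2 / 2 := by
  rw [gridSpacing_sq h0 h1]
  linear_combination (Real.log η) * oracleVar_mul (r := r)

/-- The two-sided geometric series sums to 3; the tail at negative indices, cut off by k ≥ 0, is
exactly 2^(-K), and adding it back gives an identity that can be proved by induction. -/
theorem tsum_two_inv_pow_natAbs (K : ℕ) :
    ∑' k : ℕ, (2⁻¹ : ℝ≥0∞) ^ ((k : ℤ) - K).natAbs ≤ 3 := by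
  have hgeo : ∑' k : ℕ, (2⁻¹ : ℝ≥0∞) ^ k = 2 := by
    rw [ENNReal.tsum_geometric, ENNReal.one_sub_inv_two, inv_inv]
  suffices h : ∑' k : ℕ, (2⁻¹ : ℝ≥0∞) ^ ((k : ℤ) - K).natAbs + 2⁻¹ ^ K = 3 from
    le_self_add.trans h.le
  induction K with
  | zero =>
    simp only [Nat.cast_zero, sub_zero, Int.natAbs_natCast, hgeo, pow_zero]
    norm_num
  | succ K ih =>
    rw [tsum_eq_zero_add' ENNReal.summable]
    have h1 : ∀ k : ℕ, ((k + 1 : ℕ) - (K + 1 : ℕ) : ℤ).natAbs = ((k : ℤ) - K).natAbs := by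
      intro k; congr 1; push_cast; ring
    have h2 : ((0 : ℕ) - (K + 1 : ℕ) : ℤ).natAbs = K + 1 := by omega
    simp_rw [h1, h2]
    rw [← ih, add_right_comm, add_comm, pow_succ, ← mul_add, ENNReal.inv_two_add_inv_two, mul_one]

theorem tiltMass_scaledGridPos (r : ℝ≥0) (b η c s : ℝ) :
    tiltMass (scaledGridPos r b η) c s = ∑' k : ℕ,
      ENNReal.ofReal ((1 - η ^ (b ^ 2 * oracleVar r)) * η ^ ((k : ℝ) * (b ^ 2 * oracleVar r))) *
      ENNReal.ofReal (Real.exp (gridSpacing r η * (1 + b * (k : ℝ)) * s -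
        c * (gridSpacing r η * (1 + b * (k : ℝ))) ^ 2 / 2)) := by
  rw [tiltMass, scaledGridPos, lintegral_sum_measure]
  refine tsum_congr fun k => ?_
  rw [lintegral_smul_measure, lintegral_dirac]
  rfl

theorem tiltMass_scaledGridPrior (r : ℝ≥0) (b η c s : ℝ) :
    tiltMass (scaledGridPrior r b η) c s = ENNReal.ofReal (1 - η) + ENNReal.ofReal (η / 2) *
      (tiltMass (scaledGridPos r b η) c s + tiltMass (scaledGridPos r b η) c (-s)) := by
  rw [tiltMass, scaledGridPrior, lintegral_add_measure, lintegral_smul_measure, lintegral_dirac,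
    lintegral_smul_measure, lintegral_add_measure, lintegral_map (by fun_prop) (by fun_prop)]
  simp only [tiltMass, smul_eq_mul, neg_mul, neg_sq, mul_neg]
  simp

theorem tiltMass_scaledGridPrior_neg (r : ℝ≥0) (b η c s : ℝ) :
    tiltMass (scaledGridPrior r b η) c (-s) = tiltMass (scaledGridPrior r b η) c s := by
  rw [tiltMass_scaledGridPrior, tiltMass_scaledGridPrior, neg_neg, add_comm (tiltMass _ c (-s))]

theorem logTilt_scaledGridPrior_neg (r : ℝ≥0) (b η c s : ℝ) :
    logTilt (scaledGridPrior r b η) c (-s) = logTilt (scaledGridPrior r b η) c s := by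
  rw [logTilt, logTilt, tiltMass_scaledGridPrior_neg]

/-! ### Total mass, atoms and log-mass of the scaled grid prior -/

section Weights

variable {r : ℝ≥0} {b η : ℝ}

theorem ratio_lt_one (hb : 0 < b) (h0 : 0 < η) (h1 : η < 1) : η ^ (b ^ 2 * oracleVar r) < 1 :=
  Real.rpow_lt_one h0.le h1 (mul_pos (by positivity) oracleVar_pos)

theorem tsum_gridWeights (hb : 0 < b) (h0 : 0 < η) (h1 : η < 1) :
    ∑' k : ℕ, ENNReal.ofReal
      ((1 - η ^ (b ^ 2 * oracleVar r)) * η ^ ((k : ℝ) * (b ^ 2 * oracleVar r))) = 1 := by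
  have hq1 := ratio_lt_one (r := r) hb h0 h1
  have hq0 : 0 < η ^ (b ^ 2 * oracleVar r) := Real.rpow_pos_of_pos h0 _
  have h : ∀ k : ℕ, η ^ ((k : ℝ) * (b ^ 2 * oracleVar r)) = (η ^ (b ^ 2 * oracleVar r)) ^ k := by
    intro k
    rw [mul_comm, Real.rpow_mul h0.le, Real.rpow_natCast]
  simp_rw [h]
  rw [← ENNReal.ofReal_tsum_of_nonneg]
  · rw [tsum_mul_left, tsum_geometric_of_lt_one hq0.le hq1, mul_inv_cancel₀ (by linarith),
      ENNReal.ofReal_one]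
  · intro k
    have : 0 ≤ 1 - η ^ (b ^ 2 * oracleVar r) := by linarith
    positivity
  · exact (summable_geometric_of_lt_one hq0.le hq1).mul_left _

theorem isProbabilityMeasure_scaledGridPos (hb : 0 < b) (h0 : 0 < η) (h1 : η < 1) :
    IsProbabilityMeasure (scaledGridPos r b η) := by
  refine ⟨?_⟩
  rw [scaledGridPos, Measure.sum_apply _ .univ, ← tsum_gridWeights (r := r) hb h0 h1]
  exact tsum_congr fun k => by simp

theorem isProbabilityMeasure_scaledGridPrior (hb : 0 < b) (h0 : 0 < η) (h1 : η < 1) :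
    IsProbabilityMeasure (scaledGridPrior r b η) := by
  have := isProbabilityMeasure_scaledGridPos (r := r) hb h0 h1
  refine ⟨?_⟩
  have hm : ((scaledGridPos r b η).map fun t => -t) Set.univ = 1 := by
    rw [Measure.map_apply measurable_neg .univ]; simp
  simp only [scaledGridPrior, Measure.add_apply, Measure.smul_apply, measure_univ, hm, smul_eq_mul,
    mul_one]
  rw [one_add_one_eq_two, ← ENNReal.ofReal_ofNat, ← ENNReal.ofReal_mul (by linarith),
    ← ENNReal.ofReal_add (by linarith) (by linarith)]
  norm_num

theorem ofReal_le_scaledGridPrior_zero : ENNReal.ofReal (1 - η) ≤ scaledGridPrior r b η {0} := by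
  simp [scaledGridPrior]

theorem ofReal_le_scaledGridPrior_atom (h0 : 0 < η) (k : ℕ) :
    ENNReal.ofReal (η / 2 *
      ((1 - η ^ (b ^ 2 * oracleVar r)) * η ^ ((k : ℝ) * (b ^ 2 * oracleVar r)))) ≤
      scaledGridPrior r b η {gridSpacing r η * (1 + b * (k : ℝ))} := by
  rw [ENNReal.ofReal_mul (by positivity)]
  simp only [scaledGridPrior, Measure.add_apply, Measure.smul_apply, smul_eq_mul]
  refine le_trans ?_ le_add_self
  gcongr
  refine le_trans ?_ le_self_add
  rw [scaledGridPos, Measure.sum_apply _ (measurableSet_singleton _)]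
  refine le_trans ?_ (ENNReal.le_tsum k)
  simp

/-- The decay is l² - l rather than l² because the best atom and its neighbour may tie. For l = q +
1 one half-square κ²q²/2 absorbs the noise qκz up to z², and the remaining κ²q/2 pays for the factor
2^(-q). -/
theorem gridExponent_le {κ z : ℝ} (hκ : Real.log 2 ≤ κ ^ 2 / 2) (hκ0 : 0 ≤ κ) (hz : 0 ≤ z) (l : ℕ) :
    -(κ ^ 2 / 2) * ((l : ℝ) ^ 2 - l) + l * κ * z ≤
      κ * z + z ^ 2 + Real.log 2 - l * Real.log 2 := by
  have h2 : 0 ≤ Real.log 2 := Real.log_nonneg (by norm_num)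
  have hκz := mul_nonneg hκ0 hz
  rcases l with _ | q
  · simp; positivity
  · push_cast
    have hq : (0 : ℝ) ≤ q := q.cast_nonneg
    nlinarith [sq_nonneg (q * κ / 2 - z), mul_le_mul_of_nonneg_left hκ hq, sq_nonneg (q * κ)]

/-- If the exponents of the positive atoms decay quadratically away from the index `K`, then the
log-mass is governed by the exponent at `K`. -/
theorem logTilt_scaledGridPrior_le (hb : 0 < b) (h0 : 0 < η) (h1 : η < 1) {c θ Z κ a M : ℝ}
    (hc : 1 ≤ c) (hθ : 0 ≤ θ) (hκ : Real.log 2 ≤ κ ^ 2 / 2) (hκ0 : 0 ≤ κ) (K : ℕ)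
    (hE : ∀ k : ℕ, Real.log η + k * (b ^ 2 * oracleVar r) * Real.log η +
      gridSpacing r η * (1 + b * k) * (c * θ + Z) -
        c * (gridSpacing r η * (1 + b * k)) ^ 2 / 2 ≤
      a + M * Z - κ ^ 2 / 2 * ((((k : ℤ) - K).natAbs : ℝ) ^ 2 - (((k : ℤ) - K).natAbs : ℝ)) +
        (((k : ℤ) - K).natAbs : ℝ) * κ * |Z|) :
    logTilt (scaledGridPrior r b η) c (c * θ + Z) ≤
      3 + max (a + M * Z) 0 + κ * |Z| + Z ^ 2 := by
  have := isProbabilityMeasure_scaledGridPrior (r := r) hb h0 h1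
  have hc0 : 0 < c := by linarith
  have hq1 := ratio_lt_one (r := r) hb h0 h1
  have hq0 : 0 < η ^ (b ^ 2 * oracleVar r) := Real.rpow_pos_of_pos h0 _
  have hlam := gridSpacing_nonneg r η
  set R := max (a + M * Z) 0 + κ * |Z| + Z ^ 2 with hR
  have hR0 : Z ^ 2 ≤ R := by
    have : 0 ≤ κ * |Z| := by positivity
    have := le_max_right (a + M * Z) 0
    linarith
  have hR1 : 0 ≤ R := (sq_nonneg Z).trans hR0
  -- The constant 6 is 2 · 3: a factor 2 from log 2 in `gridExponent_le`, and 3 from the two-sided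
  -- geometric series.
  have hpos : ENNReal.ofReal (η / 2) * tiltMass (scaledGridPos r b η) c (c * θ + Z) ≤
      ENNReal.ofReal (6 * Real.exp R) := by
    have h2 : ENNReal.ofReal (6 * Real.exp R) = ENNReal.ofReal (2 * Real.exp R) * 3 := by
      rw [← ENNReal.ofReal_ofNat 3, ← ENNReal.ofReal_mul (by positivity)]
      congr 1; ring
    rw [tiltMass_scaledGridPos, ← ENNReal.tsum_mul_left, h2]
    refine le_trans ?_ (mul_le_mul_right (tsum_two_inv_pow_natAbs K) _)
    rw [← ENNReal.tsum_mul_left]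
    refine ENNReal.tsum_le_tsum fun k => ?_
    have hw : 0 ≤ (1 - η ^ (b ^ 2 * oracleVar r)) * η ^ ((k : ℝ) * (b ^ 2 * oracleVar r)) :=
      mul_nonneg (by linarith) (Real.rpow_nonneg h0.le _)
    have h3 : (2⁻¹ : ℝ≥0∞) ^ ((k : ℤ) - K).natAbs =
        ENNReal.ofReal (Real.exp (-(((k : ℤ) - K).natAbs * Real.log 2))) := by
      rw [Real.exp_neg, Real.exp_nat_mul, Real.exp_log two_pos, ← inv_pow,
        ENNReal.ofReal_pow (by positivity), ENNReal.ofReal_inv_of_pos two_pos, ENNReal.ofReal_ofNat]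
    rw [h3, ← ENNReal.ofReal_mul hw, ← ENNReal.ofReal_mul (by positivity),
      ← ENNReal.ofReal_mul (by positivity)]
    apply ENNReal.ofReal_le_ofReal
    have h4 : η ^ ((k : ℝ) * (b ^ 2 * oracleVar r)) =
        Real.exp (k * (b ^ 2 * oracleVar r) * Real.log η) := by
      rw [Real.rpow_def_of_pos h0, mul_comm]
    calc _ ≤ η * (Real.exp (k * (b ^ 2 * oracleVar r) * Real.log η) *
          Real.exp (gridSpacing r η * (1 + b * (k : ℝ)) * (c * θ + Z) -
            c * (gridSpacing r η * (1 + b * (k : ℝ))) ^ 2 / 2)) := by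
          rw [h4] at hw ⊢
          gcongr
          · linarith
          · nlinarith [Real.exp_pos (k * (b ^ 2 * oracleVar r) * Real.log η)]
      _ = Real.exp (Real.log η + k * (b ^ 2 * oracleVar r) * Real.log η +
            gridSpacing r η * (1 + b * k) * (c * θ + Z) -
            c * (gridSpacing r η * (1 + b * k)) ^ 2 / 2) := by
          rw [add_sub_assoc, Real.exp_add, Real.exp_add, Real.exp_log h0, mul_assoc η]
      _ ≤ Real.exp (Real.log 2 + R - ((k : ℤ) - K).natAbs * Real.log 2) := by
          rw [Real.exp_le_exp]
          have h5 := gridExponent_le hκ hκ0 (abs_nonneg Z) ((k : ℤ) - K).natAbs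
          have h6 := le_max_left (a + M * Z) 0
          rw [sq_abs] at h5
          linarith [hE k]
      _ = _ := by
          rw [sub_eq_add_neg, Real.exp_add, Real.exp_add, Real.exp_log two_pos]
  have hneg : ENNReal.ofReal (η / 2) * tiltMass (scaledGridPos r b η) c (-(c * θ + Z)) ≤
      ENNReal.ofReal (Real.exp R) := by
    rw [tiltMass_scaledGridPos]
    calc _ ≤ 1 * ∑' k : ℕ, ENNReal.ofReal ((1 - η ^ (b ^ 2 * oracleVar r)) *
          η ^ ((k : ℝ) * (b ^ 2 * oracleVar r))) * ENNReal.ofReal (Real.exp R) := by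
          gcongr with k
          · rw [ENNReal.ofReal_le_one]; linarith
          -- A negative atom sees the signal with the wrong sign: as θ ≥ 0 and c ≥ 1, its exponent
          -- is at most -μZ - μ²/2 ≤ Z²/2.
          · set μ := gridSpacing r η * (1 + b * (k : ℝ)) with hμ
            have hμ0 : 0 ≤ μ := by positivity
            have h5 : 0 ≤ μ * (c * θ) := by positivity
            nlinarith [sq_nonneg (μ + Z), mul_nonneg (by linarith : 0 ≤ c - 1) (sq_nonneg μ)]
      _ = _ := by rw [ENNReal.tsum_mul_right, tsum_gridWeights hb h0 h1, one_mul, one_mul]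
  -- Here 8 = 1 + 6 + 1: the atom at zero, the positive atoms and the negative atoms. Its logarithm
  -- is the 3 of the statement.
  have hT : tiltMass (scaledGridPrior r b η) c (c * θ + Z) ≤ ENNReal.ofReal (8 * Real.exp R) := by
    rw [tiltMass_scaledGridPrior, mul_add]
    calc _ ≤ ENNReal.ofReal (Real.exp R) +
          (ENNReal.ofReal (6 * Real.exp R) + ENNReal.ofReal (Real.exp R)) := by
          gcongr
          linarith [Real.one_le_exp hR1]
      _ = _ := by
          rw [← ENNReal.ofReal_add (by positivity) (by positivity),
            ← ENNReal.ofReal_add (by positivity) (by positivity)]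
          congr 1; ring
  have hTpos := ENNReal.toReal_pos (tiltMass_ne_zero (π := scaledGridPrior r b η) (p := 1 - η)
    (by linarith) ofReal_le_scaledGridPrior_zero c (c * θ + Z)) (tiltMass_ne_top hc0 _)
  have hlog := Real.log_le_log hTpos (ENNReal.toReal_le_of_le_ofReal (by positivity) hT)
  rw [Real.log_mul (by norm_num) (Real.exp_pos _).ne', Real.log_exp] at hlog
  have h8 : Real.log 8 ≤ 3 := by
    rw [show (8 : ℝ) = 2 ^ 3 by norm_num, Real.log_pow]
    have := Real.log_two_lt_d9
    push_cast
    linarith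
  rw [logTilt]
  linarith

end Weights

/-! ### Risk of the scaled grid prior in terms of a deterministic profile -/

section GridRisk

variable {r : ℝ≥0} {b η : ℝ}

theorem natCast_eq_add_sub (K k : ℕ) :
    (k : ℝ) = K + (((k : ℤ) - K : ℤ) : ℝ) := by push_cast; ring

theorem abs_le_half_one_add_sq (z : ℝ) : |z| ≤ (1 + z ^ 2) / 2 := by
  rw [← sq_abs z]; nlinarith [sq_nonneg (|z| - 1)]

/-- Geometric ratio at most 1/2 means that the atoms are at distance at least √(2 log 2), the
separation required by `gridExponent_le`. -/
theorem log_two_le_of_ratio (h0 : 0 < η) (h1 : η < 1)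
    (hq : η ^ (b ^ 2 * oracleVar r) ≤ 1 / 2) :
    Real.log 2 ≤ (gridSpacing r η * b) ^ 2 / 2 := by
  have h := Real.log_le_log (Real.rpow_pos_of_pos h0 _) hq
  rw [Real.log_rpow h0, one_div, Real.log_inv] at h
  rw [mul_pow, gridSpacing_sq h0 h1]
  linarith

/-- Upper bound for the log-mass of the past observation at `θ = λ t`, where
`t = 1 + b (K + u)`. -/
theorem integral_logTilt_one_le (hb : 0 < b) (hb1 : b ≤ 1) (h0 : 0 < η) (h1 : η < 1)
    (hq : η ^ (b ^ 2 * oracleVar r) ≤ 1 / 2) (K : ℕ) {t u : ℝ} (ht0 : 0 ≤ t)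
    (ht : t = 1 + b * (K + u)) (hu1 : u ≤ 1) (hu0 : 0 ≤ u ∨ K = 0) :
    ∫ x, logTilt (scaledGridPrior r b η) 1 x ∂gaussianReal (gridSpacing r η * t) 1 ≤
      gridSpacing r η ^ 2 / 2 * max (2 * (1 + b * K) * t - (1 + b * K) ^ 2 - (1 + (r : ℝ)⁻¹) -
        b ^ 2 * K) 0 + 6 + (3 + 4 * (r : ℝ)⁻¹) * gridSpacing r η := by
  have := isProbabilityMeasure_scaledGridPrior (r := r) hb h0 h1
  have hL := neg_log_eq_gridSpacing (r := r) h0 h1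
  have hv := oracleVar_mul (r := r)
  have hlog2 := log_two_le_of_ratio h0 h1 hq
  set lam := gridSpacing r η with hlam
  have hlam0 : 0 ≤ lam := gridSpacing_nonneg r η
  set v := oracleVar r
  set ri := (r : ℝ)⁻¹ with hri
  have hri0 : 0 ≤ ri := by positivity
  set d := 2 * (1 + b * K) * t - (1 + b * K) ^ 2 - (1 + ri) - b ^ 2 * K with hd
  set m := 1 + b * (K : ℝ) with hm
  have hK0 : (0 : ℝ) ≤ K := K.cast_nonneg
  have hm0 : 1 ≤ m := by rw [hm]; have : 0 ≤ b * (K : ℝ) := by positivity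
                         linarith
  have hpt : ∀ Z, logTilt (scaledGridPrior r b η) 1 (1 * (lam * t) + Z) ≤
      3 + max (lam ^ 2 / 2 * d + lam * m * Z) 0 + lam * b * |Z| + Z ^ 2 := by
    intro Z
    refine logTilt_scaledGridPrior_le hb h0 h1 le_rfl (by positivity) hlog2 (by positivity) K
      fun k => ?_
    set l : ℤ := (k : ℤ) - K with hl
    have hk : (k : ℝ) = K + (l : ℝ) := natCast_eq_add_sub K k
    have habs : (l.natAbs : ℝ) = |(l : ℝ)| := Nat.cast_natAbs l |>.trans (by push_cast; rfl)
    rw [habs, sq_abs]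
    have hlog : Real.log η = -((1 + ri) * lam ^ 2 / 2) := by linarith
    have hkv : (k : ℝ) * (b ^ 2 * v) * Real.log η = -(b ^ 2 * k * lam ^ 2 / 2) := by
      rw [hlog]; linear_combination (-(k : ℝ) * b ^ 2 * lam ^ 2 / 2) * hv
    -- This is where K is the best index: u ≤ 1 handles atoms above K and u ≥ 0 those below. If K =
    -- 0 there are none below, so u may be negative.
    have hlu : 2 * (l : ℝ) * u ≤ l + |(l : ℝ)| := by
      rcases le_or_gt 0 l with h | h
      · have h' : (0 : ℝ) ≤ l := by exact_mod_cast h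
        rw [abs_of_nonneg h']; nlinarith
      · have h' : (l : ℝ) < 0 := by exact_mod_cast h
        rw [abs_of_neg h']
        rcases hu0 with hu0 | hu0
        · nlinarith
        · omega
    have hlz : (l : ℝ) * Z ≤ |(l : ℝ)| * |Z| := by
      rw [← abs_mul]; exact le_abs_self _
    rw [hkv, hlog, hk]
    have h5 : 0 ≤ lam ^ 2 * b ^ 2 / 2 := by positivity
    have h6 := mul_le_mul_of_nonneg_left hlu h5
    have h7 := mul_le_mul_of_nonneg_left hlz (by positivity : 0 ≤ lam * b)
    rw [hd, hm, ht]
    linear_combination h6 + h7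
  have hI := integrable_logTilt_one (π := scaledGridPrior r b η) (p := 1 - η) (by linarith)
    ofReal_le_scaledGridPrior_zero (lam * t) 1
  have hpt' : ∀ x, logTilt (scaledGridPrior r b η) 1 x ≤
      3 + max (lam ^ 2 / 2 * d + lam * m * (x - lam * t)) 0 + lam * b * |x - lam * t| +
        (x - lam * t) ^ 2 := by
    intro x
    have := hpt (x - lam * t)
    rwa [one_mul, add_sub_cancel] at this
  have hlb : lam * b ≤ lam := mul_le_of_le_one_right hlam0 hb1
  have hmax : lam ^ 2 / 2 * max d 0 = max (lam ^ 2 / 2 * d) 0 := by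
    rw [mul_max_of_nonneg _ _ (by positivity), mul_zero]
  rw [hmax]
  -- For bounded m the noise λmZ may be bounded in absolute value at cost O(λ). For large m that
  -- would grow with θ, so the noise must stay linear and average out.
  rcases le_or_gt m (2 + 4 * ri) with hcase | hcase
  · have := integral_le_of_le_quadratic hI
      (3 + max (lam ^ 2 / 2 * d) 0 + (lam * m + lam * b) / 2) 0 (1 + (lam * m + lam * b) / 2)
      fun x => by
        set Z := x - lam * t
        refine (hpt' x).trans ?_
        have hz := abs_le_half_one_add_sq Z
        have h2 : max (lam ^ 2 / 2 * d + lam * m * Z) 0 ≤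
            max (lam ^ 2 / 2 * d) 0 + lam * m * |Z| := by
          have : lam * m * Z ≤ lam * m * |Z| :=
            mul_le_mul_of_nonneg_left (le_abs_self Z) (by positivity)
          have h3 : 0 ≤ lam * m * |Z| := by positivity
          refine max_le ?_ ?_
          · linarith [le_max_left (lam ^ 2 / 2 * d) 0]
          · linarith [le_max_right (lam ^ 2 / 2 * d) 0]
        have h4 := mul_le_mul_of_nonneg_left hz (by positivity : 0 ≤ lam * m + lam * b)
        linear_combination h2 + h4
    refine this.trans ?_
    have : lam * m ≤ lam * (2 + 4 * ri) := mul_le_mul_of_nonneg_left hcase hlam0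
    push_cast
    linarith
  · have hKpos : K ≠ 0 := by
      rintro rfl
      rw [hm] at hcase
      simp only [Nat.cast_zero, mul_zero, add_zero] at hcase
      linarith
    have hu : 0 ≤ u := hu0.resolve_right hKpos
    have hdm : m ^ 2 / 4 ≤ d := by
      have h2 : d = m ^ 2 + 2 * m * b * u - (1 + ri) - b * (m - 1) := by
        rw [hd, ht, hm]; ring
      have h3 : 0 ≤ 2 * m * b * u := by positivity
      have h4 : b * (m - 1) ≤ m - 1 := mul_le_of_le_one_left (by linarith) hb1
      nlinarith
    have := integral_le_of_le_quadratic hI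
      (3 + lam ^ 2 / 2 * d + lam * b / 2) (lam * m) (3 + lam * b / 2)
      fun x => by
        set Z := x - lam * t
        refine (hpt' x).trans ?_
        have hz := abs_le_half_one_add_sq Z
        -- Since d ≥ m²/4, adding 2Z² leaves at least (λm + 4Z)²/8 ≥ 0. Thus the maximum with 0 is
        -- removed at bounded cost and λmZ integrates to zero.
        have h2 : max (lam ^ 2 / 2 * d + lam * m * Z) 0 ≤
            lam ^ 2 / 2 * d + lam * m * Z + 2 * Z ^ 2 := by
          refine max_le (by nlinarith [sq_nonneg Z]) ?_
          have h3 := mul_le_mul_of_nonneg_left hdm (by positivity : 0 ≤ lam ^ 2 / 2)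
          nlinarith [sq_nonneg (lam * m + 4 * Z)]
        have h4 := mul_le_mul_of_nonneg_left hz (by positivity : 0 ≤ lam * b)
        linear_combination h2 + h4
    refine this.trans ?_
    have h5 : 0 ≤ ri * lam := by positivity
    have := le_max_left (lam ^ 2 / 2 * d) 0
    push_cast
    linarith

/-- Lower bound for the log-mass of the joint observation, from the atom of index `k`. -/
theorem le_integral_logTilt_prod (hr : r ≠ 0) (hb : 0 < b) (h0 : 0 < η) (h1 : η < 1)
    (hq : η ^ (b ^ 2 * oracleVar r) ≤ 1 / 2) (k : ℕ) (t : ℝ) :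
    gridSpacing r η ^ 2 / 2 * ((1 + (r : ℝ)⁻¹) * (2 * (1 + b * k) * t - (1 + b * k) ^ 2 - 1) -
        b ^ 2 * k) - 2 ≤
      ∫ z : ℝ × ℝ, logTilt (scaledGridPrior r b η) (1 + (r : ℝ)⁻¹) (z.1 + z.2 / r)
        ∂((gaussianReal (gridSpacing r η * t) 1).prod (gaussianReal (gridSpacing r η * t) r)) := by
  have := isProbabilityMeasure_scaledGridPrior (r := r) hb h0 h1
  have hL := neg_log_eq_gridSpacing (r := r) h0 h1
  have hv := oracleVar_mul (r := r)
  have hq0 : 0 < η ^ (b ^ 2 * oracleVar r) := Real.rpow_pos_of_pos h0 _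
  have hkq : 0 < η ^ ((k : ℝ) * (b ^ 2 * oracleVar r)) := Real.rpow_pos_of_pos h0 _
  have hI := integrable_logTilt_prod (π := scaledGridPrior r b η) (p := 1 - η) (r := r)
    (by linarith) ofReal_le_scaledGridPrior_zero (gridSpacing r η * t) (gridSpacing r η * t) 1 r
  have hat := ofReal_le_scaledGridPrior_atom (r := r) (b := b) h0 k
  -- The factor η/2 and the normalization 1 - η^(b²v) ≥ 1/2 together lose a factor 4, and log 4 ≤ 2.
  have hwlog : -2 + Real.log η + k * (b ^ 2 * oracleVar r) * Real.log η ≤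
      Real.log (η / 2 * ((1 - η ^ (b ^ 2 * oracleVar r)) *
        η ^ ((k : ℝ) * (b ^ 2 * oracleVar r)))) := by
    have h5 : η * (1 / 4) * η ^ ((k : ℝ) * (b ^ 2 * oracleVar r)) ≤
        η / 2 * ((1 - η ^ (b ^ 2 * oracleVar r)) * η ^ ((k : ℝ) * (b ^ 2 * oracleVar r))) := by
      rw [← mul_assoc (η / 2)]
      apply mul_le_mul_of_nonneg_right _ hkq.le
      nlinarith
    refine le_trans ?_ (Real.log_le_log (by positivity) h5)
    rw [Real.log_mul (by positivity) hkq.ne', Real.log_mul h0.ne' (by norm_num),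
      Real.log_rpow h0]
    have : Real.log (1 / 4) = -(2 * Real.log 2) := by
      rw [one_div, Real.log_inv, show (4 : ℝ) = 2 ^ 2 by norm_num, Real.log_pow]; norm_num
    linarith [Real.log_two_lt_d9]
  set w := η / 2 * ((1 - η ^ (b ^ 2 * oracleVar r)) * η ^ ((k : ℝ) * (b ^ 2 * oracleVar r)))
  have hw0 : 0 < w := by
    have : 0 < 1 - η ^ (b ^ 2 * oracleVar r) := by linarith
    positivity
  set lam := gridSpacing r η
  set v := oracleVar r
  set m := 1 + b * (k : ℝ) with hm
  have hr' : (r : ℝ) ≠ 0 := by exact_mod_cast hr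
  set c := 1 + (r : ℝ)⁻¹ with hc
  have key : ∫ z : ℝ × ℝ, -logTilt (scaledGridPrior r b η) c (z.1 + z.2 / r)
      ∂((gaussianReal (lam * t) 1).prod (gaussianReal (lam * t) r)) ≤ _ :=
    integral_prod_le_of_le_quadratic hI.neg
    (-(Real.log w + (lam * m * (c * (lam * t)) - c * (lam * m) ^ 2 / 2)))
    (-(lam * m)) (-(lam * m * (r : ℝ)⁻¹)) 0 0 fun z => by
      have := log_add_le_logTilt (one_add_inv_pos r) hw0 hat (z.1 + z.2 / r)
      change -logTilt _ c (z.1 + z.2 / r) ≤ _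
      rw [div_eq_mul_inv z.2] at this ⊢
      rw [hc]
      linear_combination this
  rw [integral_neg] at key
  have hkv : (k : ℝ) * (b ^ 2 * v) * Real.log η = -(b ^ 2 * k * lam ^ 2 / 2) := by
    have hlog : Real.log η = -(c * lam ^ 2 / 2) := by linarith
    rw [hlog]; linear_combination (-(k : ℝ) * b ^ 2 * lam ^ 2 / 2) * hv
  linear_combination key + hwlog - hkv + hL

/-- The risk at `λ t`, `t ≥ 1`, in terms of any atom of index `k` and of the index `K` of the grid
point below `t`. -/
theorem uniRisk_scaledGridPrior_le (hr : r ≠ 0) (hb : 0 < b) (hb1 : b ≤ 1) (h0 : 0 < η)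
    (h1 : η < 1) (hq : η ^ (b ^ 2 * oracleVar r) ≤ 1 / 2) (K k : ℕ) {t u : ℝ} (ht0 : 0 ≤ t)
    (ht : t = 1 + b * (K + u)) (hu0 : 0 ≤ u) (hu1 : u ≤ 1) :
    uniRisk r (scaledGridPrior r b η) (gridSpacing r η * t) ≤ gridSpacing r η ^ 2 / 2 *
      ((r : ℝ)⁻¹ * t ^ 2 - (1 + (r : ℝ)⁻¹) * (2 * (1 + b * k) * t - (1 + b * k) ^ 2 - 1) +
        b ^ 2 * k + max (2 * (1 + b * K) * t - (1 + b * K) ^ 2 - (1 + (r : ℝ)⁻¹) -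
        b ^ 2 * K) 0) + 8 + (3 + 4 * (r : ℝ)⁻¹) * gridSpacing r η := by
  have := isProbabilityMeasure_scaledGridPrior (r := r) hb h0 h1
  have hD := integral_logTilt_one_le hb hb1 h0 h1 hq K ht0 ht hu1 (Or.inl hu0)
  have hN := le_integral_logTilt_prod hr hb h0 h1 hq k t
  rw [uniRisk_eq (p := 1 - η) (by linarith) ofReal_le_scaledGridPrior_zero]
  have hr' : (r : ℝ) ≠ 0 := by exact_mod_cast hr
  have : (gridSpacing r η * t) ^ 2 / (2 * r) = gridSpacing r η ^ 2 / 2 * ((r : ℝ)⁻¹ * t ^ 2) := by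
    field_simp
  linear_combination hD + hN + this

theorem eta_le_half (hb1 : b ≤ 1) (hb : 0 < b) (h0 : 0 < η) (h1 : η < 1)
    (hq : η ^ (b ^ 2 * oracleVar r) ≤ 1 / 2) : η ≤ 1 / 2 := by
  refine le_trans ?_ hq
  have h : b ^ 2 * oracleVar r ≤ 1 :=
    mul_le_one₀ (pow_le_one₀ hb.le hb1) oracleVar_pos.le oracleVar_le_one
  calc η = η ^ (1 : ℝ) := (Real.rpow_one η).symm
    _ ≤ _ := Real.rpow_le_rpow_of_exponent_ge h0 h1.le h

theorem neg_log_one_sub_le {η : ℝ} (h0 : 0 < η) (hη : η ≤ 1 / 2) : -Real.log (1 - η) ≤ 2 * η := by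
  have h := Real.one_sub_inv_le_log_of_pos (show 0 < 1 - η by linarith)
  have : (1 - η)⁻¹ ≤ 1 + 2 * η := by
    rw [inv_le_comm₀ (by linarith) (by linarith), inv_le_iff_one_le_mul₀ (by linarith)]
    nlinarith
  linarith

/-- Up to the first positive atom the atom at 0 suffices for the joint mass, and θ²/(2r) is at most
λ²/(2r). -/
theorem uniRisk_scaledGridPrior_le_of_le_one (hr : r ≠ 0) (hb : 0 < b) (hb1 : b ≤ 1) (h0 : 0 < η)
    (h1 : η < 1) (hq : η ^ (b ^ 2 * oracleVar r) ≤ 1 / 2) {t : ℝ} (ht0 : 0 ≤ t) (ht1 : t ≤ 1) :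
    uniRisk r (scaledGridPrior r b η) (gridSpacing r η * t) ≤ gridSpacing r η ^ 2 / 2 *
      (r : ℝ)⁻¹ + 8 + (3 + 4 * (r : ℝ)⁻¹) * gridSpacing r η := by
  have := isProbabilityMeasure_scaledGridPrior (r := r) hb h0 h1
  have hη := eta_le_half hb1 hb h0 h1 hq
  have hri0 : 0 ≤ (r : ℝ)⁻¹ := by positivity
  -- Here K = 0 and u = (t - 1)/b ≤ 0. The best positive exponent is not positive because t ≤ 1.
  have hD := integral_logTilt_one_le hb hb1 h0 h1 hq 0 (u := (t - 1) / b) ht0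
    (by field_simp; push_cast; ring) ((div_nonpos_of_nonpos_of_nonneg (by linarith) hb.le).trans
      zero_le_one) (Or.inr rfl)
  rw [max_eq_right (by simp only [Nat.cast_zero]; nlinarith)] at hD
  have hN : Real.log (1 - η) ≤
      ∫ z : ℝ × ℝ, logTilt (scaledGridPrior r b η) (1 + (r : ℝ)⁻¹) (z.1 + z.2 / r)
        ∂((gaussianReal (gridSpacing r η * t) 1).prod (gaussianReal (gridSpacing r η * t) r)) := by
    have h := integral_mono (integrable_const (Real.log (1 - η)))
      (integrable_logTilt_prod (π := scaledGridPrior r b η) (p := 1 - η) (r := r)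
        (by linarith) ofReal_le_scaledGridPrior_zero (gridSpacing r η * t)
        (gridSpacing r η * t) 1 r)
      fun z => log_le_logTilt (one_add_inv_pos r) (by linarith) ofReal_le_scaledGridPrior_zero _
    simpa using h
  rw [uniRisk_eq (p := 1 - η) (by linarith) ofReal_le_scaledGridPrior_zero]
  have hr' : (r : ℝ) ≠ 0 := by exact_mod_cast hr
  have h2 : (gridSpacing r η * t) ^ 2 / (2 * r) ≤ gridSpacing r η ^ 2 / 2 * (r : ℝ)⁻¹ := by
    have : (gridSpacing r η * t) ^ 2 / (2 * r) =
        gridSpacing r η ^ 2 / 2 * (r : ℝ)⁻¹ * t ^ 2 := by field_simp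
    rw [this]
    exact mul_le_of_le_one_right (by positivity) (pow_le_one₀ ht0 ht1)
  have := neg_log_one_sub_le h0 hη
  linarith

theorem uniRisk_scaledGridPrior_neg (hb : 0 < b) (h0 : 0 < η) (h1 : η < 1) (θ : ℝ) :
    uniRisk r (scaledGridPrior r b η) (-θ) = uniRisk r (scaledGridPrior r b η) θ := by
  have hmap : ∀ (F : ℝ → ℝ) (hF : Measurable F) (w : ℝ≥0),
      ∫ x, F x ∂gaussianReal (-θ) w = ∫ x, F (-x) ∂gaussianReal θ w := by
    intro F hF w
    rw [← gaussianReal_map_neg, integral_map measurable_neg.aemeasurable hF.aestronglyMeasurable]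
  have := isProbabilityMeasure_scaledGridPrior (r := r) hb h0 h1
  have hm1 := measurable_logTilt (π := scaledGridPrior r b η) 1
  have hm2 : ∀ x : ℝ, Measurable fun y : ℝ =>
      logTilt (scaledGridPrior r b η) (1 + (r : ℝ)⁻¹) (x + y / r) :=
    fun x => (measurable_logTilt _).comp (by fun_prop)
  have hp := integrable_logTilt_prod (π := scaledGridPrior r b η) (p := 1 - η) (r := r)
    (by linarith) ofReal_le_scaledGridPrior_zero
  have hN : ∫ z : ℝ × ℝ, logTilt (scaledGridPrior r b η) (1 + (r : ℝ)⁻¹) (z.1 + z.2 / r)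
        ∂((gaussianReal (-θ) 1).prod (gaussianReal (-θ) r)) =
      ∫ z : ℝ × ℝ, logTilt (scaledGridPrior r b η) (1 + (r : ℝ)⁻¹) (z.1 + z.2 / r)
        ∂((gaussianReal θ 1).prod (gaussianReal θ r)) := by
    have hm3 : StronglyMeasurable fun z : ℝ × ℝ =>
        logTilt (scaledGridPrior r b η) (1 + (r : ℝ)⁻¹) (z.1 + z.2 / r) :=
      Measurable.stronglyMeasurable ((measurable_logTilt _).comp (by fun_prop))
    rw [integral_prod _ (hp _ _ _ _), integral_prod _ (hp _ _ _ _),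
      hmap _ hm3.integral_prod_right.measurable]
    refine integral_congr_ae (ae_of_all _ fun x => ?_)
    change ∫ y, logTilt _ _ (-x + y / r) ∂gaussianReal (-θ) r = _
    rw [hmap _ (hm2 _)]
    refine integral_congr_ae (ae_of_all _ fun y => ?_)
    change logTilt _ _ (-x + -y / r) = _
    rw [← logTilt_scaledGridPrior_neg]
    congr 1; ring
  have hD : ∫ x, logTilt (scaledGridPrior r b η) 1 x ∂gaussianReal (-θ) 1 =
      ∫ x, logTilt (scaledGridPrior r b η) 1 x ∂gaussianReal θ 1 := by
    rw [hmap _ hm1]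
    simp_rw [logTilt_scaledGridPrior_neg]
  rw [uniRisk_eq (p := 1 - η) (by linarith) ofReal_le_scaledGridPrior_zero,
    uniRisk_eq (p := 1 - η) (by linarith) ofReal_le_scaledGridPrior_zero, hN, hD, neg_sq]

/-- A bound `F` for the limiting risk profile at every `t ≥ 1` bounds the risk everywhere. -/
theorem uniRisk_scaledGridPrior_le_of_profile (hr : r ≠ 0) (hb : 0 < b) (hb1 : b ≤ 1) (h0 : 0 < η)
    (h1 : η < 1) (hq : η ^ (b ^ 2 * oracleVar r) ≤ 1 / 2) {F : ℝ} (hF1 : 1 ≤ F)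
    (hF : ∀ (K : ℕ) (u : ℝ), 0 ≤ u → u ≤ 1 → ∃ k : ℕ,
      (r : ℝ)⁻¹ * (1 + b * (K + u)) ^ 2 - (1 + (r : ℝ)⁻¹) *
        (2 * (1 + b * k) * (1 + b * (K + u)) - (1 + b * k) ^ 2 - 1) +
        b ^ 2 * k + max (2 * (1 + b * K) * (1 + b * (K + u)) - (1 + b * K) ^ 2 -
          (1 + (r : ℝ)⁻¹) - b ^ 2 * K) 0 ≤ (r : ℝ)⁻¹ * F) (θ : ℝ) :
    uniRisk r (scaledGridPrior r b η) θ ≤ gridSpacing r η ^ 2 / 2 *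
      ((r : ℝ)⁻¹ * F) + 8 + (3 + 4 * (r : ℝ)⁻¹) * gridSpacing r η := by
  wlog hθ : 0 ≤ θ generalizing θ
  · rw [← uniRisk_scaledGridPrior_neg hb h0 h1]
    exact this (-θ) (by linarith)
  have hlam : 0 < gridSpacing r η := by
    refine (gridSpacing_nonneg r η).lt_of_ne fun h => ?_
    have := log_two_le_of_ratio h0 h1 hq
    rw [← h] at this
    have h2 := Real.log_pos one_lt_two
    norm_num at this
    linarith
  have hri0 : 0 ≤ (r : ℝ)⁻¹ := by positivity
  obtain ⟨t, ht⟩ : ∃ t, θ = gridSpacing r η * t := ⟨θ / gridSpacing r η, by field_simp⟩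
  have ht0 : 0 ≤ t := by
    rw [ht] at hθ
    exact nonneg_of_mul_nonneg_right hθ hlam
  rw [ht]
  rcases le_total t 1 with ht1 | ht1
  · refine (uniRisk_scaledGridPrior_le_of_le_one hr hb hb1 h0 h1 hq ht0 ht1).trans ?_
    have : (r : ℝ)⁻¹ ≤ (r : ℝ)⁻¹ * F := le_mul_of_one_le_right hri0 hF1
    have := mul_le_mul_of_nonneg_left this (by positivity : 0 ≤ gridSpacing r η ^ 2 / 2)
    linarith
  · have hx : 0 ≤ (t - 1) / b := div_nonneg (by linarith) hb.le
    set K := ⌊(t - 1) / b⌋₊ with hK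
    set u := (t - 1) / b - K with hu
    have hu0 : 0 ≤ u := by have := Nat.floor_le hx; rw [hu]; linarith
    have hu1 : u ≤ 1 := by have := Nat.lt_floor_add_one ((t - 1) / b); rw [hu]; linarith
    have htu : t = 1 + b * (K + u) := by rw [hu]; field_simp; ring
    obtain ⟨k, hk⟩ := hF K u hu0 hu1
    refine (uniRisk_scaledGridPrior_le hr hb hb1 h0 h1 hq K k ht0 htu hu0 hu1).trans ?_
    rw [htu]
    gcongr

end GridRisk

/-! ### Maximizing the risk profile, and the critical point of the grid prior -/

section Profile

variable {r : ℝ≥0} {b η : ℝ}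

/-- Case k = K: the same atom is used for the joint and the past masses, so most terms cancel
through x + max(-x, 0) = max(0, x). What is left is the squared distance to the atom and a remaining
prior penalty. -/
theorem profile_eq (ri b u : ℝ) (K : ℝ) :
    ri * (1 + b * (K + u)) ^ 2 - (1 + ri) *
      (2 * (1 + b * K) * (1 + b * (K + u)) - (1 + b * K) ^ 2 - 1) + b ^ 2 * K +
      max (2 * (1 + b * K) * (1 + b * (K + u)) - (1 + b * K) ^ 2 - (1 + ri) - b ^ 2 * K) 0 =
    ri * (b * u) ^ 2 +
      max 0 (1 + ri + b ^ 2 * K - ((1 + b * K) ^ 2 + 2 * (1 + b * K) * (b * u))) := by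
  have h : ∀ x : ℝ, x + max (-x) 0 = max 0 x := by
    intro x
    rcases le_total x 0 with h | h
    · rw [max_eq_left (by linarith), max_eq_left h]; ring
    · rw [max_eq_right (by linarith), max_eq_right h]; ring
  rw [← h]
  have h2 : 2 * (1 + b * K) * (1 + b * (K + u)) - (1 + b * K) ^ 2 - (1 + ri) - b ^ 2 * K =
      -(1 + ri + b ^ 2 * K - ((1 + b * K) ^ 2 + 2 * (1 + b * K) * (b * u))) := by ring
  rw [h2]
  ring

/-- Choosing k = K always, the distance to the atom costs at most b²/r and the remaining penalty at
most 1/r. Small b makes this prior nearly minimax. -/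
theorem uniRisk_scaledGridPrior_le_one_add_sq (hr : r ≠ 0) (hb : 0 < b) (hb1 : b ≤ 1) (h0 : 0 < η)
    (h1 : η < 1) (hq : η ^ (b ^ 2 * oracleVar r) ≤ 1 / 2) (θ : ℝ) :
    uniRisk r (scaledGridPrior r b η) θ ≤ gridSpacing r η ^ 2 / 2 *
      ((r : ℝ)⁻¹ * (1 + b ^ 2)) + 8 + (3 + 4 * (r : ℝ)⁻¹) * gridSpacing r η := by
  refine uniRisk_scaledGridPrior_le_of_profile hr hb hb1 h0 h1 hq (by nlinarith)
    (fun K u hu0 hu1 => ⟨K, ?_⟩) θ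
  have hri0 : 0 ≤ (r : ℝ)⁻¹ := by positivity
  rw [profile_eq]
  have hK : (0 : ℝ) ≤ K := K.cast_nonneg
  have hbu : (b * u) ^ 2 ≤ b ^ 2 := by
    rw [mul_pow]; exact mul_le_of_le_one_right (sq_nonneg b) (pow_le_one₀ hu0 hu1)
  have h2 : 1 + (r : ℝ)⁻¹ + b ^ 2 * K -
      ((1 + b * K) ^ 2 + 2 * (1 + b * K) * (b * u)) ≤ (r : ℝ)⁻¹ := by
    have h3 : b ^ 2 * K ≤ b * K := by
      apply mul_le_mul_of_nonneg_right _ hK; nlinarith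
    have h4 : 0 ≤ 2 * (1 + b * K) * (b * u) := by positivity
    have h5 : 0 ≤ b * K := by positivity
    nlinarith [sq_nonneg (b * (K : ℝ))]
  have h3 := max_le hri0 h2
  have h4 := mul_le_mul_of_nonneg_left hbu hri0
  linarith

/-- With u₀ = (1 + v)/2 this is h_r = u₀² - 2ru₀, so (1 + h_r)/r is the value at u₀ of the branch
1/r + u²/r - 2u of the profile with K = 0. -/
theorem hConst_eq (hr : r ≠ 0) :
    hConst r = ((1 + oracleVar r) / 2) ^ 2 - 2 * r * ((1 + oracleVar r) / 2) := by
  have hr' : 0 < (r : ℝ) := by exact_mod_cast pos_iff_ne_zero.2 hr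
  have : oracleVar r = r / (1 + r) := by
    rw [oracleVar]; field_simp; ring
  rw [this, hConst]
  field_simp
  ring

/-- Use the atom below t for u ≤ u₀ and the atom above t otherwise. Where the penalty is active, the
bound is convex in u before u₀ and decreasing after it, so only u = 0 and u = u₀ matter: they give
the 1 and the 1 + h_r. -/
theorem uniRisk_gridPrior_le (hr : r ≠ 0) (h0 : 0 < η)
    (h1 : η < 1) (hq : η ^ oracleVar r ≤ 1 / 2) (θ : ℝ) :
    uniRisk r (gridPrior r η) θ ≤ gridSpacing r η ^ 2 / 2 *
      ((r : ℝ)⁻¹ * (1 + max (hConst r) 0)) + 8 + (3 + 4 * (r : ℝ)⁻¹) * gridSpacing r η := by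
  rw [← scaledGridPrior_one]
  have hr' : 0 < (r : ℝ) := by exact_mod_cast pos_iff_ne_zero.2 hr
  have hri0 : 0 < (r : ℝ)⁻¹ := by positivity
  have hv1 := oracleVar_le_one (r := r)
  have hv0 := oracleVar_pos (r := r)
  have hv := oracleVar_mul (r := r)
  have hH0 := le_max_right (hConst r) 0
  have hrh : (r : ℝ)⁻¹ * hConst r =
      (r : ℝ)⁻¹ * ((1 + oracleVar r) / 2) ^ 2 - 2 * ((1 + oracleVar r) / 2) := by
    rw [hConst_eq hr]; field_simp
  have hrH : (r : ℝ)⁻¹ * hConst r ≤ (r : ℝ)⁻¹ * max (hConst r) 0 :=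
    mul_le_mul_of_nonneg_left (le_max_left _ _) hri0.le
  have hrH0 : 0 ≤ (r : ℝ)⁻¹ * max (hConst r) 0 := by positivity
  set H := max (hConst r) 0
  set ri := (r : ℝ)⁻¹
  set u₀ := (1 + oracleVar r) / 2 with hu₀
  refine uniRisk_scaledGridPrior_le_of_profile hr one_pos le_rfl h0 h1 (by simpa using hq)
    (by linarith) (fun K u hu0 hu1 => ?_) θ
  have hK : (0 : ℝ) ≤ K := K.cast_nonneg
  have hu2 : u ^ 2 ≤ 1 := pow_le_one₀ hu0 hu1
  -- The penalty is largest for K = 0, which reduces the analysis to the first grid cell.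
  have hX : 1 + ri + 1 ^ 2 * K - ((1 + 1 * (K : ℝ)) ^ 2 + 2 * (1 + 1 * K) * (1 * u)) ≤
      ri - 2 * u := by
    have : 0 ≤ (K : ℝ) * u := by positivity
    nlinarith
  have hA := mul_le_mul_of_nonneg_left hu2 hri0.le
  rcases le_or_gt u u₀ with hu | hu
  · refine ⟨K, ?_⟩
    rw [profile_eq, one_mul]
    have h3 : ri * u ^ 2 - 2 * u ≤ ri * H := by
      -- The convex function u²/r - 2u is nonpositive while u/r ≤ 2 and increasing beyond, hence
      -- bounded there by its value at u₀.
      rcases le_or_gt (ri * u) 2 with h4 | h4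
      · nlinarith
      · refine le_trans ?_ hrH
        rw [hrh]
        have h5 : 0 ≤ ri * u₀ := by positivity
        have h6 := mul_nonneg (sub_nonneg.2 hu) (show 0 ≤ ri * (u₀ + u) - 2 by linarith)
        linear_combination h6
    rcases le_total (1 + ri + 1 ^ 2 * K - ((1 + 1 * (K : ℝ)) ^ 2 + 2 * (1 + 1 * K) * u)) 0
      with h5 | h5
    · rw [max_eq_left h5]; linarith
    · rw [max_eq_right h5]; rw [one_mul] at hX; linarith
  · refine ⟨K + 1, ?_⟩
    have h6 := profile_eq ri 1 u K
    rw [one_mul u] at h6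
    rw [one_mul] at hX
    push_cast
    have h7 : 0 ≤ (1 + ri) * (2 * (u - u₀)) := by
      have : 0 ≤ u - u₀ := by linarith
      positivity
    -- Passing from atom K to K + 1 lowers the profile by c(2u - 1) - 1, which vanishes exactly at
    -- u₀ because cv = 1.
    have h8 : (1 + ri) * (2 * (u - u₀)) = (1 + ri) * (2 * u - 1) - 1 := by
      rw [hu₀]; linear_combination -hv
    have h9 : ri * u ^ 2 + ri - 2 * u - ((1 + ri) * (2 * u - 1) - 1) ≤ ri * (1 + H) := by
      have : ri * u ^ 2 - 2 * u - ((1 + ri) * (2 * u - 1) - 1) ≤ ri * u₀ ^ 2 - 2 * u₀ := by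
        rw [← h8]
        have h10 : 0 ≤ u - u₀ := by linarith
        have h11 : ri * (u + u₀) ≤ ri * 2 :=
          mul_le_mul_of_nonneg_left (by rw [hu₀]; linarith) hri0.le
        have h12 := mul_nonneg h10 (show 0 ≤ 4 + 2 * ri - ri * (u + u₀) by linarith)
        linear_combination h12
      linarith
    rcases le_total (1 + ri + 1 ^ 2 * K - ((1 + 1 * (K : ℝ)) ^ 2 + 2 * (1 + 1 * K) * u)) 0
      with h5 | h5
    · rw [max_eq_left h5] at h6
      linear_combination h6 + hA + h7 + h8 + hrH0
    · rw [max_eq_right h5] at h6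
      linear_combination h6 + hX + h9

/-- Lower bound for the risk of the grid prior halfway (up to `v / 2`) between the first two
positive grid points. -/
theorem le_uniRisk_gridPrior (hr : r ≠ 0) (h0 : 0 < η)
    (h1 : η < 1) (hq : η ^ oracleVar r ≤ 1 / 2) :
    gridSpacing r η ^ 2 / 2 * ((r : ℝ)⁻¹ * (1 + hConst r)) - (4 + 2 * (1 + (r : ℝ)⁻¹) +
      gridSpacing r η * (2 + (r : ℝ)⁻¹) * (3 / 2 + (r : ℝ)⁻¹)) ≤
    uniRisk r (gridPrior r η) (gridSpacing r η * (1 + (1 + oracleVar r) / 2)) := by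
  rw [← scaledGridPrior_one]
  have := isProbabilityMeasure_scaledGridPrior (r := r) one_pos h0 h1
  have hq' : η ^ ((1 : ℝ) ^ 2 * oracleVar r) ≤ 1 / 2 := by simpa using hq
  have hη := eta_le_half le_rfl one_pos h0 h1 hq'
  have hL := neg_log_eq_gridSpacing (r := r) h0 h1
  have hr' : 0 < (r : ℝ) := by exact_mod_cast pos_iff_ne_zero.2 hr
  have hri0 : 0 < (r : ℝ)⁻¹ := by positivity
  have hrr : (r : ℝ)⁻¹ * r = 1 := inv_mul_cancel₀ hr'.ne'
  have hv1 := oracleVar_le_one (r := r)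
  have hv0 := oracleVar_pos (r := r)
  have hv := oracleVar_mul (r := r)
  have hlog2 := log_two_le_of_ratio h0 h1 hq'
  rw [mul_one] at hlog2
  have hh := hConst_eq hr
  set lam := gridSpacing r η with hlam
  have hlam0 : 0 ≤ lam := gridSpacing_nonneg r η
  set v := oracleVar r
  set ri := (r : ℝ)⁻¹ with hri
  set c := 1 + ri with hc
  have hc1 : 1 ≤ c := by rw [hc]; linarith
  set t := 1 + (1 + v) / 2 with ht
  -- At this t the exponent of atom k without noise is exactly the one at k = 0 minus cλ²(k² - k)/2.
  -- So κ² = cλ², and the atoms 0 and 1 tie.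
  set κ := lam * √c with hκ
  have hsq : √c ^ 2 = c := Real.sq_sqrt (by linarith)
  have hs1 : 1 ≤ √c := Real.one_le_sqrt.2 hc1
  have hsc : √c ≤ c := by nlinarith
  have hκ2 : κ ^ 2 = lam ^ 2 * c := by rw [hκ, mul_pow, hsq]
  have hpt : ∀ Z, logTilt (scaledGridPrior r 1 η) c (c * (lam * t) + Z) ≤
      3 + max (lam ^ 2 * c / 2 * (1 + v) + lam * Z) 0 + κ * |Z| + Z ^ 2 := by
    intro Z
    refine logTilt_scaledGridPrior_le one_pos h0 h1 hc1 (by positivity) ?_ (by positivity) 0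
      fun k => ?_
    · rw [hκ2]; nlinarith [sq_nonneg lam]
    · have hlog : Real.log η = -(c * lam ^ 2 / 2) := by linarith
      have hkv : (k : ℝ) * (1 ^ 2 * v) * Real.log η = -(k * lam ^ 2 / 2) := by
        rw [hlog]; linear_combination (-(k : ℝ) * lam ^ 2 / 2) * hv
      rw [hkv, hlog]
      simp only [Nat.cast_zero, sub_zero, Int.natAbs_natCast]
      rw [hκ2]
      have h1 : lam * k * Z ≤ k * κ * |Z| := by
        have h2 : lam * k * Z ≤ lam * k * |Z| :=
          mul_le_mul_of_nonneg_left (le_abs_self Z) (by positivity)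
        have h3 : lam * k * |Z| ≤ k * κ * |Z| := by
          refine mul_le_mul_of_nonneg_right ?_ (abs_nonneg Z)
          rw [hκ]
          have : 0 ≤ lam * k := by positivity
          nlinarith
        exact h2.trans h3
      rw [ht]
      linear_combination h1 + (lam ^ 2 / 2 * k) * hv
  have hI := integrable_logTilt_prod (π := scaledGridPrior r 1 η) (p := 1 - η) (r := r)
    (by linarith) ofReal_le_scaledGridPrior_zero (lam * t) (lam * t) 1 r
  have hN := integral_prod_le_of_le_quadratic hI
    (3 + lam ^ 2 * c / 2 * (1 + v) + (lam + κ) / 2) 0 0 (2 * ((lam + κ) / 2 + 1))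
    (2 * ((lam + κ) / 2 + 1) * ri ^ 2) fun z => by
      set Z := (z.1 - lam * t) + (z.2 - lam * t) * ri with hZ
      have hs : z.1 + z.2 / r = c * (lam * t) + Z := by
        rw [div_eq_mul_inv, hZ, hc]; ring
      rw [hs]
      refine (hpt Z).trans ?_
      have hz := abs_le_half_one_add_sq Z
      have h2 : max (lam ^ 2 * c / 2 * (1 + v) + lam * Z) 0 ≤
          lam ^ 2 * c / 2 * (1 + v) + lam * |Z| := by
        refine max_le ?_ (by positivity)
        have := mul_le_mul_of_nonneg_left (le_abs_self Z) hlam0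
        linarith
      have h3 := mul_le_mul_of_nonneg_left hz (by positivity : 0 ≤ lam + κ)
      have h4 : Z ^ 2 ≤ 2 * (z.1 - lam * t) ^ 2 + 2 * ((z.2 - lam * t) * ri) ^ 2 := by
        linear_combination sq_nonneg ((z.1 - lam * t) - (z.2 - lam * t) * ri)
      have h5 := mul_le_mul_of_nonneg_left h4 (by positivity : 0 ≤ (lam + κ) / 2 + 1)
      linear_combination h2 + h3 + h5
  -- For a lower bound the past log-mass is reduced to its atom at 0. Nothing is lost at first order
  -- when h_r ≥ 0, since then 2ru₀ ≤ u₀² ≤ 1 and no positive atom dominates.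
  have hD : Real.log (1 - η) ≤ ∫ x, logTilt (scaledGridPrior r 1 η) 1 x
      ∂gaussianReal (lam * t) 1 := by
    have h := integral_mono (integrable_const (Real.log (1 - η)))
      (integrable_logTilt_one (π := scaledGridPrior r 1 η) (p := 1 - η) (by linarith)
        ofReal_le_scaledGridPrior_zero (lam * t) 1)
      fun z => log_le_logTilt one_pos (by linarith) ofReal_le_scaledGridPrior_zero z
    simpa using h
  have hlogη := neg_log_one_sub_le h0 hη
  rw [uniRisk_eq (p := 1 - η) (by linarith) ofReal_le_scaledGridPrior_zero]
  have h6 : (lam * t) ^ 2 / (2 * r) = lam ^ 2 / 2 * (ri * t ^ 2) := by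
    rw [hri]; field_simp
  have h7 : ri * (1 + hConst r) = ri * t ^ 2 - c * (1 + v) := by
    rw [hh, ht, hc]
    linear_combination (-(1 + v)) * hrr
  have hκc : κ ≤ lam * c := mul_le_mul_of_nonneg_left hsc hlam0
  have h8 : ri ^ 2 * r = ri := by rw [sq, mul_assoc, hrr, mul_one]
  have h9 : (lam + κ) * (1 / 2 + c) ≤ (lam + lam * c) * (1 / 2 + c) := by gcongr
  rw [h6, h7]
  push_cast at hN
  have h10 : 2 * ((lam + κ) / 2 + 1) * ri ^ 2 * (r : ℝ) = 2 * ((lam + κ) / 2 + 1) * ri := by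
    rw [mul_assoc, h8]
  rw [h10] at hN
  have hce : c = 1 + ri := hc
  rw [hce] at hN h9 ⊢
  linarith

end Profile

/-! ### Lower bound for the minimax risk -/

section Bayes

theorem measurable_of_uncurry {α β γ : Type*} [MeasurableSpace α] [MeasurableSpace β]
    [MeasurableSpace γ] (F : α → β → γ) (h : Measurable fun z : α × β => F z.1 z.2) (x : α) :
    Measurable (F x) :=
  h.comp measurable_prodMk_left

variable {n : ℕ} {ι : Type*} [Fintype ι]

/-- The log-likelihood ratio of `(x, y)` between the means `θ` and `0`. -/
noncomputable def logLik (r : ℝ≥0) (θ x y : Fin n → ℝ) : ℝ :=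
  ∑ i, (θ i * (x i + y i / r) - (1 + (r : ℝ)⁻¹) * θ i ^ 2 / 2)

/-- The log-likelihood ratio between the uniform mixture of the `θ j` and the mean `0`. -/
noncomputable def logMix (r : ℝ≥0) (θ : ι → Fin n → ℝ) (x y : Fin n → ℝ) : ℝ :=
  Real.log ((∑ j, Real.exp (logLik r (θ j) x y)) / Fintype.card ι)

/-- The test function for the variational lower bound on the loss. -/
noncomputable def testFun (r : ℝ≥0) (θ : ι → Fin n → ℝ) (j : ι) (x y : Fin n → ℝ) : ℝ :=
  ∑ i, (θ j i * y i / r - θ j i ^ 2 / (2 * r)) - logMix r θ x y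

theorem gaussDensity_eq_tilt (θ : Fin n → ℝ) {w : ℝ≥0} (hw : w ≠ 0) (x : Fin n → ℝ) :
    gaussDensity θ w x = gaussDensity 0 w x *
      ENNReal.ofReal (Real.exp (∑ i, (θ i * x i / w - θ i ^ 2 / (2 * w)))) := by
  rw [gaussDensity, gaussDensity, Real.exp_sum, ENNReal.ofReal_prod_of_nonneg
    (fun i _ => (Real.exp_pos _).le), ← Finset.prod_mul_distrib]
  exact Finset.prod_congr rfl fun i _ => gaussianPDF_eq_tilt _ hw _

theorem measurable_logLik (r : ℝ≥0) (θ : Fin n → ℝ) :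
    Measurable fun z : (Fin n → ℝ) × (Fin n → ℝ) => logLik r θ z.1 z.2 := by
  unfold logLik; fun_prop

theorem measurable_logMix (r : ℝ≥0) (θ : ι → Fin n → ℝ) :
    Measurable fun z : (Fin n → ℝ) × (Fin n → ℝ) => logMix r θ z.1 z.2 := by
  unfold logMix
  have := fun j => measurable_logLik r (θ j)
  fun_prop

theorem measurable_testFun (r : ℝ≥0) (θ : ι → Fin n → ℝ) (j : ι) :
    Measurable fun z : (Fin n → ℝ) × (Fin n → ℝ) => testFun r θ j z.1 z.2 := by
  unfold testFun
  have := measurable_logMix r θ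
  fun_prop

/-- An average of exponentials lies between exp(-S) and exp(S). This domination serves only for
integrability. -/
theorem abs_logMix_le [Nonempty ι] (r : ℝ≥0) (θ : ι → Fin n → ℝ) (x y : Fin n → ℝ) :
    |logMix r θ x y| ≤ ∑ j, |logLik r (θ j) x y| := by
  set S := ∑ j, |logLik r (θ j) x y|
  have hj : ∀ j, |logLik r (θ j) x y| ≤ S := fun j =>
    Finset.single_le_sum (f := fun j => |logLik r (θ j) x y|) (fun _ _ => abs_nonneg _)
      (Finset.mem_univ j)
  have hc : (0 : ℝ) < Fintype.card ι := by exact_mod_cast Fintype.card_pos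
  have hup : (∑ j, Real.exp (logLik r (θ j) x y)) / Fintype.card ι ≤ Real.exp S := by
    rw [div_le_iff₀ hc, mul_comm]
    calc _ ≤ ∑ _j : ι, Real.exp S :=
          Finset.sum_le_sum fun j _ => Real.exp_le_exp.2 ((le_abs_self _).trans (hj j))
      _ = _ := by simp
  have hlo : Real.exp (-S) ≤ (∑ j, Real.exp (logLik r (θ j) x y)) / Fintype.card ι := by
    rw [le_div_iff₀ hc, mul_comm]
    calc _ = ∑ _j : ι, Real.exp (-S) := by simp
      _ ≤ _ := Finset.sum_le_sum fun j _ => Real.exp_le_exp.2 (by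
          linarith [neg_abs_le (logLik r (θ j) x y), hj j])
  rw [abs_le, logMix]
  exact ⟨(Real.le_log_iff_exp_le ((Real.exp_pos _).trans_le hlo)).2 hlo,
    (Real.log_le_iff_le_exp ((Real.exp_pos _).trans_le hlo)).2 hup⟩

theorem integrable_eval_gaussLaw (θ : Fin n → ℝ) (w : ℝ≥0) (i : Fin n) :
    Integrable (fun x : Fin n → ℝ => x i) (gaussLaw θ w) :=
  integrable_comp_eval (μ := fun i => gaussianReal (θ i) w) (integrable_id_gaussianReal _ _)

theorem integrable_testFun [Nonempty ι] (r : ℝ≥0) (θ : ι → Fin n → ℝ) (j : ι)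
    (x : Fin n → ℝ) (θ' : Fin n → ℝ) : Integrable (testFun r θ j x) (gaussLaw θ' r) := by
  have hev := fun i => integrable_eval_gaussLaw θ' r i
  have h1 : ∀ j, Integrable (fun y => logLik r (θ j) x y) (gaussLaw θ' r) := fun j =>
    integrable_finsetSum _ fun i _ =>
      (((integrable_const _).add ((hev i).div_const _)).const_mul _).sub (integrable_const _)
  refine (integrable_finsetSum _ fun i _ =>
    (((hev i).const_mul _).div_const _).sub (integrable_const _)).sub ?_
  refine (integrable_finsetSum Finset.univ fun j _ => (h1 j).abs).mono'
    ((measurable_logMix r θ).of_uncurry_left (x := x)).aestronglyMeasurable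
    (ae_of_all _ fun y => abs_logMix_le r θ x y)

theorem integrable_testFun_prod [Nonempty ι] (r : ℝ≥0) (θ : ι → Fin n → ℝ) (j : ι)
    (θ' : Fin n → ℝ) : Integrable (fun z : (Fin n → ℝ) × (Fin n → ℝ) => testFun r θ j z.1 z.2)
      ((gaussLaw θ' 1).prod (gaussLaw θ' r)) := by
  have hx := fun i => (integrable_eval_gaussLaw θ' 1 i).comp_fst (gaussLaw θ' r)
  have hy := fun i => (integrable_eval_gaussLaw θ' r i).comp_snd (gaussLaw θ' 1)
  have h1 : ∀ j, Integrable (fun z : (Fin n → ℝ) × (Fin n → ℝ) => logLik r (θ j) z.1 z.2)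
      ((gaussLaw θ' 1).prod (gaussLaw θ' r)) := fun j =>
    integrable_finsetSum _ fun i _ =>
      (((hx i).add ((hy i).div_const _)).const_mul _).sub (integrable_const _)
  refine (integrable_finsetSum _ fun i _ =>
    (((hy i).const_mul _).div_const _).sub (integrable_const _)).sub ?_
  exact (integrable_finsetSum Finset.univ fun j _ => (h1 j).abs).mono'
    (measurable_logMix r θ).aestronglyMeasurable
    (ae_of_all _ fun z => abs_logMix_le r θ z.1 z.2)

/-- After multiplication by p(x | θ_j), the exponential of the test function becomes p(x | 0) times
the j-th share of the joint mixture. The shares sum to the number of spikes whatever the estimate p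
is, because p(x, ·) has mass 1. The marginal of x is left out of the test function; its expected
log-ratio, averaged over the mixture, is a nonnegative divergence, so this only weakens the bound.
-/
theorem sum_lintegral_exp_testFun [Nonempty ι] {r : ℝ≥0} (hr : r ≠ 0) (θ : ι → Fin n → ℝ)
    {p : (Fin n → ℝ) → (Fin n → ℝ) → ℝ≥0∞} (hp : IsPDE p) :
    ∑ j, ∫⁻ x, (∫⁻ y, ENNReal.ofReal (Real.exp (testFun r θ j x y)) * p x y) ∂gaussLaw (θ j) 1 =
      Fintype.card ι := by
  have hm : ∀ j, Measurable fun z : (Fin n → ℝ) × (Fin n → ℝ) =>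
      ENNReal.ofReal (Real.exp (testFun r θ j z.1 z.2)) * p z.1 z.2 := fun j =>
    (measurable_testFun r θ j).exp.ennreal_ofReal.mul hp.measurable
  have hmx : ∀ j, Measurable fun x =>
      ∫⁻ y, ENNReal.ofReal (Real.exp (testFun r θ j x y)) * p x y :=
    fun j => (hm j).lintegral_prod_right'
  have hmy : ∀ j x, Measurable fun y => ENNReal.ofReal (Real.exp (testFun r θ j x y)) * p x y :=
    fun j => measurable_of_uncurry
      (fun x y => ENNReal.ofReal (Real.exp (testFun r θ j x y)) * p x y) (hm j)
  have h1 : ∀ j, ∫⁻ x, (∫⁻ y, ENNReal.ofReal (Real.exp (testFun r θ j x y)) * p x y)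
        ∂gaussLaw (θ j) 1 =
      ∫⁻ x, gaussDensity (θ j) 1 x *
        ∫⁻ y, ENNReal.ofReal (Real.exp (testFun r θ j x y)) * p x y := by
    intro j
    rw [gaussLaw_eq_withDensity _ one_ne_zero, lintegral_withDensity_eq_lintegral_mul _
      (measurable_gaussDensity _ _) (hmx j)]
    rfl
  simp_rw [h1]
  have hmg : ∀ j, Measurable fun x => gaussDensity (θ j) 1 x *
      ∫⁻ y, ENNReal.ofReal (Real.exp (testFun r θ j x y)) * p x y :=
    fun j => (measurable_gaussDensity (θ j) 1).mul (hmx j)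
  rw [← lintegral_finsetSum _ fun j _ => hmg j]
  have hc : (0 : ℝ) < Fintype.card ι := by exact_mod_cast Fintype.card_pos
  have h2 : ∀ x, ∑ j, gaussDensity (θ j) 1 x *
      ∫⁻ y, ENNReal.ofReal (Real.exp (testFun r θ j x y)) * p x y =
      gaussDensity 0 1 x * Fintype.card ι := by
    intro x
    have h3 : ∀ j, gaussDensity (θ j) 1 x *
        ∫⁻ y, ENNReal.ofReal (Real.exp (testFun r θ j x y)) * p x y =
        gaussDensity 0 1 x * ∫⁻ y, ENNReal.ofReal (Real.exp (logLik r (θ j) x y -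
          logMix r θ x y)) * p x y := by
      intro j
      rw [gaussDensity_eq_tilt (θ j) one_ne_zero, mul_assoc, ← lintegral_const_mul _ (hmy j x)]
      congr 1
      refine lintegral_congr fun y => ?_
      rw [← mul_assoc, ← ENNReal.ofReal_mul (Real.exp_pos _).le, ← Real.exp_add, testFun,
        ← add_sub_assoc, ← Finset.sum_add_distrib, logLik]
      congr 4
      refine Finset.sum_congr rfl fun i _ => ?_
      have hr' : (r : ℝ) ≠ 0 := by exact_mod_cast hr
      push_cast
      field_simp
      ring
    simp_rw [h3]
    rw [← Finset.mul_sum, ← lintegral_finsetSum]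
    · congr 1
      calc _ = ∫⁻ y, Fintype.card ι * p x y := by
            refine lintegral_congr fun y => ?_
            rw [← Finset.sum_mul, ← ENNReal.ofReal_sum_of_nonneg fun j _ => (Real.exp_pos _).le]
            congr 1
            have hS : 0 < ∑ j, Real.exp (logLik r (θ j) x y) :=
              Finset.sum_pos (fun j _ => Real.exp_pos _) Finset.univ_nonempty
            simp_rw [Real.exp_sub, ← Finset.sum_div]
            rw [logMix, Real.exp_log (by positivity), div_div_cancel₀ hS.ne',
              ENNReal.ofReal_natCast]
        _ = _ := by
            rw [lintegral_const_mul _ hp.measurable.of_uncurry_left, hp.lintegral_eq_one, mul_one]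
    · intro j _
      have h4 : Measurable fun z : (Fin n → ℝ) × (Fin n → ℝ) =>
          ENNReal.ofReal (Real.exp (logLik r (θ j) z.1 z.2 - logMix r θ z.1 z.2)) * p z.1 z.2 :=
        ((measurable_logLik r (θ j)).sub (measurable_logMix r θ)).exp.ennreal_ofReal.mul
          hp.measurable
      exact measurable_of_uncurry (fun x y => ENNReal.ofReal (Real.exp (logLik r (θ j) x y -
        logMix r θ x y)) * p x y) h4 x
  simp_rw [h2]
  have h5 : ∫⁻ x : Fin n → ℝ, gaussDensity 0 1 x = 1 := by
    have := measure_univ (μ := gaussLaw (0 : Fin n → ℝ) 1)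
    rwa [gaussLaw_eq_withDensity _ one_ne_zero, withDensity_apply _ .univ,
      Measure.restrict_univ] at this
  rw [lintegral_mul_const _ (measurable_gaussDensity _ _), h5, one_mul]

/-- If the expected test functions are at least `B`, then so is the maximum risk. -/
theorem ofReal_le_maxRisk [Nonempty ι] {r : ℝ≥0} (hr : r ≠ 0) (θ : ι → Fin n → ℝ)
    {Θ : Set (Fin n → ℝ)} (hθ : ∀ j, θ j ∈ Θ)
    {p : (Fin n → ℝ) → (Fin n → ℝ) → ℝ≥0∞} (hp : IsPDE p) {B : ℝ}
    (hB : ∀ j, B ≤ ∫ z : (Fin n → ℝ) × (Fin n → ℝ), testFun r θ j z.1 z.2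
      ∂((gaussLaw (θ j) 1).prod (gaussLaw (θ j) r))) :
    ENNReal.ofReal B ≤ maxRisk r Θ p := by
  have hm : ∀ j, Measurable fun z : (Fin n → ℝ) × (Fin n → ℝ) =>
      ENNReal.ofReal (Real.exp (testFun r θ j z.1 z.2)) * p z.1 z.2 := fun j =>
    (measurable_testFun r θ j).exp.ennreal_ofReal.mul hp.measurable
  have hmx : ∀ j, Measurable fun x =>
      ∫⁻ y, ENNReal.ofReal (Real.exp (testFun r θ j x y)) * p x y :=
    fun j => (hm j).lintegral_prod_right'
  have h1 : ∀ j, ENNReal.ofReal (B + 1) ≤ maxRisk r Θ p +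
      ∫⁻ x, (∫⁻ y, ENNReal.ofReal (Real.exp (testFun r θ j x y)) * p x y) ∂gaussLaw (θ j) 1 := by
    intro j
    have hI := integrable_testFun_prod r θ j (θ j)
    have hrisk : risk r (θ j) p ≤ maxRisk r Θ p :=
      le_iSup₂_of_le (θ j) (hθ j) le_rfl
    refine le_trans ?_ (add_le_add_left hrisk _)
    have hIx : Integrable (fun x => ∫ y, testFun r θ j x y ∂gaussLaw (θ j) r + 1)
      (gaussLaw (θ j) 1) := hI.integral_prod_left.add (integrable_const 1)
    calc ENNReal.ofReal (B + 1)
        ≤ ENNReal.ofReal (∫ x, (∫ y, testFun r θ j x y ∂gaussLaw (θ j) r + 1)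
            ∂gaussLaw (θ j) 1) := by
          apply ENNReal.ofReal_le_ofReal
          rw [integral_add hI.integral_prod_left (integrable_const 1)]
          have := hB j
          rw [integral_prod _ hI] at this
          simpa using this
      _ ≤ ∫⁻ x, ENNReal.ofReal (∫ y, testFun r θ j x y ∂gaussLaw (θ j) r + 1)
            ∂gaussLaw (θ j) 1 := by
          calc _ ≤ ENNReal.ofReal (∫ x, max (∫ y, testFun r θ j x y ∂gaussLaw (θ j) r + 1) 0
                ∂gaussLaw (θ j) 1) := ENNReal.ofReal_le_ofReal
                  (integral_mono hIx hIx.pos_part fun x => le_max_left _ _)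
            _ = ∫⁻ x, ENNReal.ofReal (max (∫ y, testFun r θ j x y ∂gaussLaw (θ j) r + 1) 0)
                ∂gaussLaw (θ j) 1 := ofReal_integral_eq_lintegral_ofReal hIx.pos_part
                  (ae_of_all _ fun x => le_max_right _ _)
            _ = _ := by simp
      _ ≤ ∫⁻ x, (loss r (θ j) (p x) +
            ∫⁻ y, ENNReal.ofReal (Real.exp (testFun r θ j x y)) * p x y) ∂gaussLaw (θ j) 1 := by
          refine lintegral_mono fun x => ?_
          have : IsProbabilityMeasure ((volume : Measure (Fin n → ℝ)).withDensity (p x)) :=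
            ⟨by rw [withDensity_apply _ .univ, Measure.restrict_univ, hp.lintegral_eq_one]⟩
          have hmt : Measurable (testFun r θ j x) := (measurable_testFun r θ j).of_uncurry_left
          have hpx : Measurable (p x) := hp.measurable.of_uncurry_left
          have key := ofReal_integral_add_one_le_klDiv_add (gaussLaw (θ j) r)
            ((volume : Measure (Fin n → ℝ)).withDensity (p x)) hmt
            (integrable_testFun r θ j x (θ j))
          rw [lintegral_withDensity_eq_lintegral_mul _ hpx hmt.exp.ennreal_ofReal] at key
          simp_rw [Pi.mul_apply, mul_comm (p x _)] at key
          exact key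
      _ = risk r (θ j) p + ∫⁻ x, (∫⁻ y, ENNReal.ofReal (Real.exp (testFun r θ j x y)) * p x y)
            ∂gaussLaw (θ j) 1 := lintegral_add_right _ (hmx j)
  have h2 := Finset.sum_le_sum fun (j : ι) (_ : j ∈ Finset.univ) => h1 j
  rw [Finset.sum_add_distrib, sum_lintegral_exp_testFun hr θ hp] at h2
  simp only [Finset.sum_const, Finset.card_univ, nsmul_eq_mul] at h2
  have hc0 : (Fintype.card ι : ℝ≥0∞) ≠ 0 := by exact_mod_cast Fintype.card_ne_zero
  -- Averaged over j, the exponential terms are exactly 1 and cancel the 1 gained from 1 + a ≤ exp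
  -- a.
  have h3 : ENNReal.ofReal (B + 1) ≤ maxRisk r Θ p + 1 := by
    rw [← ENNReal.mul_le_mul_iff_right hc0 (ENNReal.natCast_ne_top _), mul_add, mul_one]
    exact h2
  rcases le_total B 0 with h0 | h0
  · rw [ENNReal.ofReal_of_nonpos h0]; exact zero_le
  · rw [ENNReal.ofReal_add h0 zero_le_one, ENNReal.ofReal_one] at h3
    exact (ENNReal.add_le_add_iff_right ENNReal.one_ne_top).1 h3

end Bayes

/-! ### Independent block spikes as a least favourable configuration -/

section Spikes

variable {n : ℕ}

theorem measurePreserving_eval_prod (θ : Fin n → ℝ) (w₁ w₂ : ℝ≥0) (i : Fin n) :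
    MeasurePreserving (fun z : (Fin n → ℝ) × (Fin n → ℝ) => (z.1 i, z.2 i))
      ((gaussLaw θ w₁).prod (gaussLaw θ w₂))
      ((gaussianReal (θ i) w₁).prod (gaussianReal (θ i) w₂)) :=
  (measurePreserving_eval (fun i => gaussianReal (θ i) w₁) i).prod
    (measurePreserving_eval (fun i => gaussianReal (θ i) w₂) i)

theorem integral_eval_prod (θ : Fin n → ℝ) (w₁ w₂ : ℝ≥0) (i : Fin n) {F : ℝ × ℝ → ℝ}
    (hF : Measurable F) :
    ∫ z : (Fin n → ℝ) × (Fin n → ℝ), F (z.1 i, z.2 i) ∂((gaussLaw θ w₁).prod (gaussLaw θ w₂)) =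
      ∫ z, F z ∂((gaussianReal (θ i) w₁).prod (gaussianReal (θ i) w₂)) := by
  rw [← (measurePreserving_eval_prod θ w₁ w₂ i).map_eq,
    integral_map (measurePreserving_eval_prod θ w₁ w₂ i).measurable.aemeasurable
      hF.aestronglyMeasurable]

theorem integral_exp_mul_gaussianReal (t : ℝ) (w : ℝ≥0) :
    ∫ x, Real.exp (t * x) ∂gaussianReal 0 w = Real.exp (w * t ^ 2 / 2) := by
  have := congrFun (mgf_id_gaussianReal (μ := 0) (v := w)) t
  simpa [mgf] using this

theorem integrable_exp_lik (r : ℝ≥0) (τ : ℝ) :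
    Integrable (fun z : ℝ × ℝ => Real.exp (τ * (z.1 + z.2 / r) - (1 + (r : ℝ)⁻¹) * τ ^ 2 / 2))
      ((gaussianReal 0 1).prod (gaussianReal 0 r)) := by
  have h := (integrable_exp_mul_gaussianReal (μ := 0) (v := 1) τ).mul_prod
    (integrable_exp_mul_gaussianReal (μ := 0) (v := r) (τ / r))
  refine (h.const_mul (Real.exp (-((1 + (r : ℝ)⁻¹) * τ ^ 2 / 2)))).congr (ae_of_all _ fun z => ?_)
  simp only
  rw [← Real.exp_add, ← Real.exp_add]
  congr 1; ring

theorem integral_exp_lik {r : ℝ≥0} (hr : r ≠ 0) (τ : ℝ) :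
    ∫ z : ℝ × ℝ, Real.exp (τ * (z.1 + z.2 / r) - (1 + (r : ℝ)⁻¹) * τ ^ 2 / 2)
      ∂((gaussianReal 0 1).prod (gaussianReal 0 r)) = 1 := by
  have hr' : (r : ℝ) ≠ 0 := by exact_mod_cast hr
  have h : ∀ z : ℝ × ℝ, Real.exp (τ * (z.1 + z.2 / r) - (1 + (r : ℝ)⁻¹) * τ ^ 2 / 2) =
      Real.exp (-((1 + (r : ℝ)⁻¹) * τ ^ 2 / 2)) *
        (Real.exp (τ * z.1) * Real.exp (τ / r * z.2)) := by
    intro z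
    rw [← Real.exp_add, ← Real.exp_add]
    congr 1; ring
  simp_rw [h]
  rw [integral_const_mul, integral_prod_mul (fun x => Real.exp (τ * x))
    (fun y => Real.exp (τ / r * y)), integral_exp_mul_gaussianReal, integral_exp_mul_gaussianReal,
    ← Real.exp_add, ← Real.exp_add, Real.exp_eq_one_iff]
  push_cast
  field_simp
  ring

/-- The vector with value `τ` at the positions `e (b, J b)` and zeros elsewhere. -/
noncomputable def spike {k m : ℕ} (e : Fin k × Fin m ↪ Fin n) (τ : ℝ) (J : Fin k → Fin m) :
    Fin n → ℝ :=
  fun i => if i ∈ Finset.univ.image (fun b => e (b, J b)) then τ else 0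

variable {k m : ℕ} (e : Fin k × Fin m ↪ Fin n) (τ : ℝ) (J : Fin k → Fin m)

theorem spike_apply (b : Fin k) : spike e τ J (e (b, J b)) = τ :=
  if_pos (Finset.mem_image_of_mem _ (Finset.mem_univ b))

theorem spike_apply_of_ne {b : Fin k} {i : Fin m} (h : i ≠ J b) : spike e τ J (e (b, i)) = 0 := by
  refine if_neg fun hmem => ?_
  obtain ⟨b', -, hb'⟩ := Finset.mem_image.1 hmem
  have := e.injective hb'
  simp only [Prod.mk.injEq] at this
  obtain ⟨rfl, h'⟩ := this
  exact h h'.symm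

theorem sum_spike (F : Fin n → ℝ → ℝ) (hF : ∀ i, F i 0 = 0) :
    ∑ i, F i (spike e τ J i) = ∑ b, F (e (b, J b)) τ := by
  have h : ∀ i, F i (spike e τ J i) =
      if i ∈ Finset.univ.image (fun b => e (b, J b)) then F i τ else 0 := by
    intro i
    unfold spike
    split_ifs
    · rfl
    · exact hF i
  simp_rw [h]
  rw [Finset.sum_ite_mem, Finset.univ_inter, Finset.sum_image]
  intro b _ b' _ hbb'
  exact (Prod.mk.inj (e.injective hbb')).1

theorem hammingNorm_spike_le : hammingNorm (spike e τ J) ≤ k := by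
  have h : hammingNorm (spike e τ J) ≤ (Finset.univ.image (fun b => e (b, J b))).card := by
    refine Finset.card_le_card fun i hi => ?_
    by_contra hni
    exact (Finset.mem_filter.1 hi).2 (if_neg hni)
  exact h.trans (Finset.card_image_le.trans (by simp))

/-- The log-likelihood ratio of a spike at coordinate `i`. -/
noncomputable def spikeLik (r : ℝ≥0) (τ : ℝ) (z : ℝ × ℝ) : ℝ :=
  τ * (z.1 + z.2 / r) - (1 + (r : ℝ)⁻¹) * τ ^ 2 / 2

/-- Expanding the product over blocks of sums over positions gives the sum over all choices J, so
the mixture likelihood factors and each block can be treated alone. -/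
theorem logMix_spike [NeZero m] (r : ℝ≥0) (x y : Fin n → ℝ) :
    logMix r (spike e τ) x y = ∑ b, Real.log
      ((∑ i, Real.exp (spikeLik r τ (x (e (b, i)), y (e (b, i))))) / m) := by
  have hm : (0 : ℝ) < m := by exact_mod_cast Nat.pos_of_neZero m
  rw [logMix, ← Real.log_prod]
  · congr 1
    rw [Finset.prod_div_distrib, Finset.prod_univ_sum, Fintype.piFinset_univ]
    congr 1
    · refine Finset.sum_congr rfl fun J _ => ?_
      rw [← Real.exp_sum, logLik,
        sum_spike e τ J (fun i t => t * (x i + y i / r) - (1 + (r : ℝ)⁻¹) * t ^ 2 / 2) (by simp)]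
      rfl
    · simp
  · intro b _
    have : 0 < ∑ i, Real.exp (spikeLik r τ (x (e (b, i)), y (e (b, i)))) :=
      Finset.sum_pos (fun j _ => Real.exp_pos _) Finset.univ_nonempty
    positivity

/-- In one block, the log-likelihood ratio is controlled by the true spike plus the average of the
likelihood ratios of the other positions. -/
theorem log_block_le [NeZero m] {r : ℝ≥0} (hτ : 0 ≤ τ)
    (hcap : (1 + (r : ℝ)⁻¹) * τ ^ 2 / 2 ≤ Real.log m + Real.log 2) (z : Fin m → ℝ × ℝ) (j : Fin m) :
    Real.log ((∑ i, Real.exp (spikeLik r τ (z i))) / m) ≤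
      2 + τ / 2 + τ * (((z j).1 - τ) ^ 2 + (r : ℝ)⁻¹ ^ 2 * ((z j).2 - τ) ^ 2) +
        (∑ i ∈ Finset.univ.erase j, Real.exp (spikeLik r τ (z i))) / m := by
  have hm : (0 : ℝ) < m := by exact_mod_cast Nat.pos_of_neZero m
  set A := Real.exp (spikeLik r τ (z j)) / m
  set R := (∑ i ∈ Finset.univ.erase j, Real.exp (spikeLik r τ (z i))) / m
  have hA : 0 < A := by positivity
  have hR : 0 ≤ R := div_nonneg (Finset.sum_nonneg fun i _ => (Real.exp_pos _).le) hm.le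
  have hsum : (∑ i, Real.exp (spikeLik r τ (z i))) / m = A + R := by
    rw [← Finset.add_sum_erase _ _ (Finset.mem_univ j), add_div]
  set Z := ((z j).1 - τ) + ((z j).2 - τ) * (r : ℝ)⁻¹ with hZ
  -- The cap on τ is used here: log A = τZ + cτ²/2 - log m, so the block size offsets the mean
  -- signal of the true spike.
  have hlogA : Real.log A ≤ Real.log 2 + τ * |Z| := by
    rw [Real.log_div (Real.exp_pos _).ne' hm.ne', Real.log_exp, spikeLik]
    have h1 : τ * ((z j).1 + (z j).2 / r) =
        τ * Z + (1 + (r : ℝ)⁻¹) * τ ^ 2 := by rw [div_eq_mul_inv, hZ]; ring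
    have h2 := mul_le_mul_of_nonneg_left (le_abs_self Z) hτ
    linarith
  have h0 : 0 ≤ Real.log 2 := Real.log_nonneg (by norm_num)
  have hA1 : Real.log (1 + A) ≤ 2 * Real.log 2 + τ * |Z| := by
    have h2 : 1 + A ≤ 2 * Real.exp (Real.log 2 + τ * |Z|) := by
      have h3 : A ≤ Real.exp (Real.log 2 + τ * |Z|) := (Real.log_le_iff_le_exp hA).1 hlogA
      have h4 : 1 ≤ Real.exp (Real.log 2 + τ * |Z|) := Real.one_le_exp (by positivity)
      linarith
    have := Real.log_le_log (by positivity) h2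
    rw [Real.log_mul two_ne_zero (Real.exp_pos _).ne', Real.log_exp] at this
    linarith
  have hR1 : Real.log (1 + R) ≤ R := by
    have := Real.log_le_sub_one_of_pos (show 0 < 1 + R by linarith)
    linarith
  -- Since A + R ≤ (1 + A)(1 + R), the true position separates from the others, whose term R enters
  -- linearly and has mean at most 1.
  have hAR : Real.log (A + R) ≤ Real.log (1 + A) + Real.log (1 + R) := by
    rw [← Real.log_mul (by positivity) (by positivity)]
    exact Real.log_le_log (by positivity) (by nlinarith)
  have hz := mul_le_mul_of_nonneg_left (abs_le_half_one_add_sq Z) hτ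
  have hZ2 : Z ^ 2 ≤ 2 * (((z j).1 - τ) ^ 2 + (r : ℝ)⁻¹ ^ 2 * ((z j).2 - τ) ^ 2) := by
    linear_combination sq_nonneg (((z j).1 - τ) - ((z j).2 - τ) * (r : ℝ)⁻¹)
  have hz2 := mul_le_mul_of_nonneg_left hZ2 hτ
  rw [hsum]
  linarith [Real.log_two_lt_d9]

theorem le_integral_testFun_spike [NeZero m] {r : ℝ≥0} (hr : r ≠ 0) (hτ : 0 ≤ τ)
    (hcap : (1 + (r : ℝ)⁻¹) * τ ^ 2 / 2 ≤ Real.log m + Real.log 2) :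
    k * ((r : ℝ)⁻¹ * τ ^ 2 / 2 - 3 - τ * (3 / 2 + (r : ℝ)⁻¹)) ≤
      ∫ z : (Fin n → ℝ) × (Fin n → ℝ), testFun r (spike e τ) J z.1 z.2
        ∂((gaussLaw (spike e τ J) 1).prod (gaussLaw (spike e τ J) r)) := by
  have hm : (0 : ℝ) < m := by exact_mod_cast Nat.pos_of_neZero m
  have hr' : (r : ℝ) ≠ 0 := by exact_mod_cast hr
  set θ := spike e τ J with hθ
  set P := (gaussLaw θ 1).prod (gaussLaw θ r) with hP
  let Q : ℝ × ℝ → ℝ := fun z => (r : ℝ)⁻¹ * τ ^ 2 / 2 - 2 - τ / 2 + 0 * (z.1 - τ) +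
    (-τ) * (z.1 - τ) ^ 2 + (τ * (r : ℝ)⁻¹ * (z.2 - τ) + (-(τ * (r : ℝ)⁻¹ ^ 2)) * (z.2 - τ) ^ 2)
  let E : ℝ × ℝ → ℝ := fun z => Real.exp (spikeLik r τ z)
  have hQm : Measurable Q := by fun_prop
  have hEm : Measurable E := by simp only [E, spikeLik]; fun_prop
  have hQI : ∀ b, Integrable (fun z : (Fin n → ℝ) × (Fin n → ℝ) =>
      Q (z.1 (e (b, J b)), z.2 (e (b, J b)))) P := by
    intro b
    refine (measurePreserving_eval_prod θ 1 r _).integrable_comp_of_integrable (g := Q) ?_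
    rw [hθ, spike_apply]
    exact integrable_prod_quadratic τ τ _ _ _ _ _ 1 r
  have hQ : ∀ b, ∫ z : (Fin n → ℝ) × (Fin n → ℝ), Q (z.1 (e (b, J b)), z.2 (e (b, J b))) ∂P =
      (r : ℝ)⁻¹ * τ ^ 2 / 2 - 2 - τ / 2 - τ - τ * (r : ℝ)⁻¹ := by
    intro b
    rw [hP, integral_eval_prod θ 1 r _ hQm, hθ, spike_apply]
    refine (integral_prod_quadratic τ τ _ _ _ _ _ 1 r).trans ?_
    push_cast
    field_simp
    ring
  have hEI : ∀ b, ∀ i ∈ Finset.univ.erase (J b), Integrable (fun z : (Fin n → ℝ) × (Fin n → ℝ) =>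
      E (z.1 (e (b, i)), z.2 (e (b, i)))) P := by
    intro b i hi
    refine (measurePreserving_eval_prod θ 1 r _).integrable_comp_of_integrable (g := E) ?_
    rw [hθ, spike_apply_of_ne e τ J (Finset.ne_of_mem_erase hi)]
    exact integrable_exp_lik r τ
  have hE : ∀ b, ∀ i ∈ Finset.univ.erase (J b), ∫ z : (Fin n → ℝ) × (Fin n → ℝ),
      E (z.1 (e (b, i)), z.2 (e (b, i))) ∂P = 1 := by
    intro b i hi
    rw [hP, integral_eval_prod θ 1 r _ hEm, hθ,
      spike_apply_of_ne e τ J (Finset.ne_of_mem_erase hi)]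
    exact integral_exp_lik hr τ
  have hEs : ∀ b, Integrable (fun z : (Fin n → ℝ) × (Fin n → ℝ) =>
      (∑ i ∈ Finset.univ.erase (J b), E (z.1 (e (b, i)), z.2 (e (b, i)))) / m) P := fun b =>
    (integrable_finsetSum _ (hEI b)).div_const _
  have hlow : ∀ z : (Fin n → ℝ) × (Fin n → ℝ),
      ∑ b, (Q (z.1 (e (b, J b)), z.2 (e (b, J b))) -
        (∑ i ∈ Finset.univ.erase (J b), E (z.1 (e (b, i)), z.2 (e (b, i)))) / m) ≤
      testFun r (spike e τ) J z.1 z.2 := by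
    intro z
    rw [testFun, logMix_spike, sum_spike e τ J (fun i t => t * z.2 i / r - t ^ 2 / (2 * r))
      (by simp), ← Finset.sum_sub_distrib]
    refine Finset.sum_le_sum fun b _ => ?_
    have h := log_block_le τ hτ hcap (fun i => (z.1 (e (b, i)), z.2 (e (b, i)))) (J b)
    simp only at h
    have h2 : τ * z.2 (e (b, J b)) / r - τ ^ 2 / (2 * r) =
        (r : ℝ)⁻¹ * τ ^ 2 / 2 + τ * (r : ℝ)⁻¹ * (z.2 (e (b, J b)) - τ) := by
      field_simp; ring
    rw [h2]
    simp only [Q, E]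
    linarith
  have hd : ∀ b, Integrable (fun z : (Fin n → ℝ) × (Fin n → ℝ) =>
      Q (z.1 (e (b, J b)), z.2 (e (b, J b))) -
        (∑ i ∈ Finset.univ.erase (J b), E (z.1 (e (b, i)), z.2 (e (b, i)))) / m) P := fun b =>
    (hQI b).sub (hEs b)
  calc _ = ∑ _b : Fin k, ((r : ℝ)⁻¹ * τ ^ 2 / 2 - 3 - τ * (3 / 2 + (r : ℝ)⁻¹)) := by
        rw [Finset.sum_const, Finset.card_univ, Fintype.card_fin, nsmul_eq_mul]
    _ ≤ ∑ b, (∫ z : (Fin n → ℝ) × (Fin n → ℝ), Q (z.1 (e (b, J b)), z.2 (e (b, J b))) ∂P -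
        ∫ z : (Fin n → ℝ) × (Fin n → ℝ),
          (∑ i ∈ Finset.univ.erase (J b), E (z.1 (e (b, i)), z.2 (e (b, i)))) / m ∂P) := by
        refine Finset.sum_le_sum fun b _ => ?_
        rw [hQ, integral_div, integral_finsetSum _ (hEI b), Finset.sum_congr rfl (hE b)]
        -- The m - 1 empty positions each have a likelihood ratio of mean 1; together they turn the
        -- constant 2 of `log_block_le` into 3.
        have h1 : (∑ i ∈ Finset.univ.erase (J b), (1 : ℝ)) / m ≤ 1 := by
          rw [div_le_one hm]
          simp [Finset.card_erase_of_mem]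
        linarith
    _ = ∫ z, ∑ b, (Q (z.1 (e (b, J b)), z.2 (e (b, J b))) -
        (∑ i ∈ Finset.univ.erase (J b), E (z.1 (e (b, i)), z.2 (e (b, i)))) / m) ∂P := by
        rw [integral_finsetSum _ fun b _ => hd b]
        exact Finset.sum_congr rfl fun b _ => (integral_sub (hQI b) (hEs b)).symm
    _ ≤ _ := integral_mono (integrable_finsetSum _ fun b _ => hd b)
        (integrable_testFun_prod r (spike e τ) J θ) hlow

/-- Lower bound for the minimax risk over sparse vectors. -/
theorem ofReal_le_klMinimaxRisk {r : ℝ≥0} (hr : r ≠ 0) {n k m : ℕ} (hm : 0 < m)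
    (hkm : k * m ≤ n) {s : ℝ} (hks : (k : ℝ) ≤ s) {τ : ℝ} (hτ : 0 ≤ τ)
    (hcap : (1 + (r : ℝ)⁻¹) * τ ^ 2 / 2 ≤ Real.log m + Real.log 2) :
    ENNReal.ofReal (k * ((r : ℝ)⁻¹ * τ ^ 2 / 2 - 3 - τ * (3 / 2 + (r : ℝ)⁻¹))) ≤
      klMinimaxRisk r (sparseSet n s) := by
  have : NeZero m := ⟨hm.ne'⟩
  let e : Fin k × Fin m ↪ Fin n := finProdFinEquiv.toEmbedding.trans (Fin.castLEEmb hkm)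
  refine le_iInf₂ fun p hp => ?_
  refine ofReal_le_maxRisk hr (spike e τ) (fun J => ?_) hp
    fun J => le_integral_testFun_spike e τ J hr hτ hcap
  have h : (hammingNorm (spike e τ J) : ℝ) ≤ k := by exact_mod_cast hammingNorm_spike_le e τ J
  exact h.trans hks

end Spikes

/-! ### Bounds on maximum and minimax risk for fixed n -/

section Finite

variable {r : ℝ≥0} {b : ℝ} {n : ℕ} {s : ℝ}

theorem gridPDE_eq (r : ℝ≥0) (n : ℕ) (η : ℝ) :
    gridPDE r n η = bayesPDE r (Measure.pi fun _ : Fin n => scaledGridPrior r 1 η) := by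
  rw [scaledGridPrior_one]; rfl

theorem le_two_mul_floor (hs : 1 ≤ s) : s ≤ 2 * (⌊s⌋₊ : ℝ) := by
  have h1 := Nat.lt_floor_add_one s
  have h2 : (1 : ℝ) ≤ ⌊s⌋₊ := by exact_mod_cast Nat.floor_pos.2 hs
  linarith

/-- A uniform bound on the univariate risk bounds the maximum risk over sparse vectors. -/
theorem maxRisk_scaledGridPrior_le (hr : r ≠ 0) (hb : 0 < b) (hb1 : b ≤ 1) (hs : 1 ≤ s)
    (h1 : s / n < 1) (hn : 0 < n) (hq : (s / n) ^ (b ^ 2 * oracleVar r) ≤ 1 / 2) {U : ℝ}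
    (hU0 : 0 ≤ U) (hU : ∀ θ, uniRisk r (scaledGridPrior r b (s / n)) θ ≤ U) :
    maxRisk r (sparseSet n s) (bayesPDE r (Measure.pi fun _ : Fin n =>
      scaledGridPrior r b (s / n))) ≤ ENNReal.ofReal (⌊s⌋₊ * (U + 4)) := by
  have hn' : (0 : ℝ) < n := by exact_mod_cast hn
  have h0 : 0 < s / n := by positivity
  have := isProbabilityMeasure_scaledGridPrior (r := r) hb h0 h1
  have hη := eta_le_half hb1 hb h0 h1 hq
  refine iSup₂_le fun θ hθ => ?_
  rw [risk_bayesPDE_pi hr (p := 1 - s / n) (by linarith) ofReal_le_scaledGridPrior_zero]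
  apply ENNReal.ofReal_le_ofReal
  have hzero : uniRisk r (scaledGridPrior r b (s / n)) 0 ≤ 2 * (s / n) :=
    (uniRisk_zero_le (p := 1 - s / n) (by linarith) ofReal_le_scaledGridPrior_zero).trans
      (neg_log_one_sub_le h0 hη)
  have hle : ∀ i, uniRisk r (scaledGridPrior r b (s / n)) (θ i) ≤
      2 * (s / n) + if θ i ≠ 0 then U else 0 := by
    intro i
    split_ifs with h
    · linarith [hU (θ i)]
    · rw [not_not.1 h, add_zero]; exact hzero
  refine (Finset.sum_le_sum fun i _ => hle i).trans ?_
  rw [Finset.sum_add_distrib, Finset.sum_ite, Finset.sum_const_zero, Finset.sum_const,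
    Finset.sum_const, Finset.card_univ, Fintype.card_fin, add_zero, nsmul_eq_mul, nsmul_eq_mul]
  have hcard : ((Finset.univ.filter fun i => θ i ≠ 0).card : ℝ) ≤ ⌊s⌋₊ := by
    exact_mod_cast Nat.le_floor hθ
  have h2 := mul_le_mul_of_nonneg_right hcard hU0
  -- The n coordinates at risk 2s/n cost 2s ≤ 4⌊s⌋ in all, which is the 4 in the bound.
  have h3 : (n : ℝ) * (2 * (s / n)) = 2 * s := by field_simp
  have h4 := le_two_mul_floor hs
  rw [h3]
  linarith

/-- A lower bound on the maximum risk from the risk at one nonzero point. -/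
theorem le_gridMaxRisk (hr : r ≠ 0) (hs : 1 ≤ s) (h1 : s / n < 1) (hn : 0 < n) {θ₀ : ℝ}
    (hθ₀ : θ₀ ≠ 0) :
    ENNReal.ofReal (⌊s⌋₊ * uniRisk r (gridPrior r (s / n)) θ₀) ≤ gridMaxRisk r n s := by
  have hn' : (0 : ℝ) < n := by exact_mod_cast hn
  have h0 : 0 < s / n := by positivity
  have := isProbabilityMeasure_scaledGridPrior (r := r) one_pos h0 h1
  have hnonneg := uniRisk_nonneg (π := scaledGridPrior r 1 (s / n)) hr (p := 1 - s / n)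
    (by linarith) ofReal_le_scaledGridPrior_zero
  rw [gridMaxRisk, gridPDE_eq, ← scaledGridPrior_one]
  have hk : ⌊s⌋₊ * 1 ≤ n := by
    rw [mul_one]
    have h2 : s ≤ n := by rw [div_lt_one hn'] at h1; exact h1.le
    exact Nat.floor_le_of_le h2
  -- Blocks of size one: the spike vector has ⌊s⌋ coordinates equal to θ₀.
  let e : Fin ⌊s⌋₊ × Fin 1 ↪ Fin n := finProdFinEquiv.toEmbedding.trans (Fin.castLEEmb hk)
  have hmem : spike e θ₀ (fun _ => 0) ∈ sparseSet n s := by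
    have h : (hammingNorm (spike e θ₀ fun _ => 0) : ℝ) ≤ ⌊s⌋₊ := by
      exact_mod_cast hammingNorm_spike_le e θ₀ fun _ => 0
    exact h.trans (Nat.floor_le (by linarith))
  refine le_trans ?_ (le_iSup₂ (f := fun θ (_ : θ ∈ sparseSet n s) => risk r θ _)
    (spike e θ₀ fun _ => 0) hmem)
  rw [risk_bayesPDE_pi hr (p := 1 - s / n) (by linarith) ofReal_le_scaledGridPrior_zero]
  apply ENNReal.ofReal_le_ofReal
  -- The risk at 0 is replaced by 0 so that the summand vanishes at zero; this lowers the sum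
  -- because risks are nonnegative.
  have hsum := sum_spike e θ₀ (fun _ => 0)
    (fun _ t => if t = 0 then 0 else uniRisk r (scaledGridPrior r 1 (s / n)) t) (by simp)
  simp only [if_neg hθ₀, Finset.sum_const, Finset.card_univ, Fintype.card_fin,
    nsmul_eq_mul] at hsum
  rw [← hsum]
  refine Finset.sum_le_sum fun i _ => ?_
  split_ifs
  · exact hnonneg _
  · exact le_rfl

/-- Take ⌊s⌋ blocks of size m, the integer part of n/⌊s⌋, and spikes of height λ. The cap becomes
n/s ≤ 2m, and its spare log 2 absorbs the rounding. -/
theorem le_klMinimaxRisk (hr : r ≠ 0) (hs : 1 ≤ s) (h1 : s / n < 1) (hn : 0 < n) :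
    ENNReal.ofReal (⌊s⌋₊ * ((r : ℝ)⁻¹ * gridSpacing r (s / n) ^ 2 / 2 - 3 -
      gridSpacing r (s / n) * (3 / 2 + (r : ℝ)⁻¹))) ≤ klMinimaxRisk r (sparseSet n s) := by
  have hn' : (0 : ℝ) < n := by exact_mod_cast hn
  have h0 : 0 < s / n := by positivity
  have hk1 : 0 < ⌊s⌋₊ := Nat.floor_pos.2 hs
  have hkn : ⌊s⌋₊ ≤ n := by
    have h2 : s ≤ n := by rw [div_lt_one hn'] at h1; exact h1.le
    exact Nat.floor_le_of_le h2
  have hm : 0 < n / ⌊s⌋₊ := Nat.div_pos hkn hk1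
  refine ofReal_le_klMinimaxRisk hr hm (Nat.mul_div_le n _) (Nat.floor_le (by linarith))
    (gridSpacing_nonneg _ _) ?_
  rw [← neg_log_eq_gridSpacing h0 h1, ← Real.log_inv, inv_div,
    ← Real.log_mul (by exact_mod_cast hm.ne') two_ne_zero]
  apply Real.log_le_log (by positivity)
  rw [div_le_iff₀ (by linarith)]
  have h2 : n < ⌊s⌋₊ * (n / ⌊s⌋₊ + 1) := by
    have := Nat.lt_mul_div_succ n hk1
    simpa using this
  have h3 : n ≤ (n / ⌊s⌋₊) * 2 * ⌊s⌋₊ := by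
    have : ⌊s⌋₊ * 1 ≤ ⌊s⌋₊ * (n / ⌊s⌋₊) := Nat.mul_le_mul_left _ hm
    nlinarith
  have h4 : (n : ℝ) ≤ ((n / ⌊s⌋₊ : ℕ) : ℝ) * 2 * ⌊s⌋₊ := by exact_mod_cast h3
  refine h4.trans ?_
  gcongr
  exact Nat.floor_le (by linarith)

theorem klMinimaxRisk_le (hr : r ≠ 0) (hb : 0 < b) (hs : 1 ≤ s) (h1 : s / n < 1)
    (hn : 0 < n) : klMinimaxRisk r (sparseSet n s) ≤
      maxRisk r (sparseSet n s) (bayesPDE r (Measure.pi fun _ : Fin n =>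
        scaledGridPrior r b (s / n))) := by
  have hn' : (0 : ℝ) < n := by exact_mod_cast hn
  have h0 : 0 < s / n := by positivity
  have := isProbabilityMeasure_scaledGridPrior (r := r) hb h0 h1
  exact iInf₂_le _ (isPDE_bayesPDE_pi hr (p := 1 - s / n) (by linarith)
    ofReal_le_scaledGridPrior_zero n)

end Finite

/-! ### Common first-order rate and limits of the two risks -/

section Asymptotics

/-- The first-order size `⌊s⌋ λ² / (2 r)` of the minimax risk. -/
noncomputable def rate (r : ℝ≥0) (n : ℕ) (s : ℝ) : ℝ :=
  ⌊s⌋₊ * ((r : ℝ)⁻¹ * gridSpacing r (s / n) ^ 2 / 2)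

/-- The relative size of the lower-order terms. -/
noncomputable def relErr (r : ℝ≥0) (l : ℝ) : ℝ :=
  (12 + 4 * (r : ℝ)⁻¹ + (r : ℝ)⁻¹ ^ 2) * (1 + l) / ((r : ℝ)⁻¹ * l ^ 2 / 2)

theorem tendsto_relErr {r : ℝ≥0} (hr : r ≠ 0) : Tendsto (relErr r) atTop (𝓝 0) := by
  have hr' : 0 < (r : ℝ) := by exact_mod_cast pos_iff_ne_zero.2 hr
  have h1 : Tendsto (fun l : ℝ => (12 + 4 * (r : ℝ)⁻¹ + (r : ℝ)⁻¹ ^ 2) * (2 * r) *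
      (l⁻¹ * l⁻¹ + l⁻¹)) atTop (𝓝 ((12 + 4 * (r : ℝ)⁻¹ + (r : ℝ)⁻¹ ^ 2) * (2 * r) *
      (0 * 0 + 0))) :=
    ((tendsto_inv_atTop_zero.mul tendsto_inv_atTop_zero).add tendsto_inv_atTop_zero).const_mul _
  simp only [mul_zero, add_zero] at h1
  refine h1.congr' ?_
  filter_upwards [eventually_gt_atTop 0] with l hl
  rw [relErr]
  field_simp

theorem mul_one_add_relErr {r : ℝ≥0} (hr : r ≠ 0) {l : ℝ} (hl : 0 < l) :
    (r : ℝ)⁻¹ * l ^ 2 / 2 * relErr r l = (12 + 4 * (r : ℝ)⁻¹ + (r : ℝ)⁻¹ ^ 2) * (1 + l) := by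
  have hr' : 0 < (r : ℝ) := by exact_mod_cast pos_iff_ne_zero.2 hr
  rw [relErr, mul_div_cancel₀]
  positivity

variable {r : ℝ≥0} {b : ℝ} {n : ℕ} {s : ℝ}

theorem rate_pos (hr : r ≠ 0) (hs : 1 ≤ s) (hl : 0 < gridSpacing r (s / n)) : 0 < rate r n s := by
  have hr' : 0 < (r : ℝ) := by exact_mod_cast pos_iff_ne_zero.2 hr
  have hk1 : (0 : ℝ) < ⌊s⌋₊ := by exact_mod_cast Nat.floor_pos.2 hs
  rw [rate]; positivity

theorem rate_mul_le_klMinimaxRisk (hr : r ≠ 0) (hs : 1 ≤ s) (h1 : s / n < 1) (hn : 0 < n)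
    (hl : 0 < gridSpacing r (s / n)) :
    ENNReal.ofReal (rate r n s * (1 - relErr r (gridSpacing r (s / n)))) ≤
      klMinimaxRisk r (sparseSet n s) := by
  refine le_trans (ENNReal.ofReal_le_ofReal ?_) (le_klMinimaxRisk hr hs h1 hn)
  have hE := mul_one_add_relErr hr hl
  have hri : 0 ≤ (r : ℝ)⁻¹ := by positivity
  rw [rate, mul_assoc]
  apply mul_le_mul_of_nonneg_left _ (Nat.cast_nonneg _)
  rw [mul_sub, hE]
  have := mul_nonneg hri hl.le
  have := mul_nonneg (sq_nonneg (r : ℝ)⁻¹) hl.le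
  nlinarith

theorem klMinimaxRisk_le_rate_mul (hr : r ≠ 0) (hb : 0 < b) (hb1 : b ≤ 1) (hs : 1 ≤ s)
    (h1 : s / n < 1) (hn : 0 < n) (hq : (s / n) ^ (b ^ 2 * oracleVar r) ≤ 1 / 2)
    (hl : 0 < gridSpacing r (s / n)) :
    klMinimaxRisk r (sparseSet n s) ≤
      ENNReal.ofReal (rate r n s * (1 + b ^ 2 + relErr r (gridSpacing r (s / n)))) := by
  have hn' : (0 : ℝ) < n := by exact_mod_cast hn
  have h0 : 0 < s / n := by positivity
  have hri : 0 ≤ (r : ℝ)⁻¹ := by positivity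
  refine (klMinimaxRisk_le hr hb hs h1 hn).trans ((maxRisk_scaledGridPrior_le hr hb hb1 hs h1 hn hq
    (by positivity) (uniRisk_scaledGridPrior_le_one_add_sq hr hb hb1 h0 h1 hq)).trans
    (ENNReal.ofReal_le_ofReal ?_))
  have hE := mul_one_add_relErr hr hl
  rw [rate, mul_assoc]
  apply mul_le_mul_of_nonneg_left _ (Nat.cast_nonneg _)
  rw [mul_add _ (1 + b ^ 2), hE]
  have := mul_nonneg hri hl.le
  have := mul_nonneg (sq_nonneg (r : ℝ)⁻¹) hl.le
  nlinarith

theorem gridMaxRisk_le_rate_mul (hr : r ≠ 0) (hs : 1 ≤ s)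
    (h1 : s / n < 1) (hn : 0 < n) (hq : (s / n) ^ oracleVar r ≤ 1 / 2)
    (hl : 0 < gridSpacing r (s / n)) :
    gridMaxRisk r n s ≤
      ENNReal.ofReal (rate r n s * (1 + max (hConst r) 0 + relErr r (gridSpacing r (s / n)))) := by
  have hn' : (0 : ℝ) < n := by exact_mod_cast hn
  have h0 : 0 < s / n := by positivity
  have hri : 0 ≤ (r : ℝ)⁻¹ := by positivity
  have hH := le_max_right (hConst r) 0
  rw [gridMaxRisk, gridPDE_eq]
  refine (maxRisk_scaledGridPrior_le (U := gridSpacing r (s / n) ^ 2 / 2 *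
      ((r : ℝ)⁻¹ * (1 + max (hConst r) 0)) + 8 + (3 + 4 * (r : ℝ)⁻¹) * gridSpacing r (s / n))
    hr one_pos le_rfl hs h1 hn (by simpa using hq)
    (by positivity) fun θ => ?_).trans (ENNReal.ofReal_le_ofReal ?_)
  · rw [scaledGridPrior_one]
    exact uniRisk_gridPrior_le hr h0 h1 hq θ
  · have hE := mul_one_add_relErr hr hl
    rw [rate, mul_assoc]
    apply mul_le_mul_of_nonneg_left _ (Nat.cast_nonneg _)
    rw [mul_add _ (1 + max (hConst r) 0), hE]
    have := mul_nonneg hri hl.le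
    have := mul_nonneg (sq_nonneg (r : ℝ)⁻¹) hl.le
    nlinarith

theorem rate_mul_le_gridMaxRisk (hr : r ≠ 0) (hs : 1 ≤ s) (h1 : s / n < 1) (hn : 0 < n)
    (hq : (s / n) ^ oracleVar r ≤ 1 / 2) (hl : 0 < gridSpacing r (s / n)) :
    ENNReal.ofReal (rate r n s * (1 + hConst r - relErr r (gridSpacing r (s / n)))) ≤
      gridMaxRisk r n s := by
  have hn' : (0 : ℝ) < n := by exact_mod_cast hn
  have h0 : 0 < s / n := by positivity
  have hri : 0 ≤ (r : ℝ)⁻¹ := by positivity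
  have hv0 := oracleVar_pos (r := r)
  have hθ : gridSpacing r (s / n) * (1 + (1 + oracleVar r) / 2) ≠ 0 := by positivity
  refine le_trans (ENNReal.ofReal_le_ofReal ?_) (le_gridMaxRisk hr hs h1 hn hθ)
  have hE := mul_one_add_relErr hr hl
  have := le_uniRisk_gridPrior hr h0 h1 hq
  rw [rate, mul_assoc]
  apply mul_le_mul_of_nonneg_left _ (Nat.cast_nonneg _)
  refine le_trans ?_ this
  rw [mul_sub, hE]
  have := mul_nonneg hri hl.le
  have := mul_nonneg (sq_nonneg (r : ℝ)⁻¹) hl.le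
  nlinarith

theorem klMinimaxRisk_le_gridMaxRisk (hr : r ≠ 0) (hs : 1 ≤ s) (h1 : s / n < 1) (hn : 0 < n) :
    klMinimaxRisk r (sparseSet n s) ≤ gridMaxRisk r n s := by
  rw [gridMaxRisk, gridPDE_eq]
  exact klMinimaxRisk_le hr one_pos hs h1 hn

/-- The sign of h_r is that of 1 - 2r - 4r², whose positive root is `rCrit`. -/
theorem hConst_pos_iff : 0 < hConst r ↔ (r : ℝ) < rCrit := by
  have h5 : √5 ^ 2 = 5 := Real.sq_sqrt (by norm_num)
  have h50 : 0 ≤ √5 := Real.sqrt_nonneg 5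
  have hr0 : (0 : ℝ) ≤ r := r.2
  have hpos : 0 < (1 + 2 * (r : ℝ)) * ((1 + (r : ℝ)) ^ 2)⁻¹ := by positivity
  have h1 : 0 < hConst r ↔ 0 < 1 - 2 * (r : ℝ) - 4 * (r : ℝ) ^ 2 := by
    rw [hConst, div_pos_iff_of_pos_right (by norm_num), mul_pos_iff_of_pos_left hpos]
  rw [h1, rCrit]
  constructor
  · intro h
    by_contra hcon
    push Not at hcon
    nlinarith
  · intro h
    nlinarith

/-- Clearing denominators leaves 1 - 8r² - 8r³ < (1 + r)². Strictness is what later turns a limit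
into a bound for all large n. -/
theorem hConst_lt_quarter (hr : r ≠ 0) : hConst r < 1 / 4 := by
  have hr' : 0 < (r : ℝ) := by exact_mod_cast pos_iff_ne_zero.2 hr
  have : hConst r = (1 + 2 * (r : ℝ)) * (1 - 2 * r - 4 * r ^ 2) / (4 * (1 + r) ^ 2) := by
    rw [hConst]; field_simp
  rw [this, div_lt_iff₀ (by positivity)]
  have h3 : 0 < (r : ℝ) ^ 3 := by positivity
  nlinarith

variable {s : ℕ → ℝ}

theorem tendsto_gridSpacing (hpos : ∀ᶠ n : ℕ in atTop, 0 < s n / (n : ℝ))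
    (hη : Tendsto (fun n : ℕ => s n / (n : ℝ)) atTop (𝓝 0)) :
    Tendsto (fun n : ℕ => gridSpacing r (s n / n)) atTop atTop := by
  have hv0 := oracleVar_pos (r := r)
  have h1 : Tendsto (fun n : ℕ => s n / (n : ℝ)) atTop (𝓝[>] 0) :=
    tendsto_nhdsWithin_iff.2 ⟨hη, hpos⟩
  have h2 := Real.tendsto_log_nhdsGT_zero.comp h1
  have h3 : Tendsto (fun n : ℕ => 2 * (-oracleVar r * Real.log (s n / n))) atTop atTop :=
    (h2.const_mul_atBot_of_neg (by linarith : -oracleVar r < 0)).const_mul_atTop two_pos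
  refine (Real.tendsto_sqrt_atTop.comp h3).congr' ?_
  filter_upwards [hpos] with n hn
  rw [Function.comp_apply, gridSpacing, Real.log_rpow hn]

theorem eventually_rpow_le_half
    (hη : Tendsto (fun n : ℕ => s n / (n : ℝ)) atTop (𝓝 0)) {a : ℝ} (ha : 0 < a) :
    ∀ᶠ n : ℕ in atTop, (s n / n) ^ a ≤ 1 / 2 := by
  have h := hη.rpow_const (p := a) (Or.inr ha.le)
  rw [Real.zero_rpow ha.ne'] at h
  exact h.eventually_le_const (by norm_num)

/-- Both risks, relative to `rate`, converge. -/
theorem tendsto_risks (hr : r ≠ 0) (hs : ∀ᶠ n in atTop, 1 ≤ s n)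
    (hη : Tendsto (fun n : ℕ => s n / (n : ℝ)) atTop (𝓝 0)) :
    (∀ᶠ n in atTop, 0 < rate r n (s n)) ∧
    (∀ᶠ n in atTop, klMinimaxRisk r (sparseSet n (s n)) < ⊤) ∧
    (∀ᶠ n in atTop, gridMaxRisk r n (s n) < ⊤) ∧
    Tendsto (fun n => (klMinimaxRisk r (sparseSet n (s n))).toReal / rate r n (s n))
      atTop (𝓝 1) ∧
    Tendsto (fun n => (gridMaxRisk r n (s n)).toReal / rate r n (s n))
      atTop (𝓝 (1 + max (hConst r) 0)) := by
  have hn : ∀ᶠ n : ℕ in atTop, 0 < n := eventually_gt_atTop 0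
  have hpos : ∀ᶠ n : ℕ in atTop, 0 < s n / (n : ℝ) := by
    filter_upwards [hs, hn] with n h1 h2
    have : (0 : ℝ) < n := by exact_mod_cast h2
    positivity
  have h1 : ∀ᶠ n : ℕ in atTop, s n / (n : ℝ) < 1 := hη.eventually_lt_const one_pos
  have hlam := tendsto_gridSpacing (r := r) hpos hη
  have hl : ∀ᶠ n : ℕ in atTop, 0 < gridSpacing r (s n / n) := hlam.eventually_gt_atTop 0
  have hE : Tendsto (fun n : ℕ => relErr r (gridSpacing r (s n / n))) atTop (𝓝 0) :=
    (tendsto_relErr hr).comp hlam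
  have hv0 := oracleVar_pos (r := r)
  have hq := eventually_rpow_le_half hη hv0
  have hrate : ∀ᶠ n in atTop, 0 < rate r n (s n) := by
    filter_upwards [hs, hl] with n a b
    exact rate_pos hr a b
  have hG : ∀ᶠ n in atTop, gridMaxRisk r n (s n) < ⊤ := by
    filter_upwards [hs, h1, hn, hq, hl] with n a b c d e
    exact (gridMaxRisk_le_rate_mul hr a b c d e).trans_lt ENNReal.ofReal_lt_top
  have hR : ∀ᶠ n in atTop, klMinimaxRisk r (sparseSet n (s n)) < ⊤ := by
    filter_upwards [hs, h1, hn, hG] with n a b c d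
    exact (klMinimaxRisk_le_gridMaxRisk hr a b c).trans_lt d
  have hRlow : ∀ᶠ n : ℕ in atTop, 1 - relErr r (gridSpacing r (s n / n)) ≤
      (klMinimaxRisk r (sparseSet n (s n))).toReal / rate r n (s n) := by
    filter_upwards [hs, h1, hn, hl, hR, hrate] with n a b c d e f
    rw [le_div_iff₀ f, mul_comm]
    exact (ENNReal.ofReal_le_iff_le_toReal e.ne).1 (rate_mul_le_klMinimaxRisk hr a b c d)
  refine ⟨hrate, hR, hG, ?_, ?_⟩
  · refine tendsto_order.2 ⟨fun x hx => ?_, fun x hx => ?_⟩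
    · have h2 : Tendsto (fun n : ℕ => 1 - relErr r (gridSpacing r (s n / n))) atTop (𝓝 (1 - 0)) :=
        hE.const_sub 1
      rw [sub_zero] at h2
      filter_upwards [h2.eventually_const_lt hx, hRlow] with n a b
      exact a.trans_le b
    -- With b = min(1, (x - 1)/2) one has b² ≤ b ≤ (x - 1)/2 < x - 1. The spacing is fixed before n
    -- grows, so no rate for b is needed.
    · obtain ⟨b, hb0, hb1, hbx⟩ : ∃ b : ℝ, 0 < b ∧ b ≤ 1 ∧ 1 + b ^ 2 < x := by
        refine ⟨min 1 ((x - 1) / 2), lt_min one_pos (by linarith), min_le_left _ _, ?_⟩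
        have h3 := min_le_left 1 ((x - 1) / 2)
        have h4 := min_le_right 1 ((x - 1) / 2)
        have h5 : 0 < min 1 ((x - 1) / 2) := lt_min one_pos (by linarith)
        nlinarith
      have h2 : Tendsto (fun n : ℕ => 1 + b ^ 2 + relErr r (gridSpacing r (s n / n))) atTop
        (𝓝 (1 + b ^ 2 + 0)) := hE.const_add _
      rw [add_zero] at h2
      have hqb := eventually_rpow_le_half hη (show 0 < b ^ 2 * oracleVar r by positivity)
      filter_upwards [h2.eventually_lt_const hbx, hs, h1, hn, hqb, hl, hrate]
        with n a c d e f g h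
      refine lt_of_le_of_lt ?_ a
      have hnn : 0 ≤ relErr r (gridSpacing r (s n / n)) := by
        have := g.le
        rw [relErr]; positivity
      rw [div_le_iff₀ h, mul_comm]
      exact ENNReal.toReal_le_of_le_ofReal (by positivity)
        (klMinimaxRisk_le_rate_mul hr hb0 hb1 c d e f g)
  · have h2 : Tendsto (fun n : ℕ => 1 + max (hConst r) 0 - relErr r (gridSpacing r (s n / n)))
        atTop (𝓝 (1 + max (hConst r) 0 - 0)) := hE.const_sub _
    have h3 : Tendsto (fun n : ℕ => 1 + max (hConst r) 0 + relErr r (gridSpacing r (s n / n)))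
        atTop (𝓝 (1 + max (hConst r) 0 + 0)) := hE.const_add _
    rw [sub_zero] at h2
    rw [add_zero] at h3
    refine tendsto_of_tendsto_of_tendsto_of_le_of_le' h2 h3 ?_ ?_
    · filter_upwards [hs, h1, hn, hq, hl, hG, hrate, hRlow] with n a b c d e f g h
      -- If h_r ≤ 0 the halfway point is not worst, and the lower bound comes from the minimax risk
      -- itself.
      rcases le_total (hConst r) 0 with h0 | h0
      · rw [max_eq_right h0, add_zero]
        refine h.trans ?_
        gcongr
        · exact f.ne
        · exact klMinimaxRisk_le_gridMaxRisk hr a b c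
      · rw [max_eq_left h0, le_div_iff₀ g, mul_comm]
        exact (ENNReal.ofReal_le_iff_le_toReal f.ne).1 (rate_mul_le_gridMaxRisk hr a b c d e)
    · filter_upwards [hs, h1, hn, hq, hl, hrate] with n a b c d e f
      have hnn : 0 ≤ relErr r (gridSpacing r (s n / n)) := by
        have := e.le
        rw [relErr]; positivity
      have hH := le_max_right (hConst r) 0
      rw [div_le_iff₀ f, mul_comm]
      exact ENNReal.toReal_le_of_le_ofReal (by positivity) (gridMaxRisk_le_rate_mul hr a b c d e)

end Asymptotics

end SparsePrediction

/-! ### The main theorem -/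

theorem theorem1 (r : ℝ≥0) (hr : 0 < r) (s : ℕ → ℝ)
    (hs : ∀ᶠ n in atTop, 1 ≤ s n)
    (hη : Tendsto (fun n : ℕ => s n / (n : ℝ)) atTop (𝓝 0)) :
    -- the maximum risk is `R_N (1 + h_r⁺ + o(1))`, with `R_N` positive and finite
    (∃ ε : ℕ → ℝ, Tendsto ε atTop (𝓝 0) ∧
      ∀ᶠ n : ℕ in atTop,
        0 < klMinimaxRisk r (sparseSet n (s n)) ∧
        klMinimaxRisk r (sparseSet n (s n)) < ⊤ ∧
        gridMaxRisk r n (s n) < ⊤ ∧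
        (gridMaxRisk r n (s n)).toReal =
          (klMinimaxRisk r (sparseSet n (s n))).toReal * (1 + max (hConst r) 0 + ε n)) ∧
    -- asymptotic minimaxity holds exactly when `r ≥ r₀`
    (Tendsto (fun n : ℕ => gridMaxRisk r n (s n) / klMinimaxRisk r (sparseSet n (s n)))
        atTop (𝓝 1) ↔ rCrit ≤ (r : ℝ)) ∧
    -- below `r₀` the maximum risk is too large by a constant factor in `(1, 5/4]`
    ((r : ℝ) < rCrit →
      1 < 1 + hConst r ∧ 1 + hConst r ≤ 5 / 4 ∧
      Tendsto (fun n : ℕ => gridMaxRisk r n (s n) / klMinimaxRisk r (sparseSet n (s n)))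
        atTop (𝓝 (ENNReal.ofReal (1 + hConst r)))) ∧
    -- for every `r` the maximum risk is eventually at most `5/4` times the minimax risk
    (∀ᶠ n : ℕ in atTop,
      gridMaxRisk r n (s n) ≤ (5 / 4) * klMinimaxRisk r (sparseSet n (s n))) := by
  have hr0 : r ≠ 0 := hr.ne'
  obtain ⟨hrate, hR, hG, hRt, hGt⟩ := tendsto_risks hr0 hs hη
  set R : ℕ → ℝ≥0∞ := fun n => klMinimaxRisk r (sparseSet n (s n)) with hRdef
  set G : ℕ → ℝ≥0∞ := fun n => gridMaxRisk r n (s n) with hGdef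
  have hRpos : ∀ᶠ n in atTop, 0 < (R n).toReal := by
    filter_upwards [hrate, hRt.eventually_const_lt one_pos] with n h1 h2
    exact (div_pos_iff_of_pos_right h1).1 h2
  have hratio : Tendsto (fun n => (G n).toReal / (R n).toReal) atTop
      (𝓝 (1 + max (hConst r) 0)) := by
    -- Both risks are compared with the same `rate`, which cancels in the quotient.
    have h := hGt.div hRt one_ne_zero
    rw [div_one] at h
    refine h.congr' ?_
    filter_upwards [hrate] with n h1
    exact div_div_div_cancel_right₀ h1.ne' _ _
  have hratio' : Tendsto (fun n => G n / R n) atTop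
      (𝓝 (ENNReal.ofReal (1 + max (hConst r) 0))) := by
    refine (ENNReal.tendsto_ofReal hratio).congr' ?_
    filter_upwards [hR, hG, hRpos] with n h1 h2 h3
    rw [ENNReal.ofReal_div_of_pos h3, ENNReal.ofReal_toReal h1.ne, ENNReal.ofReal_toReal h2.ne]
  have hquarter := hConst_lt_quarter hr0
  refine ⟨⟨fun n => (G n).toReal / (R n).toReal - (1 + max (hConst r) 0), ?_, ?_⟩, ?_, ?_, ?_⟩
  · simpa using hratio.sub_const (1 + max (hConst r) 0)
  · filter_upwards [hR, hG, hRpos] with n h1 h2 h3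
    refine ⟨(ENNReal.toReal_pos_iff.1 h3).1, h1, h2, ?_⟩
    rw [add_sub_cancel, mul_div_cancel₀ _ h3.ne']
  · constructor
    · intro h
      have heq := tendsto_nhds_unique hratio' h
      rw [ENNReal.ofReal_eq_one] at heq
      by_contra hcon
      have := hConst_pos_iff.2 (not_le.1 hcon)
      have := le_max_left (hConst r) 0
      linarith
    · intro h
      have h0 : hConst r ≤ 0 := not_lt.1 fun hlt => absurd (hConst_pos_iff.1 hlt) (not_lt.2 h)
      rwa [max_eq_right h0, add_zero, ENNReal.ofReal_one] at hratio'
  · intro h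
    have h0 := hConst_pos_iff.2 h
    rw [max_eq_left h0.le] at hratio'
    exact ⟨by linarith, by linarith, hratio'⟩
  · have hlt : 1 + max (hConst r) 0 < 5 / 4 := by
      have : max (hConst r) 0 < 1 / 4 := max_lt hquarter (by norm_num)
      linarith
    filter_upwards [hratio.eventually_lt_const hlt, hR, hG, hRpos] with n h1 h2 h3 h4
    rw [div_lt_iff₀ h4] at h1
    have h5 : ENNReal.ofReal (5 / 4) = 5 / 4 := by
      rw [ENNReal.ofReal_div_of_pos (by norm_num), ENNReal.ofReal_ofNat, ENNReal.ofReal_ofNat]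
    calc G n = ENNReal.ofReal (G n).toReal := (ENNReal.ofReal_toReal h3.ne).symm
      _ ≤ ENNReal.ofReal (5 / 4 * (R n).toReal) := ENNReal.ofReal_le_ofReal h1.le
      _ = 5 / 4 * R n := by
          rw [ENNReal.ofReal_mul (by norm_num), ENNReal.ofReal_toReal h2.ne, h5]
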